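/- Let $q:\mathbb Z\to\mathbb R$ satisfy $\sum_{n}\langle n\rangle|q(n)|<\infty$ with $\langle n\rangle=\sqrt{1+n^2}$ (that is, $q\in\ell^{1,1}$), and let $H=-\Delta+q$ on $\ell^2(\mathbb Z)$, where $(\Delta u)(n)=u(n+1)+u(n-1)-2u(n)$. Let $\ell^2_c(H)$ be the orthogonal complement in $\ell^2$ of the span of the eigenvectors of $H$. Let $L^2(\mathbb T)$, $\mathbb T=\mathbb R/2\pi\mathbb Z$, be taken with respect to $d\theta$ on $(-\pi,\pi]$. For each $\theta\in\mathbb R$ there is exactly one solution $f_+(\cdot,\theta)$ of $-\Delta f+qf=2(1-\cos\theta)f$ on $\mathbb Z$ with $f_+(n,\theta)-e^{-in\theta}\to0$ as $n\to+\infty$, and exactly one solution $f_-(\cdot,\theta)$ with $f_-(n,\theta)-e^{in\theta}\to0$ as $n\to-\infty$. Put $m_\pm(n,\theta)=e^{\pm in\theta}f_\pm(n,\theta)$, let $w(\theta)=f_+(n+1,\theta)f_-(n,\theta)-f_+(n,\theta)f_-(n+1,\theta)$ be the Wronskian, which does not depend on $n$, and let $T(\theta)=-2i\sin\theta/w(\theta)$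 be the transmission coefficient; $w(\theta)\neq0$ whenever $\sin\theta\ne0$. Define for $\theta\in[-\pi,\pi]$ (up to the null set $\sin\theta=0$) $$\psi(n,\theta)=\tfrac1{\sqrt{2\pi}}T(\theta)e^{-in\theta}m_+(n,\theta)\ \ (\theta\ge0),\qquad \psi(n,\theta)=\tfrac1{\sqrt{2\pi}}T(-\theta)e^{-in\theta}m_-(n,-\theta)\ \ (\theta<0).$$ For each $n$, $\psi(n,\cdot)\in L^2(\mathbb T)$, and for $u\in\ell^2$ the series $$F[u](\theta)=\sum_n\psi(n,\theta)u(n),\qquad F_0[u](\theta)=\tfrac1{\sqrt{2\pi}}\sum_ne^{-in\theta}u(n)$$ converge unconditionally in $L^2(\mathbb T)$. For $f\in L^2(\mathbb T)$ put $F^*[f](n)=\int_{-\pi}^{\pi}\overline{\psi(n,\theta)}f(\theta)\,d\theta$. Then: 1. $F:\ell^2_c(H)\to L^2(\mathbb T)$ is an isometric isomorphism (onto). 2. $F^*$ is its inverse; in particular $F^*[f]\in\ell^2_c(H)$ for all $f\in L^2(\mathbb T)$. 3. $F[Hu](\theta)=2(1-\cos\theta)F[u](\theta)$ for almost every $\theta$,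 for all $u\in\ell^2$. 4. For every $u\in\ell^2$ the limits $W_\pm u=\lim_{t\to\pm\infty}e^{itH}e^{it\Delta}u$ exist in $\ell^2$, and $$W_-=F^*F_0,\qquad (W_+u)(n)=\int_{-\pi}^{\pi}\psi(n,-\theta)\,F_0[u](\theta)\,d\theta ,$$ that is, $W_+=G^*F_0$, where $G$ is the transform $F$ with $\psi(n,\theta)$ replaced by $\overline{\psi(n,-\theta)}$. -/

import Mathlib

open scoped ENNReal Topology

namespace DiscreteSchrodinger

noncomputable section

/-- The complex Hilbert space of square summable functions on the integers. -/
abbrev Ell2 : Type := lp (fun _ : ℤ => ℂ) 2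

/-- The circle of length `2π`, as the fundamental domain `(-π, π]` with the measure `dθ`. -/
abbrev torusMeasure : MeasureTheory.Measure ℝ :=
  MeasureTheory.volume.restrict (Set.Ioc (-Real.pi) Real.pi)

/-- The space of square integrable functions on the circle, with respect to `dθ`. -/
abbrev L2Torus : Type := MeasureTheory.Lp ℂ 2 torusMeasure

/-- The weighted space of potentials `q` with `∑ ⟨n⟩ |q n| < ∞`, where `⟨n⟩ = √(1 + n²)`. -/
def MemEllOneOne (q : ℤ → ℝ) : Prop :=
  Summable fun n : ℤ => Real.sqrt (1 + (n : ℝ) ^ 2) * |q n|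

/-! ### The operators on square summable functions -/

theorem memlp_shift (k : ℤ) (u : Ell2) : Memℓp (fun n : ℤ => u (n + k)) 2 := by
  apply memℓp_gen
  have h := (memℓp_gen_iff (p := 2) (by norm_num)).1 (lp.memℓp u)
  exact (Equiv.addRight k).summable_iff.2 h

/-- The translation `u ↦ (n ↦ u (n + k))`. -/
def shift (k : ℤ) : Ell2 →ₗᵢ[ℂ] Ell2 where
  toFun u := ⟨fun n => u (n + k), memlp_shift k u⟩
  map_add' _ _ := rfl
  map_smul' _ _ := rfl
  norm_map' u := by
    have h2 : (0 : ℝ) < (2 : ℝ≥0∞).toReal := by norm_num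
    rw [lp.norm_eq_tsum_rpow h2, lp.norm_eq_tsum_rpow h2]
    congr 1
    exact (Equiv.addRight k).tsum_eq fun n : ℤ => ‖u n‖ ^ (2 : ℝ≥0∞).toReal

/-- The discrete Laplacian `(Δu)(n) = u(n+1) + u(n-1) - 2u(n)`. -/
def laplacian : Ell2 →L[ℂ] Ell2 :=
  (shift 1).toContinuousLinearMap + (shift (-1)).toContinuousLinearMap
    - (2 : ℂ) • ContinuousLinearMap.id ℂ Ell2

theorem MemEllOneOne.abs_le {q : ℤ → ℝ} (hq : MemEllOneOne q) (n : ℤ) :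
    |q n| ≤ ∑' m : ℤ, Real.sqrt (1 + (m : ℝ) ^ 2) * |q m| := by
  have h1 : 1 ≤ Real.sqrt (1 + (n : ℝ) ^ 2) := by
    rw [Real.one_le_sqrt]
    nlinarith [sq_nonneg (n : ℝ)]
  calc |q n| ≤ Real.sqrt (1 + (n : ℝ) ^ 2) * |q n| := le_mul_of_one_le_left (abs_nonneg _) h1
    _ ≤ _ := Summable.le_tsum hq n fun m _ => by positivity

/-- Multiplication by the potential `q`. -/
def potential (q : ℤ → ℝ) (hq : MemEllOneOne q) : Ell2 →L[ℂ] Ell2 :=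
  lp.mapCLM 2 (fun n : ℤ => (q n : ℂ) • ContinuousLinearMap.id ℂ ℂ)
    (K := ∑' m : ℤ, Real.sqrt (1 + (m : ℝ) ^ 2) * |q m|)
    (tsum_nonneg fun m => by positivity) fun n => by
      refine (norm_smul_le _ _).trans ?_
      rw [Complex.norm_real, Real.norm_eq_abs, ContinuousLinearMap.norm_id, mul_one]
      exact hq.abs_le n

/-- The discrete Schroedinger operator `H = -Δ + q`. -/
def hamiltonian (q : ℤ → ℝ) (hq : MemEllOneOne q) : Ell2 →L[ℂ] Ell2 :=
  -laplacian + potential q hq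

theorem hamiltonian_apply (q : ℤ → ℝ) (hq : MemEllOneOne q) (u : Ell2) (n : ℤ) :
    hamiltonian q hq u n = -(u (n + 1) + u (n - 1) - 2 * u n) + q n * u n := by
  change -(u (n + 1) + u (n + -1) - 2 * u n) + (q n : ℂ) * u n = _
  rw [sub_eq_add_neg n 1]

/-- The subspace spanned by the eigenvectors of `H`. -/
def eigenspan (q : ℤ → ℝ) (hq : MemEllOneOne q) : Submodule ℂ Ell2 :=
  ⨆ z : ℂ, Module.End.eigenspace (hamiltonian q hq : Ell2 →ₗ[ℂ] Ell2) z

/-- The space `ℓ²_c(H)`: the orthogonal complement of the eigenvectors of `H`, which is the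
range of the orthogonal projection `P_c(H)`. -/
def continuousSubspace (q : ℤ → ℝ) (hq : MemEllOneOne q) : Submodule ℂ Ell2 :=
  (eigenspan q hq)ᗮ

/-- The unitary group `e^{itA}`. -/
def expI (A : Ell2 →L[ℂ] Ell2) (t : ℝ) : Ell2 →L[ℂ] Ell2 :=
  NormedSpace.exp ((Complex.I * (t : ℂ)) • A)

/-! ### Jost functions and plane waves -/

/-- `f` solves `-Δf + qf = z f` at every point, with `z = 2(1 - cos θ)`. -/
def IsGeneralizedEigenfunction (q : ℤ → ℝ) (θ : ℝ) (f : ℤ → ℂ) : Prop :=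
  ∀ n : ℤ, -(f (n + 1) + f (n - 1) - 2 * f n) + q n * f n
    = ((2 * (1 - Real.cos θ) : ℝ) : ℂ) * f n

/-- The exponential `e^{iθn}`. -/
def wave (θ : ℝ) (n : ℤ) : ℂ := Complex.exp (Complex.I * θ * n)

/-- `f` is the Jost solution at `+∞`: it behaves there like `e^{-inθ}`. -/
def IsJostPlus (q : ℤ → ℝ) (θ : ℝ) (f : ℤ → ℂ) : Prop :=
  IsGeneralizedEigenfunction q θ f ∧
    Filter.Tendsto (fun n : ℤ => f n - wave (-θ) n) Filter.atTop (𝓝 0)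

/-- `f` is the Jost solution at `-∞`: it behaves there like `e^{inθ}`. -/
def IsJostMinus (q : ℤ → ℝ) (θ : ℝ) (f : ℤ → ℂ) : Prop :=
  IsGeneralizedEigenfunction q θ f ∧
    Filter.Tendsto (fun n : ℤ => f n - wave θ n) Filter.atBot (𝓝 0)

/-- The Jost function `f₊(n, θ)`. -/
def jostPlus (q : ℤ → ℝ) (n : ℤ) (θ : ℝ) : ℂ := Classical.epsilon (IsJostPlus q θ) n

/-- The Jost function `f₋(n, θ)`. -/
def jostMinus (q : ℤ → ℝ) (n : ℤ) (θ : ℝ) : ℂ := Classical.epsilon (IsJostMinus q θ) n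

/-- `m₊`, with `f₊(n, θ) = e^{-inθ} m₊(n, θ)`. -/
def mPlus (q : ℤ → ℝ) (n : ℤ) (θ : ℝ) : ℂ := wave θ n * jostPlus q n θ

/-- `m₋`, with `f₋(n, θ) = e^{inθ} m₋(n, θ)`. -/
def mMinus (q : ℤ → ℝ) (n : ℤ) (θ : ℝ) : ℂ := wave (-θ) n * jostMinus q n θ

/-- The Wronskian `[f₊, f₋]`; it does not depend on the point, so it is taken at `0`. -/
def jostWronskian (q : ℤ → ℝ) (θ : ℝ) : ℂ :=
  jostPlus q 1 θ * jostMinus q 0 θ - jostPlus q 0 θ * jostMinus q 1 θ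

/-- The transmission coefficient `T(θ) = -2i sin θ / [f₊(θ), f₋(θ)]`. -/
def transmission (q : ℤ → ℝ) (θ : ℝ) : ℂ :=
  -(2 * Complex.I * Real.sin θ) / jostWronskian q θ

/-- The plane waves `ψ(n, θ)`, for `θ ∈ [-π, π]`. -/
def planeWave (q : ℤ → ℝ) (n : ℤ) (θ : ℝ) : ℂ :=
  if 0 ≤ θ then
    ((Real.sqrt (2 * Real.pi) : ℝ) : ℂ)⁻¹ * transmission q θ * wave (-θ) n * mPlus q n θ
  else
    ((Real.sqrt (2 * Real.pi) : ℝ) : ℂ)⁻¹ * transmission q (-θ) * wave (-θ) n * mMinus q n (-θ)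

/-- The free plane waves `e^{-inθ} / √(2π)`. -/
def freeWave (n : ℤ) (θ : ℝ) : ℂ := ((Real.sqrt (2 * Real.pi) : ℝ) : ℂ)⁻¹ * wave (-θ) n

/-! ### Fourier transforms -/

open Classical in
/-- A function as an element of `L²(𝕋)` (zero if it is not square integrable). -/
def toL2 (f : ℝ → ℂ) : L2Torus :=
  if h : MeasureTheory.MemLp f 2 torusMeasure then h.toLp f else 0

/-- The `n`-th term `u(n) k(n, ·)` of the transform of `u` with kernel `k`. -/
def transformTerm (k : ℤ → ℝ → ℂ) (u : Ell2) (n : ℤ) : L2Torus := u n • toL2 (k n)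

/-- The transform `∑ₙ k(n, ·) u(n)`, a sum in the sense of `L²(𝕋)`. -/
def transform (k : ℤ → ℝ → ℂ) (u : Ell2) : L2Torus := ∑' n : ℤ, transformTerm k u n

/-- The distorted Fourier transform `F[u](θ) = ∑ₙ ψ(n, θ) u(n)`. -/
def distortedFourier (q : ℤ → ℝ) (u : Ell2) : L2Torus := transform (planeWave q) u

/-- The Fourier series `F₀[u](θ) = (2π)^{-1/2} ∑ₙ e^{-inθ} u(n)`. -/
def fourierSeries (u : Ell2) : L2Torus := transform freeWave u

/-- The function `F*[f](n) = ∫_{-π}^{π} conj ψ(n, θ) f(θ) dθ`. -/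
def distortedFourierAdj (q : ℤ → ℝ) (f : L2Torus) (n : ℤ) : ℂ :=
  ∫ θ in (-Real.pi)..Real.pi, (starRingEnd ℂ) (planeWave q n θ) * f θ

end

end DiscreteSchrodinger

open DiscreteSchrodinger

/-! The transform is studied through its adjoint `f ↦ (⟪ψ(n, ·), f⟫)ₙ`. Scattering theory shows that
this map is an isometry, and compactness identifies its range; neither resolvents nor spectral
measures are used.

Jost functions. They solve a Volterra equation with kernel `sin((k-n)θ)/sin θ`. The bound `k - n`
for the kernel is uniform in `θ`, so a finite first moment of `q` makes the equation a contraction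
far to the right. The bound `1/|sin θ|` shows that the error against the free wave is `O(1/n)`,
hence square summable, away from the thresholds `sin θ = 0`. Wronskian identities give `|T| ≤ 1`,
`|R| ≤ 1` and `T f₋ = conj f₊ + R f₊` (`norm_sq_jostWronskian`, `transmission_mul_jostMinus`).

Isometry. On `|sin θ| ≥ δ` the adjoint transform is a sum of free Fourier coefficients with bounded
amplitudes and a Hilbert–Schmidt remainder. Apply it to `e^{isλ} f` with `λ = 2(1 - cos θ)` and let
`s → +∞`. Non-stationary phase (`tendsto_coordProj_evol`) removes the transmitted and reflected
parts, and the remainder vanishes by weak convergence, so only the free evolution is left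
(`exists_bulkOp`). The adjoint transform carries `e^{isλ}` to `e^{isH}` and both preserve norms, so
it is an isometry (`norm_bulkOp`); then `δ → 0` (`exists_adjointTransform`). Hence `F F* = 1`, and
the same asymptotics give `W₋ = F* F₀`. Complex conjugation reverses time and gives `W₊`.

Range. An `ℓ²` solution at an energy in `[0, 4]` vanishes, by comparison with the Jost solution, and
at any other energy `F` kills eigenvectors, because `(λ - z) F v = 0`. So `F*` maps into `ℓ²_c(H)`.

Completeness. It remains to see that `F` is injective on `ℓ²_c(H)`. For `q` of finite support the
Jost functions are trigonometric polynomials; testing `ker F` against suitable functions gives a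
banded recurrence, so `ker F` is finite dimensional (`finiteDimensional_ker_transformOp`). As `H -
2` has no eigenvalue in `(-2, 2)`, it follows that `‖(H-2)v‖ ≥ 2‖v‖` on `ker F`. Put in a form that
survives strong limits (`gap_of_finite`), this passes to general `q` by truncation. On the other
hand `(H-2)² ≤ 4` up to a compact error. On `ker F ∩ ℓ²_c(H)` the operator `(H-2)² - 4` is therefore
nonnegative and compact, and a nonzero space would contain an eigenvector of it, hence one of `H`,
which is impossible (`defect_eq_bot`). -/

namespace DiscreteSchrodinger

noncomputable section

open Filter

/-! ### Plane waves -/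

theorem wave_eq (θ : ℝ) (n : ℤ) : wave θ n = Complex.exp (((θ * n : ℝ) : ℂ) * Complex.I) := by
  unfold wave; push_cast; ring_nf

theorem wave_zero (θ : ℝ) : wave θ 0 = 1 := by simp [wave]

theorem wave_add (θ : ℝ) (m n : ℤ) : wave θ (m + n) = wave θ m * wave θ n := by
  simp only [wave, ← Complex.exp_add]; push_cast; ring_nf

theorem wave_neg (θ : ℝ) (n : ℤ) : wave (-θ) n = wave θ (-n) := by
  simp [wave]

theorem norm_wave (θ : ℝ) (n : ℤ) : ‖wave θ n‖ = 1 := by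
  rw [wave_eq]; exact Complex.norm_exp_ofReal_mul_I _

theorem conj_wave (θ : ℝ) (n : ℤ) : (starRingEnd ℂ) (wave θ n) = wave (-θ) n := by
  simp [wave, ← Complex.exp_conj]

theorem wave_mul_wave_neg (θ : ℝ) (n : ℤ) : wave θ n * wave (-θ) n = 1 := by
  rw [wave_neg, ← wave_add, add_neg_cancel, wave_zero]

theorem wave_neg_mul_wave (θ : ℝ) (n : ℤ) : wave (-θ) n * wave θ n = 1 := by
  rw [mul_comm, wave_mul_wave_neg]

theorem continuous_wave (n : ℤ) : Continuous fun θ : ℝ => wave θ n := by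
  unfold wave; fun_prop

theorem wave_one_add (θ : ℝ) : wave θ 1 + wave (-θ) 1 = 2 * Real.cos θ := by
  simp only [wave]
  push_cast
  rw [Complex.two_cos]
  ring_nf

theorem wave_one_sub (θ : ℝ) : wave θ 1 - wave (-θ) 1 = 2 * Complex.I * Real.sin θ := by
  simp only [wave]
  push_cast
  rw [show (2 : ℂ) * Complex.I * Complex.sin θ = Complex.I * (2 * Complex.sin θ) by ring,
    Complex.two_sin]
  ring_nf
  simp [Complex.I_sq]
  ring

theorem wave_rec (θ : ℝ) (n : ℤ) :
    wave θ (n + 1) + wave θ (n - 1) = 2 * Real.cos θ * wave θ n := by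
  rw [sub_eq_add_neg, wave_add, wave_add, ← wave_one_add, wave_neg]; ring

/-! ### Solutions of the difference equation -/

theorem isGeneralizedEigenfunction_iff {q : ℤ → ℝ} {θ : ℝ} {f : ℤ → ℂ} :
    IsGeneralizedEigenfunction q θ f ↔
      ∀ n, f (n + 1) + f (n - 1) = (2 * Real.cos θ + q n) * f n := by
  refine forall_congr' fun n => ?_
  push_cast
  constructor <;> intro h <;> linear_combination -h

theorem IsGeneralizedEigenfunction.const_mul {q : ℤ → ℝ} {θ : ℝ} {f : ℤ → ℂ}
    (hf : IsGeneralizedEigenfunction q θ f) (c : ℂ) :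
    IsGeneralizedEigenfunction q θ (fun n => c * f n) := by
  rw [isGeneralizedEigenfunction_iff] at *
  intro n
  linear_combination c * hf n

theorem IsGeneralizedEigenfunction.sub {q : ℤ → ℝ} {θ : ℝ} {f g : ℤ → ℂ}
    (hf : IsGeneralizedEigenfunction q θ f) (hg : IsGeneralizedEigenfunction q θ g) :
    IsGeneralizedEigenfunction q θ (fun n => f n - g n) := by
  rw [isGeneralizedEigenfunction_iff] at *
  intro n
  linear_combination hf n - hg n

theorem IsGeneralizedEigenfunction.conj {q : ℤ → ℝ} {θ : ℝ} {f : ℤ → ℂ}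
    (hf : IsGeneralizedEigenfunction q θ f) :
    IsGeneralizedEigenfunction q θ (fun n => (starRingEnd ℂ) (f n)) := by
  rw [isGeneralizedEigenfunction_iff] at *
  intro n
  have h := congrArg (starRingEnd ℂ) (hf n)
  simpa only [map_add, map_mul, Complex.conj_ofReal, map_ofNat] using h

theorem IsGeneralizedEigenfunction.neg_angle {q : ℤ → ℝ} {θ : ℝ} {f : ℤ → ℂ}
    (hf : IsGeneralizedEigenfunction q θ f) : IsGeneralizedEigenfunction q (-θ) f := by
  rw [isGeneralizedEigenfunction_iff] at *
  simpa using hf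

/-- The Wronskian `[f, g]` at `n`. -/
def wronsk (f g : ℤ → ℂ) (n : ℤ) : ℂ := f (n + 1) * g n - f n * g (n + 1)

theorem wronsk_const {q : ℤ → ℝ} {θ : ℝ} {f g : ℤ → ℂ}
    (hf : IsGeneralizedEigenfunction q θ f) (hg : IsGeneralizedEigenfunction q θ g) (n : ℤ) :
    wronsk f g n = wronsk f g 0 := by
  rw [isGeneralizedEigenfunction_iff] at *
  have step : ∀ k : ℤ, wronsk f g k = wronsk f g (k - 1) := fun k => by
    have h1 := hf k
    have h2 := hg k
    simp only [wronsk, sub_add_cancel]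
    linear_combination g k * h1 - f k * h2
  induction n using Int.induction_on with
  | zero => rfl
  | succ k ih => rw [step, add_sub_cancel_right, ih]
  | pred k ih => rw [← ih, step (-k)]

theorem IsGeneralizedEigenfunction.eq_zero {q : ℤ → ℝ} {θ : ℝ} {f : ℤ → ℂ}
    (hf : IsGeneralizedEigenfunction q θ f) {n : ℤ} (h0 : f n = 0) (h1 : f (n + 1) = 0) (k : ℤ) :
    f k = 0 := by
  rw [isGeneralizedEigenfunction_iff] at hf
  have key : ∀ j : ℤ, f (n + j) = 0 ∧ f (n + j + 1) = 0 := by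
    intro j
    induction j using Int.induction_on with
    | zero => simpa using ⟨h0, h1⟩
    | succ j ih =>
      have h := hf (n + j + 1)
      rw [add_sub_cancel_right, ih.1, ih.2] at h
      rw [← add_assoc]
      exact ⟨ih.2, by simpa using h⟩
    | pred j ih =>
      have h := hf (n + -j)
      rw [ih.1, ih.2] at h
      rw [← add_sub_assoc, sub_add_cancel]
      exact ⟨by simpa using h, ih.1⟩
  simpa using (key (k - n)).1

/-- Every solution is a combination of two given ones. -/
theorem wronsk_expansion {q : ℤ → ℝ} {θ : ℝ} {f g h : ℤ → ℂ}
    (hf : IsGeneralizedEigenfunction q θ f) (hg : IsGeneralizedEigenfunction q θ g)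
    (hh : IsGeneralizedEigenfunction q θ h) (n : ℤ) :
    wronsk f g 0 * h n = wronsk h g 0 * f n + wronsk f h 0 * g n := by
  have h1 := wronsk_const hf hg n
  have h2 := wronsk_const hh hg n
  have h3 := wronsk_const hf hh n
  rw [← h1, ← h2, ← h3]
  simp only [wronsk]
  ring

theorem tendsto_norm_one_of_jostPlus {q : ℤ → ℝ} {θ : ℝ} {f : ℤ → ℂ} (hf : IsJostPlus q θ f) :
    Tendsto (fun n => ‖f n‖) atTop (𝓝 1) := by
  rw [tendsto_iff_norm_sub_tendsto_zero]
  refine squeeze_zero (fun _ => norm_nonneg _) (fun n => ?_) (by simpa using hf.2.norm)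
  have := abs_norm_sub_norm_le (f n) (wave (-θ) n)
  rwa [norm_wave] at this

/-- A decaying solution vanishes when there is a Jost solution. -/
theorem eq_zero_of_tendsto_zero {q : ℤ → ℝ} {θ : ℝ} {f d : ℤ → ℂ} (hf : IsJostPlus q θ f)
    (hd : IsGeneralizedEigenfunction q θ d) (h0 : Tendsto d atTop (𝓝 0)) (n : ℤ) : d n = 0 := by
  have hN := tendsto_norm_one_of_jostPlus hf
  have hd1 : Tendsto (fun n : ℤ => d (n + 1)) atTop (𝓝 0) :=
    h0.comp (tendsto_atTop_add_const_right _ 1 tendsto_id)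
  have hN1 : Tendsto (fun n : ℤ => ‖f (n + 1)‖) atTop (𝓝 1) :=
    hN.comp (tendsto_atTop_add_const_right _ 1 tendsto_id)
  -- The Wronskian is constant and tends to zero, so `d` is a multiple of `f`; since `‖f‖ → 1`, the
  -- multiple is zero. Nothing here needs `sin θ ≠ 0`, so the thresholds are covered.
  have hw0 : wronsk f d 0 = 0 := by
    have h1 : Tendsto (fun n => wronsk f d n) atTop (𝓝 0) := by
      have : Tendsto (fun n : ℤ => ‖f (n + 1)‖ * ‖d n‖ + ‖f n‖ * ‖d (n + 1)‖) atTop (𝓝 0) := by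
        simpa using (hN1.mul h0.norm).add (hN.mul hd1.norm)
      refine squeeze_zero_norm (fun n => ?_) this
      refine (norm_sub_le _ _).trans ?_
      rw [norm_mul, norm_mul]
    have h2 : (fun n => wronsk f d n) = fun _ => wronsk f d 0 :=
      funext fun n => wronsk_const hf.1 hd n
    rw [h2] at h1
    exact tendsto_nhds_unique tendsto_const_nhds h1
  obtain ⟨m, hm⟩ := (hN.eventually (lt_mem_nhds (show (0 : ℝ) < 1 by norm_num))).exists
  have hfm : f m ≠ 0 := norm_pos_iff.1 hm
  set c := d m / f m with hc
  have hz := (hd.sub (hf.1.const_mul c)).eq_zero (n := m) (by rw [hc]; field_simp; ring) (by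
    have h := (wronsk_const hf.1 hd m).trans hw0
    rw [wronsk] at h
    rw [hc]; field_simp
    linear_combination -h)
  have heq : ∀ k, d k = c * f k := fun k => sub_eq_zero.1 (hz k)
  have hc0 : ‖c‖ = 0 := by
    have h1 : Tendsto (fun n => ‖d n‖) atTop (𝓝 (‖c‖ * 1)) := by
      simp_rw [heq, norm_mul]
      exact hN.const_mul _
    have h2 : Tendsto (fun n => ‖d n‖) atTop (𝓝 0) := by simpa using h0.norm
    simpa using tendsto_nhds_unique h1 h2
  rw [heq, norm_eq_zero.1 hc0, zero_mul]

theorem IsJostPlus.unique {q : ℤ → ℝ} {θ : ℝ} {f g : ℤ → ℂ} (hf : IsJostPlus q θ f)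
    (hg : IsJostPlus q θ g) : f = g := by
  funext n
  have := eq_zero_of_tendsto_zero hf (hf.1.sub hg.1) (by simpa using hf.2.sub hg.2) n
  exact sub_eq_zero.1 this

/-! ### The Volterra kernel -/

/-- The kernel `sin(jθ) / sin θ`. -/
def sineKernel (θ : ℝ) : ℕ → ℝ
  | 0 => 0
  | j + 1 => Real.cos θ * sineKernel θ j + Real.cos (j * θ)

/-- The recursive definition gives the kernel a meaning at `sin θ = 0` too; this identity recovers
the quotient elsewhere. -/
theorem sin_mul_sineKernel (θ : ℝ) (j : ℕ) : Real.sin θ * sineKernel θ j = Real.sin (j * θ) := by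
  induction j with
  | zero => simp [sineKernel]
  | succ j ih =>
    rw [sineKernel, Nat.cast_succ, add_mul, one_mul, Real.sin_add]
    linear_combination Real.cos θ * ih

theorem abs_sineKernel_le (θ : ℝ) (j : ℕ) : |sineKernel θ j| ≤ j := by
  induction j with
  | zero => simp [sineKernel]
  | succ j ih =>
    rw [sineKernel, Nat.cast_succ]
    refine (abs_add_le _ _).trans (add_le_add ?_ (Real.abs_cos_le_one _))
    rw [abs_mul]
    exact (mul_le_of_le_one_left (abs_nonneg _) (Real.abs_cos_le_one _)).trans ih

/-- The bound by `j` is uniform in `θ` and serves existence; this one costs no moment of `q` and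
serves decay in `n` away from the thresholds. -/
theorem abs_sineKernel_le_inv {θ : ℝ} (h : Real.sin θ ≠ 0) (j : ℕ) :
    |sineKernel θ j| ≤ |Real.sin θ|⁻¹ := by
  have h1 := congrArg abs (sin_mul_sineKernel θ j)
  rw [abs_mul] at h1
  have h2 : 0 < |Real.sin θ| := abs_pos.2 h
  rw [← mul_le_mul_iff_of_pos_left h2, h1, mul_inv_cancel₀ h2.ne']
  exact Real.abs_sin_le_one _

theorem sineKernel_rec (θ : ℝ) (j : ℕ) :
    sineKernel θ (j + 2) + sineKernel θ j = 2 * Real.cos θ * sineKernel θ (j + 1) := by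
  have h := sin_mul_sineKernel θ j
  have h2 := Real.sin_sq_add_cos_sq θ
  simp only [sineKernel, Nat.cast_succ, add_mul, one_mul, Real.cos_add]
  linear_combination Real.sin θ * h - sineKernel θ j * h2

/-! ### Tails of the potential -/

theorem MemEllOneOne.of_abs_le {q p : ℤ → ℝ} (hq : MemEllOneOne q) (h : ∀ n, |p n| ≤ |q n|) :
    MemEllOneOne p :=
  Summable.of_nonneg_of_le (fun _ => by positivity)
    (fun n => mul_le_mul_of_nonneg_left (h n) (Real.sqrt_nonneg _)) hq

/-- The reflected potential. -/
def reflect (q : ℤ → ℝ) : ℤ → ℝ := fun n => q (-n)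

theorem MemEllOneOne.reflect {q : ℤ → ℝ} (hq : MemEllOneOne q) : MemEllOneOne (reflect q) := by
  unfold MemEllOneOne DiscreteSchrodinger.reflect at *
  rw [← (Equiv.neg ℤ).summable_iff] at hq
  simpa [Function.comp_def] using hq

theorem le_sqrt_one_add_sq (x : ℝ) : x ≤ Real.sqrt (1 + x ^ 2) :=
  Real.le_sqrt_of_sq_le (by linarith)

theorem MemEllOneOne.summable_nat {q : ℤ → ℝ} (hq : MemEllOneOne q) (n : ℕ) :
    Summable fun j : ℕ =>
      Real.sqrt (1 + (((n : ℤ) + 1 + j : ℤ) : ℝ) ^ 2) * |q (n + 1 + j)| :=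
  hq.comp_injective (i := fun j : ℕ => (n : ℤ) + 1 + j) fun a b h => by simpa using h

theorem moment_term_le (q : ℤ → ℝ) (n j : ℕ) :
    ((j : ℝ) + 1) * |q (n + 1 + j)| ≤
      Real.sqrt (1 + (((n : ℤ) + 1 + j : ℤ) : ℝ) ^ 2) * |q (n + 1 + j)| := by
  refine mul_le_mul_of_nonneg_right (le_trans ?_ (le_sqrt_one_add_sq _)) (abs_nonneg _)
  push_cast
  linarith [(Nat.cast_nonneg n : (0 : ℝ) ≤ n)]

/-- The first moment `∑_{k > n} (k - n) |q k|`. -/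
def tailMoment (q : ℤ → ℝ) (n : ℕ) : ℝ := ∑' j : ℕ, ((j : ℝ) + 1) * |q (n + 1 + j)|

/-- The tail `∑_{k > n} |q k|`. -/
def tailSum (q : ℤ → ℝ) (n : ℕ) : ℝ := ∑' j : ℕ, |q (n + 1 + j)|

theorem MemEllOneOne.summable_moment {q : ℤ → ℝ} (hq : MemEllOneOne q) (n : ℕ) :
    Summable fun j : ℕ => ((j : ℝ) + 1) * |q (n + 1 + j)| :=
  Summable.of_nonneg_of_le (fun _ => by positivity) (moment_term_le q n) (hq.summable_nat n)

theorem MemEllOneOne.summable_tail {q : ℤ → ℝ} (hq : MemEllOneOne q) (n : ℕ) :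
    Summable fun j : ℕ => |q (n + 1 + j)| :=
  Summable.of_nonneg_of_le (fun _ => by positivity)
    (fun j => le_mul_of_one_le_left (abs_nonneg _) (by linarith [(Nat.cast_nonneg j : (0 : ℝ) ≤ j)]))
    (hq.summable_moment n)

theorem MemEllOneOne.tendsto_tailMoment {q : ℤ → ℝ} (hq : MemEllOneOne q) :
    Tendsto (tailMoment q) atTop (𝓝 0) := by
  have h := (tendsto_sum_nat_add fun k : ℕ =>
    Real.sqrt (1 + ((k : ℤ) : ℝ) ^ 2) * |q k|).comp (tendsto_add_atTop_nat 1)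
  refine squeeze_zero (fun n => tsum_nonneg fun _ => by positivity) (fun n => ?_) h
  have e : ∀ j : ℕ, ((j + (n + 1) : ℕ) : ℤ) = n + 1 + j := fun j => by push_cast; ring
  simp only [Function.comp_apply, e]
  exact (hq.summable_moment n).tsum_le_tsum (moment_term_le q n) (hq.summable_nat n)

/-- Beyond `n` the weight is at least `n + 1`. The resulting rate `1/n` is square summable, which is
what the Hilbert–Schmidt remainder needs. -/
theorem MemEllOneOne.tailSum_le {q : ℤ → ℝ} (hq : MemEllOneOne q) :
    ∃ A : ℝ, 0 ≤ A ∧ ∀ n : ℕ, tailSum q n ≤ A / (n + 1) := by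
  refine ⟨∑' m : ℤ, Real.sqrt (1 + (m : ℝ) ^ 2) * |q m|, tsum_nonneg fun _ => by positivity,
    fun n => ?_⟩
  rw [le_div_iff₀ (by positivity), tailSum, ← tsum_mul_right]
  refine Summable.tsum_le_tsum_of_inj (fun j : ℕ => (n : ℤ) + 1 + j)
    (fun a b h => by simpa using h) (fun _ _ => by positivity) (fun j => ?_)
    ((hq.summable_tail n).mul_right _) hq
  rw [mul_comm]
  refine mul_le_mul_of_nonneg_right (le_trans ?_ (le_sqrt_one_add_sq _)) (abs_nonneg _)
  push_cast
  linarith [(Nat.cast_nonneg j : (0 : ℝ) ≤ j)]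

theorem tailMoment_mono {q p : ℤ → ℝ} (hq : MemEllOneOne q) (h : ∀ n, |p n| ≤ |q n|) (n : ℕ) :
    tailMoment p n ≤ tailMoment q n :=
  ((hq.of_abs_le h).summable_moment n).tsum_le_tsum
    (fun j => mul_le_mul_of_nonneg_left (h _) (by positivity)) (hq.summable_moment n)

/-- From `n₀` on, the moments of `q` are small. -/
def SmallFrom (q : ℤ → ℝ) (n₀ : ℕ) : Prop := ∀ n : ℕ, n₀ ≤ n → tailMoment q n ≤ 1 / 2

theorem MemEllOneOne.exists_smallFrom {q : ℤ → ℝ} (hq : MemEllOneOne q) :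
    ∃ n₀, SmallFrom q n₀ :=
  eventually_atTop.1 (hq.tendsto_tailMoment.eventually (ge_mem_nhds (by norm_num)))

/-! ### The Volterra equation -/

/-- The integral term `∑_{k > n} sin((k-n)θ)/sin θ q(k) f(k)`. -/
def volterraTerm (q : ℤ → ℝ) (θ : ℝ) (f : ℤ → ℂ) (n : ℕ) (j : ℕ) : ℂ :=
  ((sineKernel θ (j + 1) * q (n + 1 + j) : ℝ) : ℂ) * f (n + 1 + j)

def volterra (q : ℤ → ℝ) (θ : ℝ) (f : ℤ → ℂ) (n : ℕ) : ℂ := ∑' j : ℕ, volterraTerm q θ f n j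

theorem norm_volterraTerm_le {q : ℤ → ℝ} {θ : ℝ} {f : ℤ → ℂ} {n : ℕ} {C : ℝ}
    (hf : ∀ k : ℕ, n < k → ‖f k‖ ≤ C) (j : ℕ) :
    ‖volterraTerm q θ f n j‖ ≤ ((j : ℝ) + 1) * |q (n + 1 + j)| * C := by
  rw [volterraTerm, norm_mul, Complex.norm_real, Real.norm_eq_abs, abs_mul]
  have h1 := abs_sineKernel_le θ (j + 1)
  have h2 := hf (n + 1 + j) (by omega)
  push_cast at h1 h2
  gcongr

theorem summable_volterraTerm {q : ℤ → ℝ} (hq : MemEllOneOne q) {θ : ℝ} {f : ℤ → ℂ} {n : ℕ} {C : ℝ}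
    (hf : ∀ k : ℕ, n < k → ‖f k‖ ≤ C) : Summable (volterraTerm q θ f n) :=
  Summable.of_norm_bounded ((hq.summable_moment n).mul_right C) (norm_volterraTerm_le hf)

theorem norm_volterra_le {q : ℤ → ℝ} (hq : MemEllOneOne q) {θ : ℝ} {f : ℤ → ℂ} {n : ℕ} {C : ℝ}
    (hf : ∀ k : ℕ, n < k → ‖f k‖ ≤ C) : ‖volterra q θ f n‖ ≤ tailMoment q n * C := by
  rw [tailMoment, ← tsum_mul_right]
  exact tsum_of_norm_bounded ((hq.summable_moment n).mul_right C).hasSum (norm_volterraTerm_le hf)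

theorem norm_volterra_le_tailSum {q : ℤ → ℝ} (hq : MemEllOneOne q) {θ : ℝ}
    (hθ : Real.sin θ ≠ 0) {f : ℤ → ℂ} {n : ℕ} {C : ℝ}
    (hf : ∀ k : ℕ, n < k → ‖f k‖ ≤ C) :
    ‖volterra q θ f n‖ ≤ |Real.sin θ|⁻¹ * tailSum q n * C := by
  rw [tailSum, ← tsum_mul_left, ← tsum_mul_right]
  refine tsum_of_norm_bounded (((hq.summable_tail n).mul_left _).mul_right C).hasSum fun j => ?_
  rw [volterraTerm, norm_mul, Complex.norm_real, Real.norm_eq_abs, abs_mul]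
  have h1 := abs_sineKernel_le_inv hθ (j + 1)
  have h2 := hf (n + 1 + j) (by omega)
  push_cast at h2
  gcongr

/-- The functions that solve the Volterra equation from `n₀` on solve the difference equation. -/
theorem volterra_rec {q : ℤ → ℝ} (hq : MemEllOneOne q) {θ : ℝ} {f : ℤ → ℂ} {n₀ : ℕ} {C : ℝ}
    (hf : ∀ k : ℕ, n₀ ≤ k → ‖f k‖ ≤ C)
    (hv : ∀ k : ℕ, n₀ ≤ k → f k = wave (-θ) k + volterra q θ f k) {n : ℕ} (hn : n₀ ≤ n) :
    f (n + 2) + f n = (2 * Real.cos θ + q (n + 1)) * f (n + 1) := by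
  have e0 := hv n hn
  have e1 := hv (n + 1) (by omega)
  have e2 := hv (n + 2) (by omega)
  have s0 := summable_volterraTerm hq (θ := θ) (n := n) fun k hk => hf k (by omega)
  have s1 := summable_volterraTerm hq (θ := θ) (n := n + 1) fun k hk => hf k (by omega)
  have s2 := summable_volterraTerm hq (θ := θ) (n := n + 2) fun k hk => hf k (by omega)
  have k1 : sineKernel θ 1 = 1 := by simp [sineKernel]
  have k2 : sineKernel θ 2 = 2 * Real.cos θ := by simp [sineKernel]; ring
  -- The three integral terms are all written as sums over the sites `n + 3 + j`, with kernel
  -- indices `j + 3`, `j + 2`, `j + 1`, so that `sineKernel_rec` cancels them term by term; the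
  -- split-off terms leave `q (n + 1) f (n + 1)`.
  have v0 : volterra q θ f n = q (n + 1) * f (n + 1)
      + (2 * Real.cos θ * (q (n + 2) * f (n + 2))
      + ∑' j : ℕ, ((sineKernel θ (j + 3) * q (n + 3 + j) : ℝ) : ℂ) * f (n + 3 + j)) := by
    rw [volterra, s0.tsum_eq_zero_add, ((summable_nat_add_iff 1).2 s0).tsum_eq_zero_add]
    simp only [volterraTerm, k1, zero_add, k2]
    push_cast
    congr 1
    · ring_nf
    · congr 1
      · ring_nf
      · refine tsum_congr fun j => ?_
        ring_nf
  have v1 : volterra q θ f (n + 1) = q (n + 2) * f (n + 2)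
      + ∑' j : ℕ, ((sineKernel θ (j + 2) * q (n + 3 + j) : ℝ) : ℂ) * f (n + 3 + j) := by
    rw [volterra, s1.tsum_eq_zero_add]
    simp only [volterraTerm, k1, zero_add]
    push_cast
    congr 1
    · ring_nf
    · refine tsum_congr fun j => ?_
      ring_nf
  have t1 : Summable fun j : ℕ =>
      ((sineKernel θ (j + 2) * q (n + 3 + j) : ℝ) : ℂ) * f (n + 3 + j) := by
    refine ((summable_nat_add_iff 1).2 s1).congr fun j => ?_
    simp only [volterraTerm]
    push_cast
    ring_nf
  have t2 : Summable fun j : ℕ =>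
      ((sineKernel θ (j + 1) * q (n + 3 + j) : ℝ) : ℂ) * f (n + 3 + j) := by
    refine s2.congr fun j => ?_
    simp only [volterraTerm]
    push_cast
    ring_nf
  have v2 : volterra q θ f (n + 2) =
      ∑' j : ℕ, ((sineKernel θ (j + 1) * q (n + 3 + j) : ℝ) : ℂ) * f (n + 3 + j) := by
    rw [volterra]
    refine tsum_congr fun j => ?_
    simp only [volterraTerm]
    push_cast
    ring_nf
  have v3 : ∑' j : ℕ, ((sineKernel θ (j + 3) * q (n + 3 + j) : ℝ) : ℂ) * f (n + 3 + j)
      = 2 * Real.cos θ * (volterra q θ f (n + 1) - q (n + 2) * f (n + 2))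
        - volterra q θ f (n + 2) := by
    rw [v1, v2, add_sub_cancel_left, ← tsum_mul_left, ← (t1.mul_left _).tsum_sub t2]
    refine tsum_congr fun j => ?_
    have := sineKernel_rec θ (j + 1)
    rw [← Complex.ofReal_ofNat, ← Complex.ofReal_mul, ← mul_assoc, ← Complex.ofReal_mul, ← sub_mul,
      ← Complex.ofReal_sub]
    congr 2
    linear_combination q (n + 3 + j) * this
  rw [v3] at v0
  have hw := wave_rec (-θ) (n + 1)
  rw [add_sub_cancel_right, Real.cos_neg, show (n : ℤ) + 1 + 1 = n + 2 by ring] at hw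
  push_cast at e0 e1 e2
  linear_combination e0 + e2 + v0 + hw - 2 * Real.cos θ * e1

/-- The integral operator has norm at most `1/2` on bounded functions from `n₀` on, so the fixed
point of the contraction satisfies `‖g‖ ≤ 1 + ‖g‖ / 2`, whence the bound `2`, uniform in `θ`. -/
theorem exists_volterra_solution {q : ℤ → ℝ} (hq : MemEllOneOne q) {n₀ : ℕ} (h : SmallFrom q n₀)
    (θ : ℝ) : ∃ f : ℤ → ℂ, (∀ n : ℕ, n₀ ≤ n → ‖f n‖ ≤ 2) ∧
      ∀ n : ℕ, n₀ ≤ n → f n = wave (-θ) n + volterra q θ f n := by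
  -- To the left of `n₀` the truncation `toNat` makes this the constant `g 0`; only values at sites
  -- beyond `n₀` enter the equation.
  let ext (g : BoundedContinuousFunction ℕ ℂ) (n : ℤ) : ℂ := g (n - n₀).toNat
  have hext : ∀ g (n : ℕ), ‖ext g n‖ ≤ ‖g‖ := fun g n => g.norm_coe_le_norm _
  have hsub : ∀ g g' (n : ℕ), volterra q θ (ext g) n - volterra q θ (ext g') n
      = volterra q θ (ext (g - g')) n := fun g g' n => by
    rw [volterra, volterra, volterra, ← (summable_volterraTerm hq fun k _ => hext g k).tsum_sub
      (summable_volterraTerm hq fun k _ => hext g' k)]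
    refine tsum_congr fun j => ?_
    simp only [volterraTerm, ← mul_sub]
    rfl
  have hbd : ∀ g (i : ℕ), ‖volterra q θ (ext g) (n₀ + i)‖ ≤ 1 / 2 * ‖g‖ := fun g i =>
    (norm_volterra_le hq fun k _ => hext g k).trans
      (mul_le_mul_of_nonneg_right (h _ (by omega)) (norm_nonneg _))
  let Φ (g : BoundedContinuousFunction ℕ ℂ) : BoundedContinuousFunction ℕ ℂ :=
    BoundedContinuousFunction.ofNormedAddCommGroupDiscrete
      (fun i : ℕ => wave (-θ) ((n₀ + i : ℕ) : ℤ) + volterra q θ (ext g) (n₀ + i)) (1 + 1 / 2 * ‖g‖)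
      fun i => (norm_add_le _ _).trans (add_le_add (norm_wave _ _).le (hbd g i))
  have hΦ : ∀ g i, Φ g i = wave (-θ) ((n₀ + i : ℕ) : ℤ) + volterra q θ (ext g) (n₀ + i) :=
    fun _ _ => rfl
  have hc : ContractingWith (1 / 2) Φ := by
    refine ⟨?_, LipschitzWith.of_dist_le_mul fun g g' => ?_⟩
    · rw [← NNReal.coe_lt_coe]; norm_num
    · rw [BoundedContinuousFunction.dist_le (by positivity)]
      intro i
      rw [dist_eq_norm, hΦ, hΦ, add_sub_add_left_eq_sub, hsub, dist_eq_norm]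
      simpa using hbd (g - g') i
  obtain ⟨g, hg, -⟩ := hc.exists_fixedPoint 0 (edist_ne_top _ _)
  have hg' : ∀ i, g i = wave (-θ) ((n₀ + i : ℕ) : ℤ) + volterra q θ (ext g) (n₀ + i) := fun i => by
    rw [← hΦ, hg]
  have hn : ‖g‖ ≤ 2 := by
    have : ‖g‖ ≤ 1 + 1 / 2 * ‖g‖ := by
      rw [BoundedContinuousFunction.norm_le (by positivity)]
      intro i
      rw [hg']
      exact (norm_add_le _ _).trans (add_le_add (norm_wave _ _).le (hbd g i))
    linarith
  refine ⟨ext g, fun n _ => (hext g n).trans hn, fun n hnn => ?_⟩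
  obtain ⟨i, rfl⟩ := Nat.exists_eq_add_of_le hnn
  rw [← hg']
  exact congrArg g (by omega)

/-- A solution on a half line extends to a solution on the line. -/
theorem exists_extension (q : ℤ → ℝ) (θ : ℝ) {g : ℤ → ℂ} (n₀ : ℕ)
    (hg : ∀ n : ℕ, n₀ ≤ n → g (n + 2) + g n = (2 * Real.cos θ + q (n + 1)) * g (n + 1)) :
    ∃ f : ℤ → ℂ, IsGeneralizedEigenfunction q θ f ∧ ∀ n : ℕ, n₀ ≤ n → f n = g n := by
  -- The pair `p j` holds the values at `n₀ - j` and `n₀ - j + 1`; the equation is solved for its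
  -- leftmost value.
  let p : ℕ → ℂ × ℂ := fun j => Nat.rec (g n₀, g (n₀ + 1))
    (fun j x => ((2 * Real.cos θ + q (n₀ - j)) * x.1 - x.2, x.1)) j
  have p0 : p 0 = (g n₀, g (n₀ + 1)) := rfl
  have ps : ∀ j, p (j + 1) = ((2 * Real.cos θ + q (n₀ - j)) * (p j).1 - (p j).2, (p j).1) :=
    fun _ => rfl
  let f : ℤ → ℂ := fun n => if (n₀ : ℤ) ≤ n then g n else (p (n₀ - n).toNat).1
  have f1 : ∀ j : ℕ, f (n₀ - j) = (p j).1 := fun j => by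
    by_cases hj : j = 0
    · simp [f, hj, p0]
    · have : ¬ ((n₀ : ℤ) ≤ n₀ - j) := by omega
      simp [f, hj]
  have f2 : ∀ j : ℕ, f (n₀ - j + 1) = (p j).2 := fun j => by
    cases j with
    | zero => simp [f, p0]
    | succ j =>
      rw [ps, ← f1 j]
      push_cast
      ring_nf
  refine ⟨f, isGeneralizedEigenfunction_iff.2 fun n => ?_, fun n hn => ?_⟩
  · rcases le_or_gt n n₀ with h | h
    · obtain ⟨j, rfl⟩ : ∃ j : ℕ, n = n₀ - j := ⟨(n₀ - n).toNat, by omega⟩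
      rw [f2, f1, show (n₀ : ℤ) - j - 1 = n₀ - (j + 1 : ℕ) by push_cast; ring, f1, ps]
      ring
    · obtain ⟨m, rfl⟩ : ∃ m : ℕ, n = m + 1 := ⟨(n - 1).toNat, by omega⟩
      have := hg m (by omega)
      have a1 : (n₀ : ℤ) ≤ m + 2 := by omega
      have a2 : (n₀ : ℤ) ≤ m := by omega
      have a3 : (n₀ : ℤ) ≤ m + 1 := by omega
      rw [add_sub_cancel_right, add_assoc, one_add_one_eq_two]
      simpa only [f, a1, a2, a3, if_true] using this
  · have : (n₀ : ℤ) ≤ n := by omega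
    simp [f, hn]

theorem volterra_congr {q : ℤ → ℝ} {θ : ℝ} {f g : ℤ → ℂ} {n : ℕ}
    (h : ∀ k : ℕ, n < k → f k = g k) : volterra q θ f n = volterra q θ g n :=
  tsum_congr fun j => by
    have := h (n + 1 + j) (by omega)
    push_cast at this
    rw [volterraTerm, volterraTerm, this]

theorem exists_jostPlus {q : ℤ → ℝ} (hq : MemEllOneOne q) {n₀ : ℕ} (h : SmallFrom q n₀) (θ : ℝ) :
    ∃ f : ℤ → ℂ, IsJostPlus q θ f ∧ (∀ n : ℕ, n₀ ≤ n → ‖f n‖ ≤ 2) ∧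
      ∀ n : ℕ, n₀ ≤ n → f n = wave (-θ) n + volterra q θ f n := by
  obtain ⟨g, hg2, hgv⟩ := exists_volterra_solution hq h θ
  obtain ⟨f, hf, hfg⟩ := exists_extension q θ n₀ fun n hn => volterra_rec hq hg2 hgv hn
  have hf2 : ∀ n : ℕ, n₀ ≤ n → ‖f n‖ ≤ 2 := fun n hn => by rw [hfg n hn]; exact hg2 n hn
  have hfv : ∀ n : ℕ, n₀ ≤ n → f n = wave (-θ) n + volterra q θ f n := fun n hn => by
    rw [volterra_congr fun k hk => hfg k (by omega), hfg n hn]; exact hgv n hn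
  refine ⟨f, ⟨hf, ?_⟩, hf2, hfv⟩
  have hnat : Tendsto (fun n : ℕ => f n - wave (-θ) n) atTop (𝓝 0) := by
    refine squeeze_zero_norm' ?_ (by simpa using hq.tendsto_tailMoment.mul_const 2)
    filter_upwards [eventually_ge_atTop n₀] with n hn
    rw [hfv n hn, add_sub_cancel_left]
    exact norm_volterra_le hq fun k hk => hf2 k (by omega)
  rw [← Nat.map_cast_int_atTop]
  exact tendsto_map'_iff.2 hnat

/-! ### The Jost functions -/

theorem jostPlus_spec {q : ℤ → ℝ} (hq : MemEllOneOne q) (θ : ℝ) :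
    IsJostPlus q θ fun n => jostPlus q n θ := by
  obtain ⟨n₀, h⟩ := hq.exists_smallFrom
  obtain ⟨f, hf, -⟩ := exists_jostPlus hq h θ
  exact Classical.epsilon_spec (p := IsJostPlus q θ) ⟨f, hf⟩

theorem IsJostPlus.jostPlus_eq {q : ℤ → ℝ} (hq : MemEllOneOne q) {θ : ℝ} {f : ℤ → ℂ}
    (hf : IsJostPlus q θ f) (n : ℤ) : jostPlus q n θ = f n :=
  congrFun ((jostPlus_spec hq θ).unique hf) n

theorem norm_jostPlus_le_two {q : ℤ → ℝ} (hq : MemEllOneOne q) {n₀ : ℕ} (h : SmallFrom q n₀)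
    (θ : ℝ) {n : ℕ} (hn : n₀ ≤ n) : ‖jostPlus q n θ‖ ≤ 2 := by
  obtain ⟨f, hf, h2, -⟩ := exists_jostPlus hq h θ
  rw [hf.jostPlus_eq hq]
  exact h2 n hn

theorem jostPlus_eq_volterra {q : ℤ → ℝ} (hq : MemEllOneOne q) {n₀ : ℕ} (h : SmallFrom q n₀)
    (θ : ℝ) {n : ℕ} (hn : n₀ ≤ n) :
    jostPlus q n θ = wave (-θ) n + volterra q θ (fun k => jostPlus q k θ) n := by
  obtain ⟨f, hf, -, hv⟩ := exists_jostPlus hq h θ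
  simp only [hf.jostPlus_eq hq]
  exact hv n hn

theorem jostPlus_rec {q : ℤ → ℝ} (hq : MemEllOneOne q) (θ : ℝ) (n : ℤ) :
    jostPlus q (n - 1) θ
      = (2 * Real.cos θ + q n) * jostPlus q n θ - jostPlus q (n + 1) θ := by
  have := isGeneralizedEigenfunction_iff.1 (jostPlus_spec hq θ).1 n
  linear_combination this

theorem conj_jostPlus {q : ℤ → ℝ} (hq : MemEllOneOne q) (θ : ℝ) (n : ℤ) :
    (starRingEnd ℂ) (jostPlus q n θ) = jostPlus q n (-θ) := by
  have h := jostPlus_spec hq θ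
  refine (IsJostPlus.jostPlus_eq hq
    (f := fun n => (starRingEnd ℂ) (jostPlus q n θ)) ⟨h.1.conj.neg_angle, ?_⟩ n).symm
  have := (Complex.continuous_conj.tendsto _).comp h.2
  simpa [Function.comp_def, conj_wave] using this

/-- Bounds for the Jost functions that are uniform over smaller potentials. -/
theorem exists_jostPlus_bound {q : ℤ → ℝ} (hq : MemEllOneOne q) (n : ℤ) :
    ∃ C : ℝ, ∀ p : ℤ → ℝ, (∀ k, |p k| ≤ |q k|) → ∀ θ, ‖jostPlus p n θ‖ ≤ C := by
  obtain ⟨n₀, h⟩ := hq.exists_smallFrom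
  have hp : ∀ p : ℤ → ℝ, (∀ k, |p k| ≤ |q k|) → SmallFrom p n₀ := fun p hpq k hk =>
    (tailMoment_mono hq hpq k).trans (h k hk)
  have large : ∀ m : ℕ, n₀ ≤ m → ∃ C : ℝ, ∀ p : ℤ → ℝ, (∀ k, |p k| ≤ |q k|) →
      ∀ θ, ‖jostPlus p m θ‖ ≤ C := fun m hm =>
    ⟨2, fun p hpq θ => norm_jostPlus_le_two (hq.of_abs_le hpq) (hp p hpq) θ hm⟩
  have small : ∀ j : ℕ, (∃ C : ℝ, ∀ p : ℤ → ℝ, (∀ k, |p k| ≤ |q k|) →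
      ∀ θ, ‖jostPlus p (n₀ - j) θ‖ ≤ C) ∧ ∃ C : ℝ, ∀ p : ℤ → ℝ, (∀ k, |p k| ≤ |q k|) →
      ∀ θ, ‖jostPlus p (n₀ - j + 1) θ‖ ≤ C := by
    intro j
    induction j with
    | zero =>
      refine ⟨by simpa using large n₀ le_rfl, ?_⟩
      simpa using large (n₀ + 1) (by omega)
    | succ j ih =>
      obtain ⟨⟨C, hC⟩, D, hD⟩ := ih
      have e : (n₀ : ℤ) - (j + 1 : ℕ) = n₀ - j - 1 := by push_cast; ring
      rw [e, sub_add_cancel]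
      refine ⟨⟨(2 + |q (n₀ - j)|) * C + D, fun p hpq θ => ?_⟩, C, hC⟩
      rw [jostPlus_rec (hq.of_abs_le hpq)]
      refine (norm_sub_le _ _).trans (add_le_add ?_ (hD p hpq θ))
      rw [norm_mul]
      refine mul_le_mul ((norm_add_le _ _).trans (add_le_add ?_ ?_)) (hC p hpq θ) (norm_nonneg _)
        (by positivity)
      · rw [norm_mul, Complex.norm_real, Real.norm_eq_abs, Complex.norm_ofNat]
        linarith [Real.abs_cos_le_one θ]
      · rw [Complex.norm_real, Real.norm_eq_abs]
        exact hpq _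
  rcases le_or_gt (n₀ : ℤ) n with hn | hn
  · obtain ⟨m, rfl⟩ : ∃ m : ℕ, n = m := ⟨n.toNat, by omega⟩
    exact large m (by omega)
  · obtain ⟨j, rfl⟩ : ∃ j : ℕ, n = n₀ - j := ⟨(n₀ - n).toNat, by omega⟩
    exact (small j).1

/-- The Volterra term is at most `2 / |sin θ|` times the tail of `q`, which is `O(1/n)`. -/
theorem exists_jostPlus_sub_wave_bound {q : ℤ → ℝ} (hq : MemEllOneOne q) :
    ∃ A : ℝ, 0 ≤ A ∧ ∀ (n : ℕ) (θ : ℝ), Real.sin θ ≠ 0 →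
      ‖jostPlus q n θ - wave (-θ) n‖ ≤ A / |Real.sin θ| / (n + 1) := by
  obtain ⟨n₀, h⟩ := hq.exists_smallFrom
  obtain ⟨A, hA0, hA⟩ := hq.tailSum_le
  choose C hC using exists_jostPlus_bound hq
  set B := ∑ k ∈ Finset.range n₀, (|C k| + 1) with hB
  have hB0 : 0 ≤ B := Finset.sum_nonneg fun _ _ => by positivity
  -- `2 * A` serves `n ≥ n₀`, where the Jost function is bounded by `2`. `B * n₀` serves the
  -- finitely many smaller `n`, where `n + 1 ≤ n₀` and `|sin θ| ≤ 1`.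
  refine ⟨2 * A + B * n₀, by positivity, fun n θ hθ => ?_⟩
  have hs : 0 < |Real.sin θ| := abs_pos.2 hθ
  have hs1 := Real.abs_sin_le_one θ
  rcases le_or_gt n₀ n with hn | hn
  · rw [jostPlus_eq_volterra hq h θ hn, add_sub_cancel_left]
    refine (norm_volterra_le_tailSum hq hθ fun k hk =>
      norm_jostPlus_le_two hq h θ (by omega)).trans ?_
    calc |Real.sin θ|⁻¹ * tailSum q n * 2 ≤ |Real.sin θ|⁻¹ * (A / (n + 1)) * 2 := by
          gcongr; exact hA n
      _ = 2 * A / |Real.sin θ| / (n + 1) := by ring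
      _ ≤ _ := by gcongr; nlinarith [(Nat.cast_nonneg n₀ : (0 : ℝ) ≤ n₀)]
  · have h1 : ‖jostPlus q n θ - wave (-θ) n‖ ≤ B := by
      refine (norm_sub_le _ _).trans ?_
      rw [norm_wave]
      refine (add_le_add_left ((hC n q (fun _ => le_rfl) θ).trans (le_abs_self _)) _).trans ?_
      exact Finset.single_le_sum (f := fun k : ℕ => |C k| + 1) (fun _ _ => by positivity)
        (Finset.mem_range.2 hn)
    refine h1.trans ?_
    rw [div_div, le_div_iff₀ (by positivity)]
    have h2 : (n : ℝ) + 1 ≤ n₀ := by exact_mod_cast hn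
    calc B * (|Real.sin θ| * (n + 1)) ≤ B * (1 * n₀) := by gcongr
      _ ≤ _ := by linarith

/-! ### Reflection of the line -/

theorem IsGeneralizedEigenfunction.reflect {q : ℤ → ℝ} {θ : ℝ} {f : ℤ → ℂ}
    (hf : IsGeneralizedEigenfunction q θ f) :
    IsGeneralizedEigenfunction (reflect q) θ fun n => f (-n) := by
  rw [isGeneralizedEigenfunction_iff] at *
  intro n
  have := hf (-n)
  rw [neg_add, neg_sub', sub_neg_eq_add, ← sub_eq_add_neg, DiscreteSchrodinger.reflect]
  linear_combination this

theorem reflect_reflect (q : ℤ → ℝ) : reflect (reflect q) = q := by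
  funext n; simp [reflect]

/-- Through this equivalence every result at `+∞` transfers to `-∞`. -/
theorem isJostMinus_iff {q : ℤ → ℝ} {θ : ℝ} {f : ℤ → ℂ} :
    IsJostMinus q θ f ↔ IsJostPlus (reflect q) θ fun n => f (-n) := by
  unfold IsJostMinus IsJostPlus
  refine and_congr ⟨fun h => h.reflect, fun h => ?_⟩ ?_
  · simpa [reflect_reflect] using h.reflect
  · constructor <;> intro h
    · have := h.comp tendsto_neg_atTop_atBot
      simpa [Function.comp_def, wave_neg] using this
    · have := h.comp tendsto_neg_atBot_atTop
      simpa [Function.comp_def, wave_neg] using this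

theorem jostMinus_eq {q : ℤ → ℝ} (hq : MemEllOneOne q) (n : ℤ) (θ : ℝ) :
    jostMinus q n θ = jostPlus (reflect q) (-n) θ := by
  have h := jostPlus_spec hq.reflect θ
  have h1 : IsJostMinus q θ fun n => jostPlus (reflect q) (-n) θ := by
    rw [isJostMinus_iff]; simpa using h
  have h2 : IsJostMinus q θ fun n => jostMinus q n θ :=
    Classical.epsilon_spec (p := IsJostMinus q θ) ⟨_, h1⟩
  rw [isJostMinus_iff] at h1 h2
  simpa using congrFun (h2.unique h1) (-n)

theorem jostMinus_spec {q : ℤ → ℝ} (hq : MemEllOneOne q) (θ : ℝ) :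
    IsJostMinus q θ fun n => jostMinus q n θ := by
  rw [isJostMinus_iff]
  simpa [jostMinus_eq hq] using jostPlus_spec hq.reflect θ

theorem conj_jostMinus {q : ℤ → ℝ} (hq : MemEllOneOne q) (θ : ℝ) (n : ℤ) :
    (starRingEnd ℂ) (jostMinus q n θ) = jostMinus q n (-θ) := by
  rw [jostMinus_eq hq, jostMinus_eq hq, conj_jostPlus hq.reflect]

/-! ### Scattering coefficients -/

/-- The Wronskian does not depend on the site, so it can be evaluated at `+∞`, where the solutions
may be replaced by plane waves. -/
theorem wronsk_jostPlus_conj {q : ℤ → ℝ} (hq : MemEllOneOne q) (θ : ℝ) :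
    wronsk (fun n => jostPlus q n θ) (fun n => jostPlus q n (-θ)) 0
      = -(2 * Complex.I * Real.sin θ) := by
  have h := jostPlus_spec hq θ
  have h' := jostPlus_spec hq (-θ)
  have hc : (fun n => wronsk (fun n => jostPlus q n θ) (fun n => jostPlus q n (-θ)) n)
      = fun _ => wronsk (fun n => jostPlus q n θ) (fun n => jostPlus q n (-θ)) 0 :=
    funext fun n => wronsk_const h.1 (by simpa using h'.1.neg_angle) n
  refine tendsto_nhds_unique (f := fun _ : ℤ => wronsk (fun n => jostPlus q n θ)
    (fun n => jostPlus q n (-θ)) 0) (l := atTop) tendsto_const_nhds ?_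
  rw [← hc, ← sub_zero (-_), ← tendsto_sub_nhds_zero_iff, sub_zero]
  set d := fun n : ℤ => jostPlus q n θ - wave (-θ) n with hd
  set e := fun n : ℤ => jostPlus q n (-θ) - wave (- -θ) n with he
  have d0 : Tendsto (fun n => ‖d n‖) atTop (𝓝 0) := by simpa using h.2.norm
  have e0 : Tendsto (fun n => ‖e n‖) atTop (𝓝 0) := by simpa [he] using h'.2.norm
  have s : Tendsto (fun n : ℤ => n + 1) atTop atTop :=
    tendsto_atTop_add_const_right _ 1 tendsto_id
  have d1 := d0.comp s
  have e1 := e0.comp s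
  have key : Tendsto (fun n => (‖d (n + 1)‖ * ‖e n‖ + ‖d (n + 1)‖ + ‖e n‖)
      + (‖d n‖ * ‖e (n + 1)‖ + ‖d n‖ + ‖e (n + 1)‖)) atTop (𝓝 0) := by
    simpa using (((d1.mul e0).add d1).add e0).add (((d0.mul e1).add d0).add e1)
  refine squeeze_zero_norm (fun n => ?_) key
  have eq : wronsk (fun n => jostPlus q n θ) (fun n => jostPlus q n (-θ)) n
      - -(2 * Complex.I * Real.sin θ)
      = (d (n + 1) * e n + d (n + 1) * wave θ n + wave (-θ) (n + 1) * e n)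
        - (d n * e (n + 1) + d n * wave θ (n + 1) + wave (-θ) n * e (n + 1)) := by
    rw [← wave_one_sub]
    simp only [hd, he, wronsk, neg_neg, wave_add]
    linear_combination (-(wave θ 1 - wave (-θ) 1)) * wave_mul_wave_neg θ n
  rw [eq]
  refine (norm_sub_le _ _).trans (add_le_add ?_ ?_) <;>
  · refine (norm_add₃_le ..).trans ?_
    simp only [norm_mul, norm_wave, one_mul, mul_one]
    exact le_rfl

theorem wronsk_reflect (f g : ℤ → ℂ) (n : ℤ) :
    wronsk (fun k => f (-k)) (fun k => g (-k)) n = -wronsk f g (-n - 1) := by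
  simp only [wronsk, neg_add, sub_add_cancel]
  simp only [← sub_eq_add_neg]
  ring

theorem wronsk_jostMinus_conj {q : ℤ → ℝ} (hq : MemEllOneOne q) (θ : ℝ) :
    wronsk (fun n => jostMinus q n θ) (fun n => jostMinus q n (-θ)) 0
      = 2 * Complex.I * Real.sin θ := by
  simp only [jostMinus_eq hq]
  rw [wronsk_reflect (fun n => jostPlus (reflect q) n θ)
    (fun n => jostPlus (reflect q) n (-θ)), wronsk_const
    (jostPlus_spec hq.reflect θ).1 (by simpa using (jostPlus_spec hq.reflect (-θ)).1.neg_angle),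
    wronsk_jostPlus_conj hq.reflect, neg_neg]

theorem jostWronskian_eq (q : ℤ → ℝ) (θ : ℝ) : jostWronskian q θ =
    wronsk (fun n => jostPlus q n θ) (fun n => jostMinus q n θ) 0 := by
  simp [jostWronskian, wronsk]

/-- The Wronskian `[f₋, conj f₊]`. -/
def crossWronskian (q : ℤ → ℝ) (θ : ℝ) : ℂ :=
  jostMinus q 1 θ * jostPlus q 0 (-θ) - jostMinus q 0 θ * jostPlus q 1 (-θ)

theorem crossWronskian_eq (q : ℤ → ℝ) (θ : ℝ) : crossWronskian q θ =
    wronsk (fun n => jostMinus q n θ) (fun n => jostPlus q n (-θ)) 0 := by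
  simp [crossWronskian, wronsk]

/-- This is the Plücker relation among the Wronskians of `f₊`, `conj f₊`, `f₋`, `conj f₋`. Away from
the thresholds it says `|T|² + |R|² = 1`; it also gives `w ≠ 0` there. -/
theorem norm_sq_jostWronskian {q : ℤ → ℝ} (hq : MemEllOneOne q) (θ : ℝ) :
    ‖jostWronskian q θ‖ ^ 2 = 4 * Real.sin θ ^ 2 + ‖crossWronskian q θ‖ ^ 2 := by
  have h1 := wronsk_jostPlus_conj hq θ
  have h2 := wronsk_jostMinus_conj hq θ
  have h3 : jostWronskian q θ * (starRingEnd ℂ) (jostWronskian q θ)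
      = 4 * Real.sin θ ^ 2 + crossWronskian q θ * (starRingEnd ℂ) (crossWronskian q θ) := by
    have h4 : (4 : ℂ) * Real.sin θ ^ 2
        = (-(2 * Complex.I * Real.sin θ)) * (2 * Complex.I * Real.sin θ) := by
      linear_combination 4 * (Real.sin θ : ℂ) ^ 2 * Complex.I_sq
    rw [h4, ← h1, ← h2]
    simp only [jostWronskian, crossWronskian, map_sub, map_mul, conj_jostPlus hq,
      conj_jostMinus hq, neg_neg, wronsk, zero_add]
    ring
  rw [Complex.mul_conj, Complex.mul_conj, Complex.normSq_eq_norm_sq, Complex.normSq_eq_norm_sq]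
    at h3
  exact_mod_cast h3

theorem jostWronskian_ne_zero {q : ℤ → ℝ} (hq : MemEllOneOne q) {θ : ℝ} (h : Real.sin θ ≠ 0) :
    jostWronskian q θ ≠ 0 := by
  intro h0
  have := norm_sq_jostWronskian hq θ
  rw [h0, norm_zero] at this
  have h1 : 0 < Real.sin θ ^ 2 := by positivity
  nlinarith [sq_nonneg ‖crossWronskian q θ‖]

theorem norm_transmission_le {q : ℤ → ℝ} (hq : MemEllOneOne q) (θ : ℝ) :
    ‖transmission q θ‖ ≤ 1 := by
  have := norm_sq_jostWronskian hq θ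
  rw [transmission, norm_div, norm_neg, norm_mul, norm_mul, Complex.norm_I, Complex.norm_ofNat,
    Complex.norm_real, Real.norm_eq_abs, mul_one]
  refine div_le_one_of_le₀ (abs_le_of_sq_le_sq' ?_ (norm_nonneg _)).2 (norm_nonneg _)
  rw [mul_pow, sq_abs]
  nlinarith [sq_nonneg ‖crossWronskian q θ‖]

/-- The reflection coefficient, with `T f₋ = conj f₊ + R f₊`. -/
def reflection (q : ℤ → ℝ) (θ : ℝ) : ℂ := crossWronskian q θ / jostWronskian q θ

theorem norm_reflection_le {q : ℤ → ℝ} (hq : MemEllOneOne q) (θ : ℝ) :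
    ‖reflection q θ‖ ≤ 1 := by
  have := norm_sq_jostWronskian hq θ
  rw [reflection, norm_div]
  refine div_le_one_of_le₀ (abs_le_of_sq_le_sq' ?_ (norm_nonneg _)).2 (norm_nonneg _)
  nlinarith [sq_nonneg (Real.sin θ)]

theorem transmission_mul_jostMinus {q : ℤ → ℝ} (hq : MemEllOneOne q) {θ : ℝ}
    (h : Real.sin θ ≠ 0) (n : ℤ) :
    transmission q θ * jostMinus q n θ
      = jostPlus q n (-θ) + reflection q θ * jostPlus q n θ := by
  have hw := jostWronskian_ne_zero hq h
  have key := wronsk_expansion (jostPlus_spec hq θ).1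
    (by simpa using (jostPlus_spec hq (-θ)).1.neg_angle) (jostMinus_spec hq θ).1 n
  rw [wronsk_jostPlus_conj hq, ← crossWronskian_eq, ← jostWronskian_eq] at key
  rw [transmission, reflection]
  field_simp
  linear_combination key

theorem jostWronskian_reflect {q : ℤ → ℝ} (hq : MemEllOneOne q) (θ : ℝ) :
    jostWronskian (reflect q) θ = jostWronskian q θ := by
  rw [jostWronskian_eq, jostWronskian_eq]
  simp only [jostMinus_eq hq, jostMinus_eq hq.reflect, reflect_reflect]
  have := wronsk_reflect (fun n => jostPlus q n θ) (fun n => jostPlus (reflect q) (-n) θ) 0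
  have h2 := wronsk_const (jostPlus_spec hq θ).1 (by
    simpa [jostMinus_eq hq] using (jostMinus_spec hq θ).1) (-0 - 1)
  rw [h2] at this
  simp only [neg_neg] at this
  rw [← neg_eq_iff_eq_neg] at this
  rw [← this]
  simp only [wronsk]
  ring

theorem transmission_reflect {q : ℤ → ℝ} (hq : MemEllOneOne q) (θ : ℝ) :
    transmission (reflect q) θ = transmission q θ := by
  rw [transmission, transmission, jostWronskian_reflect hq]

/-! ### Plane waves of the potential -/

/-- The normalization `1 / √(2π)`. -/
def normConst : ℂ := ((Real.sqrt (2 * Real.pi) : ℝ) : ℂ)⁻¹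

theorem normConst_ne_zero : normConst ≠ 0 := by
  unfold normConst
  have : 0 < Real.sqrt (2 * Real.pi) := Real.sqrt_pos.2 (by positivity)
  exact inv_ne_zero (by exact_mod_cast this.ne')

theorem norm_normConst_le : ‖normConst‖ ≤ 1 := by
  rw [normConst, norm_inv, Complex.norm_real, Real.norm_eq_abs, abs_of_nonneg (Real.sqrt_nonneg _)]
  refine inv_le_one_of_one_le₀ ?_
  rw [Real.one_le_sqrt]
  linarith [Real.pi_gt_three]

theorem freeWave_eq (n : ℤ) (θ : ℝ) : freeWave n θ = normConst * wave (-θ) n := rfl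

theorem planeWave_of_nonneg (q : ℤ → ℝ) (n : ℤ) {θ : ℝ} (h : 0 ≤ θ) :
    planeWave q n θ = normConst * (transmission q θ * jostPlus q n θ) := by
  rw [planeWave, if_pos h, mPlus, ← normConst]
  linear_combination normConst * transmission q θ * jostPlus q n θ * wave_neg_mul_wave θ n

theorem planeWave_of_neg (q : ℤ → ℝ) (n : ℤ) {θ : ℝ} (h : θ < 0) :
    planeWave q n θ = normConst * (transmission q (-θ) * jostMinus q n (-θ)) := by
  rw [planeWave, if_neg h.not_ge, mMinus, ← normConst, neg_neg]
  linear_combination normConst * transmission q (-θ) * jostMinus q n (-θ) * wave_neg_mul_wave θ n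

/-- Reflecting the line exchanges incidence from the two sides. The excluded angle `0`, where both
sides would take the branch `0 ≤ θ`, is a null set. -/
theorem planeWave_reflect {q : ℤ → ℝ} (hq : MemEllOneOne q) (n : ℤ) {θ : ℝ} (h : θ ≠ 0) :
    planeWave (reflect q) n θ = planeWave q (-n) (-θ) := by
  rcases lt_or_gt_of_ne h with h | h
  · rw [planeWave_of_neg _ _ h, planeWave_of_nonneg _ _ (by linarith), transmission_reflect hq,
      jostMinus_eq hq.reflect, reflect_reflect]
  · rw [planeWave_of_nonneg _ _ h.le, planeWave_of_neg _ _ (by linarith), transmission_reflect hq,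
      jostMinus_eq hq, neg_neg, neg_neg]

theorem planeWave_rec {q : ℤ → ℝ} (hq : MemEllOneOne q) (θ : ℝ) (n : ℤ) :
    planeWave q (n + 1) θ + planeWave q (n - 1) θ
      = (2 * Real.cos θ + q n) * planeWave q n θ := by
  rcases le_or_gt 0 θ with h | h
  · simp only [planeWave_of_nonneg q _ h]
    have := isGeneralizedEigenfunction_iff.1 (jostPlus_spec hq θ).1 n
    linear_combination normConst * transmission q θ * this
  · simp only [planeWave_of_neg q _ h]
    have := isGeneralizedEigenfunction_iff.1 (jostMinus_spec hq (-θ)).1 n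
    rw [Real.cos_neg] at this
    linear_combination normConst * transmission q (-θ) * this

theorem exists_planeWave_bound {q : ℤ → ℝ} (hq : MemEllOneOne q) (n : ℤ) :
    ∃ C : ℝ, ∀ p : ℤ → ℝ, (∀ k, |p k| ≤ |q k|) → ∀ θ, ‖planeWave p n θ‖ ≤ C := by
  obtain ⟨C, hC⟩ := exists_jostPlus_bound hq n
  obtain ⟨D, hD⟩ := exists_jostPlus_bound hq.reflect (-n)
  have aux : ∀ z w : ℂ, ‖z‖ ≤ 1 → ‖normConst * (z * w)‖ ≤ ‖w‖ := fun z w hz => by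
    rw [norm_mul, norm_mul]
    exact (mul_le_of_le_one_left (by positivity) norm_normConst_le).trans
      (mul_le_of_le_one_left (norm_nonneg _) hz)
  refine ⟨max C D, fun p hp θ => ?_⟩
  have hpm := hq.of_abs_le hp
  rcases le_or_gt 0 θ with h | h
  · rw [planeWave_of_nonneg _ _ h]
    exact (aux _ _ (norm_transmission_le hpm _)).trans ((hC p hp θ).trans (le_max_left _ _))
  · rw [planeWave_of_neg _ _ h, jostMinus_eq hpm]
    exact (aux _ _ (norm_transmission_le hpm _)).trans
      ((hD (reflect p) (fun k => hp (-k)) _).trans (le_max_right _ _))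

/-- The coefficient of `e^{-inθ}` in the plane wave near `+∞`. -/
def ampTransmitted (q : ℤ → ℝ) (θ : ℝ) : ℂ := if 0 ≤ θ then transmission q θ else 1

/-- The coefficient of `e^{inθ}` in the plane wave near `+∞`. -/
def ampReflected (q : ℤ → ℝ) (θ : ℝ) : ℂ := if 0 ≤ θ then 0 else reflection q (-θ)

/-- The remainder of the plane wave near `+∞`. -/
def planeRemainder (q : ℤ → ℝ) (n : ℤ) (θ : ℝ) : ℂ :=
  planeWave q n θ - ampTransmitted q θ * freeWave n θ - ampReflected q θ * freeWave (-n) θ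

/-- For `θ ≥ 0` the remainder is `T` times the error of `f₊`; for `θ < 0` the scattering relation
reduces it to the errors at `θ` and `-θ`. The bound is square summable in `n` on each set `bulk δ`.
-/
theorem exists_planeRemainder_bound {q : ℤ → ℝ} (hq : MemEllOneOne q) :
    ∃ A : ℝ, 0 ≤ A ∧ ∀ (n : ℕ) (θ : ℝ), Real.sin θ ≠ 0 →
      ‖planeRemainder q n θ‖ ≤ A / |Real.sin θ| / (n + 1) := by
  obtain ⟨A, hA0, hA⟩ := exists_jostPlus_sub_wave_bound hq
  refine ⟨2 * A, by positivity, fun n θ hθ => ?_⟩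
  have h1 := hA n θ hθ
  have aux : ∀ z w : ℂ, ‖z‖ ≤ 1 → ‖z * w‖ ≤ ‖w‖ := fun z w hz => by
    rw [norm_mul]; exact mul_le_of_le_one_left (norm_nonneg _) hz
  have hpos : 0 ≤ A / |Real.sin θ| / (n + 1) := by positivity
  rw [mul_div_assoc, mul_div_assoc]
  rw [planeRemainder, ampTransmitted, ampReflected, freeWave_eq, freeWave_eq]
  rcases le_or_gt 0 θ with h | h
  · rw [planeWave_of_nonneg _ _ h, if_pos h, if_pos h]
    rw [show normConst * (transmission q θ * jostPlus q n θ)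
      - transmission q θ * (normConst * wave (-θ) n) - 0 * (normConst * wave (-θ) (-n))
      = normConst * (transmission q θ * (jostPlus q n θ - wave (-θ) n)) by ring]
    refine (aux _ _ norm_normConst_le).trans ((aux _ _ (norm_transmission_le hq _)).trans ?_)
    linarith
  · have hθ' : Real.sin (-θ) ≠ 0 := by simpa using hθ
    have h2 := hA n (-θ) hθ'
    rw [Real.sin_neg, abs_neg] at h2
    rw [planeWave_of_neg _ _ h, if_neg h.not_ge, if_neg h.not_ge, transmission_mul_jostMinus hq hθ',
      neg_neg, one_mul, ← wave_neg, neg_neg]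
    rw [show normConst * (jostPlus q n θ + reflection q (-θ) * jostPlus q n (-θ))
      - normConst * wave (-θ) n - reflection q (-θ) * (normConst * wave θ n)
      = normConst * ((jostPlus q n θ - wave (-θ) n)
        + reflection q (-θ) * (jostPlus q n (-θ) - wave θ n)) by ring]
    refine (aux _ _ norm_normConst_le).trans ((norm_add_le _ _).trans ?_)
    rw [neg_neg] at h2
    linarith [(aux _ (jostPlus q n (-θ) - wave θ n) (norm_reflection_le hq (-θ))).trans h2]

open MeasureTheory

/-! ### Trigonometric polynomials -/

/-- Trigonometric polynomials of degree at most `D`. -/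
def trigPoly (D : ℕ) : Submodule ℂ (ℝ → ℂ) :=
  Submodule.span ℂ ((fun (j : ℤ) (θ : ℝ) => wave θ j) '' {j | |j| ≤ D})

theorem wave_mem_trigPoly {D : ℕ} {j : ℤ} (h : |j| ≤ D) : (fun θ => wave θ j) ∈ trigPoly D :=
  Submodule.subset_span ⟨j, h, rfl⟩

theorem wave_neg_mem_trigPoly {D : ℕ} {j : ℤ} (h : |j| ≤ D) :
    (fun θ => wave (-θ) j) ∈ trigPoly D := by
  simp only [wave_neg]
  exact wave_mem_trigPoly (by rwa [abs_neg])

theorem trigPoly_mono {D E : ℕ} (h : D ≤ E) : trigPoly D ≤ trigPoly E :=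
  Submodule.span_mono (Set.image_mono fun j (hj : |j| ≤ D) =>
    hj.trans (by exact_mod_cast h))

theorem mul_mem_trigPoly {D E : ℕ} {p r : ℝ → ℂ} (hp : p ∈ trigPoly D) (hr : r ∈ trigPoly E) :
    (fun θ => p θ * r θ) ∈ trigPoly (D + E) := by
  have h : trigPoly D * trigPoly E ≤ trigPoly (D + E) := by
    rw [trigPoly, trigPoly, Submodule.span_mul_span, Submodule.span_le]
    rintro _ ⟨_, ⟨i, hi, rfl⟩, _, ⟨j, hj, rfl⟩, rfl⟩
    have e : ((fun θ => wave θ i) * fun θ => wave θ j) = fun θ => wave θ (i + j) := by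
      funext θ; exact (wave_add θ i j).symm
    change ((fun θ => wave θ i) * fun θ => wave θ j) ∈ _
    rw [e]
    refine wave_mem_trigPoly ((abs_add_le i j).trans ?_)
    push_cast
    exact add_le_add hi hj
  exact h (Submodule.mul_mem_mul hp hr)

theorem const_mem_trigPoly (c : ℂ) (D : ℕ) : (fun _ => c) ∈ trigPoly D := by
  have := (trigPoly D).smul_mem c (wave_mem_trigPoly (D := D) (j := 0) (by simp))
  convert this using 1
  funext θ
  simp [wave_zero]

theorem comp_neg_mem_trigPoly {D : ℕ} {p : ℝ → ℂ} (hp : p ∈ trigPoly D) :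
    (fun θ => p (-θ)) ∈ trigPoly D := by
  induction hp using Submodule.span_induction with
  | mem x hx =>
    obtain ⟨j, hj, rfl⟩ := hx
    exact wave_neg_mem_trigPoly hj
  | zero => exact (trigPoly D).zero_mem
  | add x y _ _ hx hy => exact (trigPoly D).add_mem hx hy
  | smul a x _ hx => exact (trigPoly D).smul_mem a hx

theorem continuous_of_mem_trigPoly {D : ℕ} {p : ℝ → ℂ} (hp : p ∈ trigPoly D) : Continuous p := by
  induction hp using Submodule.span_induction with
  | mem x hx =>
    obtain ⟨j, hj, rfl⟩ := hx
    exact continuous_wave j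
  | zero => exact continuous_const
  | add x y _ _ hx hy => exact hx.add hy
  | smul a x _ hx => exact hx.const_smul a

theorem wave_period (θ : ℝ) (n : ℤ) : wave (θ + 2 * Real.pi) n = wave θ n := by
  rw [wave, wave, Complex.exp_eq_exp_iff_exists_int]
  exact ⟨n, by push_cast; ring⟩

theorem integral_wave (n : ℤ) :
    ∫ θ in (-Real.pi)..Real.pi, wave θ n = if n = 0 then 2 * (Real.pi : ℂ) else 0 := by
  split_ifs with h
  · subst h
    simp [wave_zero]
    ring
  · have hc : Complex.I * n ≠ 0 := mul_ne_zero Complex.I_ne_zero (by exact_mod_cast h)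
    have e : ∀ θ : ℝ, wave θ n = Complex.exp (Complex.I * n * θ) := fun θ => by
      rw [wave]; ring_nf
    simp_rw [e]
    rw [integral_exp_mul_complex hc]
    have := wave_period (-Real.pi) n
    rw [show -Real.pi + 2 * Real.pi = Real.pi by ring, e, e] at this
    rw [this, sub_self, zero_div]

theorem integral_trigPoly_mul_wave {D : ℕ} {p : ℝ → ℂ} (hp : p ∈ trigPoly D) {k : ℤ}
    (hk : D < |k|) : ∫ θ in (-Real.pi)..Real.pi, p θ * wave θ k = 0 := by
  have hcont : ∀ x ∈ trigPoly D, IntervalIntegrable (fun θ => x θ * wave θ k) volume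
      (-Real.pi) Real.pi := fun x hx =>
    ((continuous_of_mem_trigPoly hx).mul (continuous_wave k)).intervalIntegrable _ _
  induction hp using Submodule.span_induction with
  | mem x hx =>
    obtain ⟨j, hj, rfl⟩ := hx
    simp_rw [← wave_add, integral_wave]
    rw [if_neg]
    intro h
    have : |j| ≤ D := hj
    rw [eq_neg_of_add_eq_zero_left h, abs_neg] at this
    omega
  | zero => simp
  | add x y hx hy ihx ihy =>
    simp only [Pi.add_apply, add_mul]
    rw [intervalIntegral.integral_add (hcont x hx) (hcont y hy), ihx, ihy, add_zero]
  | smul a x _ ih =>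
    simp only [Pi.smul_apply, smul_eq_mul, mul_assoc]
    rw [intervalIntegral.integral_const_mul, ih, mul_zero]

/-! ### Potentials of finite support -/

theorem jostPlus_eq_wave {q : ℤ → ℝ} (hq : MemEllOneOne q) {N : ℕ} (h : ∀ n : ℤ, N < |n| → q n = 0)
    {n : ℤ} (hn : N ≤ n) (θ : ℝ) : jostPlus q n θ = wave (-θ) n := by
  obtain ⟨f, hf, hfg⟩ := exists_extension q θ (g := wave (-θ)) N fun k hk => by
    have := wave_rec (-θ) (k + 1)
    rw [add_sub_cancel_right, Real.cos_neg, show (k : ℤ) + 1 + 1 = k + 2 by ring] at this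
    rw [h _ (by rw [abs_of_nonneg] <;> omega)]
    simpa using this
  have hfz : ∀ k : ℤ, N ≤ k → f k = wave (-θ) k := fun k hk => by
    obtain ⟨m, rfl⟩ : ∃ m : ℕ, k = m := ⟨k.toNat, by omega⟩
    exact hfg m (by omega)
  have hj : IsJostPlus q θ f := ⟨hf, tendsto_const_nhds.congr' (by
    filter_upwards [eventually_ge_atTop (N : ℤ)] with k hk
    rw [hfz k hk, sub_self])⟩
  rw [hj.jostPlus_eq hq, hfz n hn]

theorem two_cos_mem_trigPoly (c : ℂ) : (fun θ : ℝ => 2 * (Real.cos θ : ℂ) + c) ∈ trigPoly 1 := by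
  have : (fun θ : ℝ => 2 * (Real.cos θ : ℂ) + c)
      = (fun θ => wave θ 1) + (fun θ => wave (-θ) 1) + fun _ => c := by
    funext θ
    simp only [Pi.add_apply, wave_one_add]
  rw [this]
  exact (trigPoly 1).add_mem ((trigPoly 1).add_mem (wave_mem_trigPoly (by simp))
    (wave_neg_mem_trigPoly (by simp))) (const_mem_trigPoly c 1)

theorem jostPlus_mem_trigPoly {q : ℤ → ℝ} (hq : MemEllOneOne q) {N : ℕ}
    (h : ∀ n : ℤ, N < |n| → q n = 0) (n : ℤ) :
    ∃ D, jostPlus q n ∈ trigPoly D := by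
  have large : ∀ m : ℤ, N ≤ m → ∃ D, jostPlus q m ∈ trigPoly D := fun m hm => by
    refine ⟨m.natAbs, ?_⟩
    rw [show jostPlus q m = fun θ => wave (-θ) m from
      funext fun θ => jostPlus_eq_wave hq h hm θ]
    exact wave_neg_mem_trigPoly (by rw [Int.abs_eq_natAbs])
  have small : ∀ j : ℕ, (∃ D, jostPlus q (N - j) ∈ trigPoly D) ∧
      ∃ D, jostPlus q (N - j + 1) ∈ trigPoly D := by
    intro j
    induction j with
    | zero => exact ⟨large _ (by simp), large _ (by simp)⟩
    | succ j ih =>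
      obtain ⟨⟨D, hD⟩, E, hE⟩ := ih
      rw [show (N : ℤ) - (j + 1 : ℕ) = N - j - 1 by push_cast; ring, sub_add_cancel]
      refine ⟨⟨max (1 + D) E, ?_⟩, D, hD⟩
      rw [show jostPlus q (N - j - 1) = (fun θ => (2 * (Real.cos θ : ℂ) + q (N - j))
        * jostPlus q (N - j) θ) - jostPlus q (N - j + 1) from funext fun θ => jostPlus_rec hq θ _]
      exact (trigPoly _).sub_mem
        (trigPoly_mono (le_max_left _ _) (mul_mem_trigPoly (two_cos_mem_trigPoly _) hD))
        (trigPoly_mono (le_max_right _ _) hE)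
  rcases le_or_gt (N : ℤ) n with hn | hn
  · exact large n hn
  · obtain ⟨j, rfl⟩ : ∃ j : ℕ, n = N - j := ⟨(N - n).toNat, by omega⟩
    exact (small j).1

theorem exists_trigPoly_jostPlus {q : ℤ → ℝ} (hq : MemEllOneOne q) {N : ℕ}
    (h : ∀ n : ℤ, N < |n| → q n = 0) (s : Finset ℤ) :
    ∃ D, ∀ n ∈ s, jostPlus q n ∈ trigPoly D := by
  choose D hD using jostPlus_mem_trigPoly hq h
  exact ⟨s.sup D, fun n hn => trigPoly_mono (Finset.le_sup hn) (hD n)⟩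

/-- The potential restricted to `[-N, N]`. -/
def truncate (q : ℤ → ℝ) (N : ℕ) : ℤ → ℝ := fun n => if |n| ≤ N then q n else 0

theorem abs_truncate_le (q : ℤ → ℝ) (N : ℕ) (n : ℤ) : |truncate q N n| ≤ |q n| := by
  unfold truncate; split_ifs <;> simp

theorem truncate_eq_zero (q : ℤ → ℝ) (N : ℕ) {n : ℤ} (h : N < |n|) : truncate q N n = 0 :=
  if_neg (not_le.2 h)

theorem truncate_eq (q : ℤ → ℝ) {N : ℕ} {n : ℤ} (h : |n| ≤ N) : truncate q N n = q n := if_pos h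

theorem reflect_truncate (q : ℤ → ℝ) (N : ℕ) : reflect (truncate q N) = truncate (reflect q) N := by
  funext n; simp [reflect, truncate]

theorem MemEllOneOne.truncate {q : ℤ → ℝ} (hq : MemEllOneOne q) (N : ℕ) :
    MemEllOneOne (truncate q N) := hq.of_abs_le (abs_truncate_le q N)

theorem eventually_truncate_eq (q : ℤ → ℝ) (n : ℤ) : ∀ᶠ N in atTop, truncate q N n = q n := by
  filter_upwards [eventually_ge_atTop n.natAbs] with N hN
  refine truncate_eq q ?_
  rw [Int.abs_eq_natAbs]
  exact_mod_cast hN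

/-- The weighted norm of the part of `q` that `truncate` removes. -/
def truncationError (q : ℤ → ℝ) (N : ℕ) : ℝ :=
  ∑' m : ℤ, Real.sqrt (1 + (m : ℝ) ^ 2) * |q m - truncate q N m|

theorem abs_sub_truncate_le (q : ℤ → ℝ) (N : ℕ) (n : ℤ) : |q n - truncate q N n| ≤ |q n| := by
  unfold DiscreteSchrodinger.truncate; split_ifs <;> simp

theorem MemEllOneOne.sub_truncate {q : ℤ → ℝ} (hq : MemEllOneOne q) (N : ℕ) :
    MemEllOneOne fun n => q n - DiscreteSchrodinger.truncate q N n :=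
  hq.of_abs_le (abs_sub_truncate_le q N)

theorem MemEllOneOne.tendsto_truncationError {q : ℤ → ℝ} (hq : MemEllOneOne q) :
    Tendsto (truncationError q) atTop (𝓝 0) := by
  have := tendsto_tsum_of_dominated_convergence (𝓕 := atTop)
    (f := fun (N : ℕ) (m : ℤ) => Real.sqrt (1 + (m : ℝ) ^ 2) * |q m - DiscreteSchrodinger.truncate q N m|)
    (g := fun _ => 0) hq (fun m => ?_) (Eventually.of_forall fun N m => ?_)
  · rw [tsum_zero] at this
    exact this
  · refine tendsto_const_nhds.congr' ?_
    filter_upwards [eventually_truncate_eq q m] with N hN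
    simp [hN]
  · rw [Real.norm_eq_abs, abs_of_nonneg (by positivity)]
    exact mul_le_mul_of_nonneg_left (abs_sub_truncate_le q N m) (Real.sqrt_nonneg _)

theorem tailMoment_le {p : ℤ → ℝ} (hp : MemEllOneOne p) (n : ℕ) :
    tailMoment p n ≤ ∑' m : ℤ, Real.sqrt (1 + (m : ℝ) ^ 2) * |p m| :=
  Summable.tsum_le_tsum_of_inj (fun j : ℕ => (n : ℤ) + 1 + j) (fun a b h => by simpa using h)
    (fun _ _ => by positivity) (moment_term_le p n) (hp.summable_moment n) hp

/-- The difference solves the Volterra equation of the truncated potential with a source of size at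
most `2 * truncationError q N`; the contraction constant `1/2` doubles this. -/
theorem norm_jostPlus_sub_truncate_le {q : ℤ → ℝ} (hq : MemEllOneOne q) {n₀ : ℕ}
    (h : SmallFrom q n₀) (θ : ℝ) (N : ℕ) {n : ℕ} (hn : n₀ ≤ n) :
    ‖jostPlus q n θ - jostPlus (truncate q N) n θ‖ ≤ 4 * truncationError q N := by
  have hqN := hq.truncate N
  have hN : SmallFrom (truncate q N) n₀ := fun k hk =>
    (tailMoment_mono hq (abs_truncate_le q N) k).trans (h k hk)
  set d : ℤ → ℂ := fun k => jostPlus q k θ - jostPlus (truncate q N) k θ with hd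
  have eq : ∀ k : ℕ, n₀ ≤ k → d k = volterra (fun n => q n - truncate q N n) θ
      (fun k => jostPlus q k θ) k + volterra (truncate q N) θ d k := fun k hk => by
    have b1 : ∀ l : ℕ, k < l → ‖jostPlus q l θ‖ ≤ 2 := fun l hl =>
      norm_jostPlus_le_two hq h θ (by omega)
    have b2 : ∀ l : ℕ, k < l → ‖jostPlus (truncate q N) l θ‖ ≤ 2 := fun l hl =>
      norm_jostPlus_le_two hqN hN θ (by omega)
    change jostPlus q k θ - jostPlus (truncate q N) k θ = _
    rw [jostPlus_eq_volterra hq h θ hk, jostPlus_eq_volterra hqN hN θ hk,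
      add_sub_add_left_eq_sub, volterra, volterra, volterra, volterra,
      ← (summable_volterraTerm (f := fun k => jostPlus q k θ) hq b1).tsum_sub
        (summable_volterraTerm (f := fun k => jostPlus (truncate q N) k θ) hqN b2),
      ← (summable_volterraTerm (f := fun k => jostPlus q k θ) (hq.sub_truncate N) b1).tsum_add
        (summable_volterraTerm (C := 4) (f := d) hqN fun l hl => by
          refine (norm_sub_le _ _).trans ?_
          linarith [b1 l hl, b2 l hl])]
    refine tsum_congr fun j => ?_
    simp only [volterraTerm, hd]
    push_cast
    ring
  -- Iterating this improvement from the a priori bound `4` leads to its fixed point `4 *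
  -- truncationError q N`.
  have step : ∀ C, (∀ k : ℕ, n₀ ≤ k → ‖d k‖ ≤ C) →
      ∀ k : ℕ, n₀ ≤ k → ‖d k‖ ≤ 2 * truncationError q N + C / 2 := fun C hC k hk => by
    rw [eq k hk]
    refine (norm_add_le _ _).trans (add_le_add ?_ ?_)
    · refine (norm_volterra_le (C := 2) (hq.sub_truncate N) fun l hl =>
        norm_jostPlus_le_two hq h θ (by omega)).trans ?_
      rw [mul_comm]
      exact mul_le_mul_of_nonneg_left (tailMoment_le (hq.sub_truncate N) k) (by norm_num)
    · refine (norm_volterra_le hqN fun l hl => hC l (by omega)).trans ?_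
      have : 0 ≤ C := (norm_nonneg _).trans (hC n₀ le_rfl)
      nlinarith [hN k hk]
  have iter : ∀ j : ℕ, ∀ k : ℕ, n₀ ≤ k → ‖d k‖ ≤ 4 * truncationError q N + 4 * (1 / 2) ^ j := by
    intro j
    induction j with
    | zero =>
      intro k hk
      have h0 : 0 ≤ truncationError q N := tsum_nonneg fun _ => by positivity
      have := norm_sub_le (jostPlus q k θ) (jostPlus (truncate q N) k θ)
      have h1 := norm_jostPlus_le_two hq h θ hk
      have h2 := norm_jostPlus_le_two hqN hN θ hk
      simp only [hd, pow_zero]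
      linarith
    | succ j ih =>
      intro k hk
      refine (step _ ih k hk).trans_eq ?_
      rw [pow_succ]; ring
  have lim : Tendsto (fun j : ℕ => 4 * truncationError q N + 4 * (1 / 2 : ℝ) ^ j) atTop
      (𝓝 (4 * truncationError q N + 4 * 0)) :=
    ((tendsto_pow_atTop_nhds_zero_of_lt_one (by norm_num) (by norm_num)).const_mul 4).const_add _
  rw [mul_zero, add_zero] at lim
  exact ge_of_tendsto' lim fun j => iter j n hn

theorem tendsto_jostPlus_truncate {q : ℤ → ℝ} (hq : MemEllOneOne q) (θ : ℝ) (n : ℤ) :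
    Tendsto (fun N => jostPlus (truncate q N) n θ) atTop (𝓝 (jostPlus q n θ)) := by
  obtain ⟨n₀, h⟩ := hq.exists_smallFrom
  have large : ∀ m : ℕ, n₀ ≤ m →
      Tendsto (fun N => jostPlus (truncate q N) m θ) atTop (𝓝 (jostPlus q m θ)) := fun m hm => by
    rw [tendsto_iff_norm_sub_tendsto_zero]
    refine squeeze_zero (fun _ => norm_nonneg _) (fun N => ?_)
      (by simpa using hq.tendsto_truncationError.const_mul 4)
    rw [norm_sub_rev]
    exact norm_jostPlus_sub_truncate_le hq h θ N hm
  have small : ∀ j : ℕ,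
      Tendsto (fun N => jostPlus (truncate q N) (n₀ - j) θ) atTop (𝓝 (jostPlus q (n₀ - j) θ)) ∧
      Tendsto (fun N => jostPlus (truncate q N) (n₀ - j + 1) θ) atTop
        (𝓝 (jostPlus q (n₀ - j + 1) θ)) := by
    intro j
    induction j with
    | zero =>
      refine ⟨by simpa using large n₀ le_rfl, ?_⟩
      simpa using large (n₀ + 1) (by omega)
    | succ j ih =>
      rw [show (n₀ : ℤ) - (j + 1 : ℕ) = n₀ - j - 1 by push_cast; ring, sub_add_cancel]
      refine ⟨?_, ih.1⟩
      rw [jostPlus_rec hq]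
      simp only [jostPlus_rec (hq.truncate _)]
      refine (Tendsto.mul ?_ ih.1).sub ih.2
      refine tendsto_const_nhds.congr' ?_
      filter_upwards [eventually_truncate_eq q (n₀ - j)] with N hN
      rw [hN]
  rcases le_or_gt (n₀ : ℤ) n with hn | hn
  · obtain ⟨m, rfl⟩ : ∃ m : ℕ, n = m := ⟨n.toNat, by omega⟩
    exact large m (by omega)
  · obtain ⟨j, rfl⟩ : ∃ j : ℕ, n = n₀ - j := ⟨(n₀ - n).toNat, by omega⟩
    exact (small j).1

theorem tendsto_jostMinus_truncate {q : ℤ → ℝ} (hq : MemEllOneOne q) (θ : ℝ) (n : ℤ) :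
    Tendsto (fun N => jostMinus (truncate q N) n θ) atTop (𝓝 (jostMinus q n θ)) := by
  rw [jostMinus_eq hq]
  simp only [jostMinus_eq (hq.truncate _), reflect_truncate]
  exact tendsto_jostPlus_truncate hq.reflect θ (-n)

theorem tendsto_transmission_truncate {q : ℤ → ℝ} (hq : MemEllOneOne q) (θ : ℝ) :
    Tendsto (fun N => transmission (truncate q N) θ) atTop (𝓝 (transmission q θ)) := by
  -- At the thresholds the numerator is zero, so `T = 0` for every potential, whether or not the
  -- denominator vanishes.
  by_cases h : Real.sin θ = 0
  · simp [transmission, h]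
  · refine Tendsto.div tendsto_const_nhds ?_ (jostWronskian_ne_zero hq h)
    exact ((tendsto_jostPlus_truncate hq θ 1).mul (tendsto_jostMinus_truncate hq θ 0)).sub
      ((tendsto_jostPlus_truncate hq θ 0).mul (tendsto_jostMinus_truncate hq θ 1))

theorem tendsto_planeWave_truncate {q : ℤ → ℝ} (hq : MemEllOneOne q) (n : ℤ) (θ : ℝ) :
    Tendsto (fun N => planeWave (truncate q N) n θ) atTop (𝓝 (planeWave q n θ)) := by
  rcases le_or_gt 0 θ with h | h
  · simp only [planeWave_of_nonneg _ _ h]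
    exact ((tendsto_transmission_truncate hq θ).mul (tendsto_jostPlus_truncate hq θ n)).const_mul _
  · simp only [planeWave_of_neg _ _ h]
    exact ((tendsto_transmission_truncate hq _).mul
      (tendsto_jostMinus_truncate hq _ n)).const_mul _

/-! ### Measurability in the angle -/

/-- For truncated potentials the Jost functions are trigonometric polynomials, and measurability
passes to pointwise limits. -/
theorem measurable_jostPlus {q : ℤ → ℝ} (hq : MemEllOneOne q) (n : ℤ) :
    Measurable (jostPlus q n) :=
  measurable_of_tendsto_metrizable (f := fun N => jostPlus (truncate q N) n)
    (fun N => by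
      obtain ⟨D, hD⟩ := jostPlus_mem_trigPoly (hq.truncate N) (fun _ => truncate_eq_zero q N) n
      exact (continuous_of_mem_trigPoly hD).measurable)
    (tendsto_pi_nhds.2 fun θ => tendsto_jostPlus_truncate hq θ n)

theorem measurable_jostMinus {q : ℤ → ℝ} (hq : MemEllOneOne q) (n : ℤ) :
    Measurable (jostMinus q n) := by
  rw [show jostMinus q n = jostPlus (reflect q) (-n) from funext fun θ => jostMinus_eq hq n θ]
  exact measurable_jostPlus hq.reflect _

theorem measurable_jostWronskian {q : ℤ → ℝ} (hq : MemEllOneOne q) :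
    Measurable (jostWronskian q) :=
  ((measurable_jostPlus hq 1).mul (measurable_jostMinus hq 0)).sub
    ((measurable_jostPlus hq 0).mul (measurable_jostMinus hq 1))

theorem measurable_crossWronskian {q : ℤ → ℝ} (hq : MemEllOneOne q) :
    Measurable (crossWronskian q) :=
  ((measurable_jostMinus hq 1).mul ((measurable_jostPlus hq 0).comp measurable_neg)).sub
    ((measurable_jostMinus hq 0).mul ((measurable_jostPlus hq 1).comp measurable_neg))

theorem measurable_transmission {q : ℤ → ℝ} (hq : MemEllOneOne q) :
    Measurable (transmission q) :=
  Measurable.div (by fun_prop) (measurable_jostWronskian hq)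

theorem measurable_reflection {q : ℤ → ℝ} (hq : MemEllOneOne q) : Measurable (reflection q) :=
  (measurable_crossWronskian hq).div (measurable_jostWronskian hq)

theorem measurable_planeWave {q : ℤ → ℝ} (hq : MemEllOneOne q) (n : ℤ) :
    Measurable (planeWave q n) := by
  have h : planeWave q n = fun θ => if 0 ≤ θ then
      normConst * (transmission q θ * jostPlus q n θ)
      else normConst * (transmission q (-θ) * jostMinus q n (-θ)) := by
    funext θ
    split_ifs with h
    · exact planeWave_of_nonneg q n h
    · exact planeWave_of_neg q n (not_le.1 h)
  rw [h]
  refine Measurable.ite measurableSet_Ici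
    (((measurable_transmission hq).mul (measurable_jostPlus hq n)).const_mul _) ?_
  exact (((measurable_transmission hq).comp measurable_neg).mul
    ((measurable_jostMinus hq n).comp measurable_neg)).const_mul _

theorem measurable_ampTransmitted {q : ℤ → ℝ} (hq : MemEllOneOne q) :
    Measurable (ampTransmitted q) :=
  Measurable.ite measurableSet_Ici (measurable_transmission hq) measurable_const

theorem measurable_ampReflected {q : ℤ → ℝ} (hq : MemEllOneOne q) :
    Measurable (ampReflected q) :=
  Measurable.ite measurableSet_Ici measurable_const
    ((measurable_reflection hq).comp measurable_neg)

theorem continuous_freeWave (n : ℤ) : Continuous (freeWave n) :=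
  continuous_const.mul ((continuous_wave n).comp continuous_neg)

theorem norm_freeWave_le (n : ℤ) (θ : ℝ) : ‖freeWave n θ‖ ≤ 1 := by
  rw [freeWave_eq, norm_mul, norm_wave, mul_one]
  exact norm_normConst_le

theorem memLp_of_bound {f : ℝ → ℂ} (hf : Measurable f) {C : ℝ} (hC : ∀ θ, ‖f θ‖ ≤ C) :
    MemLp f 2 torusMeasure :=
  MemLp.of_bound hf.aestronglyMeasurable C (Eventually.of_forall hC)

theorem memLp_freeWave (n : ℤ) : MemLp (freeWave n) 2 torusMeasure :=
  memLp_of_bound (continuous_freeWave n).measurable (norm_freeWave_le n)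

theorem memLp_planeWave {q : ℤ → ℝ} (hq : MemEllOneOne q) (n : ℤ) :
    MemLp (planeWave q n) 2 torusMeasure := by
  obtain ⟨C, hC⟩ := exists_planeWave_bound hq n
  exact memLp_of_bound (measurable_planeWave hq n) (hC q fun _ => le_rfl)

/-! ### Square summable functions -/

theorem Ell2.hasSum_norm_sq (u : Ell2) : HasSum (fun n => ‖u n‖ ^ 2) (‖u‖ ^ 2) := by
  have h := lp.hasSum_norm (p := 2) (by norm_num) u
  simpa using h

theorem Ell2.norm_le_of_forall_sum_le {u : Ell2} {C : ℝ} (hC : 0 ≤ C)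
    (h : ∀ s : Finset ℤ, ∑ n ∈ s, ‖u n‖ ^ 2 ≤ C ^ 2) : ‖u‖ ≤ C :=
  abs_le_of_sq_le_sq' ((hasSum_le_of_sum_le (Ell2.hasSum_norm_sq u) h)) hC |>.2

theorem memℓp_two_of_summable {f : ℤ → ℂ} (h : Summable fun n => ‖f n‖ ^ 2) : Memℓp f 2 :=
  memℓp_gen (by simpa using h)

/-- Dominated convergence in `ℓ²`. -/
theorem Ell2.tendsto_zero_of_dominated {ι : Type*} {l : Filter ι} {Y : ι → Ell2} {ρ : ℤ → ℝ}
    (hρ : Summable fun n => ρ n ^ 2) (hb : ∀ᶠ s in l, ∀ n, ‖Y s n‖ ≤ ρ n)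
    (h0 : ∀ n, Tendsto (fun s => Y s n) l (𝓝 0)) : Tendsto Y l (𝓝 0) := by
  have h : Tendsto (fun s => ∑' n, ‖Y s n‖ ^ 2) l (𝓝 (∑' _ : ℤ, (0 : ℝ))) := by
    refine tendsto_tsum_of_dominated_convergence hρ (fun n => ?_) ?_
    · simpa using (h0 n).norm.pow 2
    · filter_upwards [hb] with s hs n
      rw [Real.norm_eq_abs, abs_of_nonneg (by positivity)]
      exact pow_le_pow_left₀ (norm_nonneg _) (hs n) 2
  simp only [(Ell2.hasSum_norm_sq _).tsum_eq, tsum_zero] at h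
  rw [tendsto_zero_iff_norm_tendsto_zero]
  have := h.sqrt
  simpa using this

/-- The coordinate projection onto the functions supported in `s`. -/
def coordProj (s : Set ℤ) : Ell2 →L[ℂ] Ell2 :=
  lp.mapCLM 2 (fun n : ℤ => (s.indicator 1 n : ℂ) • ContinuousLinearMap.id ℂ ℂ) (K := 1)
    zero_le_one fun n => by
      rw [norm_smul, ContinuousLinearMap.norm_id, mul_one]
      by_cases h : n ∈ s <;> simp [h]

theorem coordProj_apply (s : Set ℤ) (u : Ell2) (n : ℤ) :
    coordProj s u n = s.indicator u n := by
  change (s.indicator 1 n : ℂ) * u n = _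
  by_cases h : n ∈ s <;> simp [h]

theorem norm_coordProj_le (s : Set ℤ) (u : Ell2) : ‖coordProj s u‖ ≤ ‖u‖ := by
  refine Ell2.norm_le_of_forall_sum_le (norm_nonneg _) fun t => ?_
  refine le_trans (Finset.sum_le_sum fun n _ => ?_)
    (sum_le_hasSum t (fun _ _ => by positivity) (Ell2.hasSum_norm_sq u))
  rw [coordProj_apply]
  exact pow_le_pow_left₀ (norm_nonneg _) (norm_indicator_le_norm_self _ _) 2

/-- The unit vectors. -/
def unitVec (n : ℤ) : Ell2 := lp.single 2 n (1 : ℂ)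

theorem inner_unitVec (n : ℤ) (u : Ell2) : inner ℂ (unitVec n) u = u n := by
  rw [unitVec, lp.inner_single_left]
  simp

theorem unitVec_apply (n m : ℤ) : unitVec n m = if m = n then 1 else 0 := by
  rw [unitVec, lp.single_apply]
  by_cases h : m = n
  · subst h; simp
  · simp [h]

theorem Ell2.hasSum_unitVec (u : Ell2) : HasSum (fun n => u n • unitVec n) u := by
  have h := lp.hasSum_single (p := 2) (by norm_num) u
  convert h using 2 with n
  rw [unitVec, ← lp.single_smul]
  simp

/-! ### Generalities on Hilbert spaces -/

section Hilbert

variable {E : Type*} [NormedAddCommGroup E] [InnerProductSpace ℂ E]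
  {F : Type*} [NormedAddCommGroup F] [NormedSpace ℂ F]

/-- The operator `f ↦ (⟪v n, f⟫)ₙ` of a Bessel family. -/
def besselOp (v : ℤ → E) (C : ℝ) (hC : 0 ≤ C)
    (h : ∀ (f : E) (s : Finset ℤ), ∑ n ∈ s, ‖inner ℂ (v n) f‖ ^ 2 ≤ (C * ‖f‖) ^ 2) :
    E →L[ℂ] Ell2 :=
  LinearMap.mkContinuous
    { toFun := fun f => ⟨fun n => inner ℂ (v n) f, memℓp_two_of_summable
        (summable_of_sum_le (fun _ => by positivity) (h f))⟩
      map_add' := fun f g => by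
        ext n
        exact inner_add_right _ _ _
      map_smul' := fun c f => by
        ext n
        exact inner_smul_right _ _ _ } C
    fun f => Ell2.norm_le_of_forall_sum_le (by positivity) (h f)

theorem besselOp_apply (v : ℤ → E) (C : ℝ) (hC : 0 ≤ C)
    (h : ∀ (f : E) (s : Finset ℤ), ∑ n ∈ s, ‖inner ℂ (v n) f‖ ^ 2 ≤ (C * ‖f‖) ^ 2) (f : E)
    (n : ℤ) : besselOp v C hC h f n = inner ℂ (v n) f := rfl

variable [CompleteSpace E]

/-- Uniformly bounded operators that tend to zero on a total set tend to zero strongly. -/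
theorem tendsto_zero_of_total {ι : Type*} {l : Filter ι} {Y : ι → E →L[ℂ] F} {C : ℝ}
    (hY : ∀ s f, ‖Y s f‖ ≤ C * ‖f‖) {D : Set E} (hD : ∀ f ∈ D, Tendsto (fun s => Y s f) l (𝓝 0))
    (htot : ∀ f : E, (∀ g ∈ D, inner ℂ g f = 0) → f = 0) (f : E) :
    Tendsto (fun s => Y s f) l (𝓝 0) := by
  let S : Submodule ℂ E :=
    { carrier := {f | Tendsto (fun s => Y s f) l (𝓝 0)}
      zero_mem' := by simpa using tendsto_const_nhds
      add_mem' := fun {f g} hf hg => by simpa using hf.add hg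
      smul_mem' := fun c f hf => by simpa using hf.const_smul c }
  have hcl : IsClosed (S : Set E) := by
    rw [← isSeqClosed_iff_isClosed]
    intro x y hx hxy
    change Tendsto (fun s => Y s y) l (𝓝 0)
    rw [tendsto_zero_iff_norm_tendsto_zero, Metric.tendsto_nhds]
    intro ε hε
    have hC : 0 < |C| + 1 := by positivity
    obtain ⟨n, hn⟩ := (((tendsto_iff_norm_sub_tendsto_zero.1 hxy).const_mul (|C| + 1)).eventually
      (gt_mem_nhds (show (|C| + 1) * 0 < ε / 2 by linarith))).exists
    have hs : Tendsto (fun s => ‖Y s (x n)‖) l (𝓝 0) :=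
      tendsto_zero_iff_norm_tendsto_zero.1 (hx n)
    filter_upwards [hs.eventually (gt_mem_nhds (half_pos hε))] with s hs
    have h1 : ‖Y s y‖ ≤ ‖Y s (x n)‖ + ‖Y s (x n - y)‖ := by
      rw [map_sub]
      have := norm_sub_le (Y s (x n)) (Y s (x n) - Y s y)
      simpa using this
    have h2 : ‖Y s (x n - y)‖ ≤ (|C| + 1) * ‖x n - y‖ :=
      (hY s _).trans (mul_le_mul_of_nonneg_right (by linarith [le_abs_self C]) (norm_nonneg _))
    rw [Real.dist_eq, sub_zero, abs_of_nonneg (norm_nonneg _)]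
    linarith
  have : CompleteSpace S := hcl.completeSpace_coe
  have hS : S = ⊤ := by
    rw [← Submodule.orthogonal_eq_bot_iff, Submodule.eq_bot_iff]
    intro f hf
    exact htot f fun g hg => (Submodule.mem_orthogonal S f).1 hf g (hD g hg)
  have : f ∈ S := hS ▸ Submodule.mem_top
  exact this

theorem adjoint_unitVec {v : ℤ → E} {V : E →L[ℂ] Ell2} (hV : ∀ f n, V f n = inner ℂ (v n) f)
    (n : ℤ) : V.adjoint (unitVec n) = v n := by
  refine ext_inner_right ℂ fun f => ?_
  rw [ContinuousLinearMap.adjoint_inner_left, inner_unitVec, hV]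

/-- Once the analysis operator is known to be bounded, the series of its adjoint converges
unconditionally as the image of the expansion in unit vectors. -/
theorem hasSum_adjoint {v : ℤ → E} {V : E →L[ℂ] Ell2} (hV : ∀ f n, V f n = inner ℂ (v n) f)
    (u : Ell2) : HasSum (fun n => u n • v n) (V.adjoint u) := by
  have h := V.adjoint.hasSum (Ell2.hasSum_unitVec u)
  simpa [adjoint_unitVec hV] using h

end Hilbert

/-! ### The Hilbert space of the circle -/

theorem coeFn_toL2 {f : ℝ → ℂ} (hf : MemLp f 2 torusMeasure) : toL2 f =ᵐ[torusMeasure] f := by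
  rw [toL2, dif_pos hf]
  exact hf.coeFn_toLp

theorem L2Torus.inner_def (f g : L2Torus) :
    inner ℂ f g = ∫ θ, (starRingEnd ℂ) (f θ) * g θ ∂torusMeasure := by
  rw [MeasureTheory.L2.inner_def]
  simp only [RCLike.inner_apply, mul_comm]

theorem inner_toL2 {f : ℝ → ℂ} (hf : MemLp f 2 torusMeasure) (g : L2Torus) :
    inner ℂ (toL2 f) g = ∫ θ, (starRingEnd ℂ) (f θ) * g θ ∂torusMeasure := by
  rw [L2Torus.inner_def]
  refine integral_congr_ae ?_
  filter_upwards [coeFn_toL2 hf] with θ h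
  rw [h]

theorem integral_torus (f : ℝ → ℂ) :
    ∫ θ, f θ ∂torusMeasure = ∫ θ in (-Real.pi)..Real.pi, f θ := by
  rw [intervalIntegral.integral_of_le (by linarith [Real.pi_pos])]

theorem L2Torus.norm_sq (f : L2Torus) : ‖f‖ ^ 2 = ∫ θ, ‖f θ‖ ^ 2 ∂torusMeasure := by
  have h := L2Torus.inner_def f f
  rw [inner_self_eq_norm_sq_to_K] at h
  have : (∫ θ, (starRingEnd ℂ) (f θ) * f θ ∂torusMeasure)
      = ((∫ θ, ‖f θ‖ ^ 2 ∂torusMeasure : ℝ) : ℂ) := by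
    rw [← integral_complex_ofReal]
    refine integral_congr_ae (Eventually.of_forall fun θ => ?_)
    simp only
    rw [mul_comm, Complex.mul_conj, Complex.normSq_eq_norm_sq]
  rw [this] at h
  refine Complex.ofReal_injective (Eq.trans ?_ h)
  simp

theorem normConst_sq : normConst * normConst = (2 * (Real.pi : ℂ))⁻¹ := by
  rw [normConst, ← mul_inv, ← Complex.ofReal_mul, Real.mul_self_sqrt (by positivity)]
  push_cast
  rfl

theorem conj_normConst : (starRingEnd ℂ) normConst = normConst := by
  rw [normConst, map_inv₀, Complex.conj_ofReal]

theorem conj_freeWave (n : ℤ) (θ : ℝ) :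
    (starRingEnd ℂ) (freeWave n θ) = normConst * wave θ n := by
  rw [freeWave_eq, map_mul, conj_normConst, conj_wave, neg_neg]

theorem orthonormal_freeWave : Orthonormal ℂ fun n : ℤ => toL2 (freeWave n) := by
  rw [orthonormal_iff_ite]
  intro i j
  rw [inner_toL2 (memLp_freeWave i), integral_congr_ae (g := fun θ =>
    (2 * (Real.pi : ℂ))⁻¹ * wave θ (i - j)), integral_const_mul, integral_torus, integral_wave]
  · by_cases h : i = j
    · have : (Real.pi : ℂ) ≠ 0 := by exact_mod_cast Real.pi_ne_zero
      simp [h]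
      field_simp
    · simp [h, sub_eq_zero]
  · filter_upwards [coeFn_toL2 (memLp_freeWave j)] with θ h
    rw [h, conj_freeWave, freeWave_eq, wave_neg, sub_eq_add_neg, wave_add, ← normConst_sq]
    ring

theorem eq_zero_of_inner_freeWave (f : L2Torus)
    (h : ∀ n : ℤ, inner ℂ (toL2 (freeWave n)) f = 0) : f = 0 := by
  have hab : -Real.pi < Real.pi := by linarith [Real.pi_pos]
  have hs := hasSum_sq_fourierCoeffOn hab (Lp.memLp f)
  have hz : ∀ i, fourierCoeffOn hab f i = 0 := fun i => by
    rw [fourierCoeffOn_eq_integral]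
    have h1 := h (-i)
    rw [inner_toL2 (memLp_freeWave _)] at h1
    simp only [conj_freeWave, mul_assoc] at h1
    rw [integral_const_mul, integral_torus] at h1
    have h2 := (mul_eq_zero.1 h1).resolve_left normConst_ne_zero
    rw [smul_eq_zero]
    right
    rw [← h2]
    congr 1
    funext θ
    rw [fourier_coe_apply, smul_eq_mul, wave]
    congr 2
    have : (Real.pi : ℂ) ≠ 0 := by exact_mod_cast Real.pi_ne_zero
    push_cast
    field_simp
    ring
  simp only [hz, norm_zero, ne_eq, OfNat.ofNat_ne_zero, not_false_eq_true, zero_pow] at hs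
  have h0 := hs.unique hasSum_zero
  rw [smul_eq_zero, intervalIntegral.integral_of_le hab.le] at h0
  have h1 := h0.resolve_left (inv_ne_zero (by linarith [Real.pi_pos]))
  have h2 := L2Torus.norm_sq f
  rw [h1] at h2
  simpa using h2

/-- The Fourier basis of `L²(𝕋)`. -/
def freeBasis : HilbertBasis ℤ ℂ L2Torus :=
  HilbertBasis.mkOfOrthogonalEqBot orthonormal_freeWave (by
    rw [Submodule.eq_bot_iff]
    intro f hf
    refine eq_zero_of_inner_freeWave f fun n => ?_
    exact (Submodule.mem_orthogonal _ f).1 hf _ (Submodule.subset_span ⟨n, rfl⟩))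

theorem freeBasis_apply (n : ℤ) : freeBasis n = toL2 (freeWave n) := by
  rw [freeBasis, HilbertBasis.coe_mkOfOrthogonalEqBot]

/-- The Fourier coefficients as a unitary operator. -/
def freeCoeff : L2Torus ≃ₗᵢ[ℂ] Ell2 := freeBasis.repr

theorem freeCoeff_apply (f : L2Torus) (n : ℤ) :
    freeCoeff f n = inner ℂ (toL2 (freeWave n)) f := by
  rw [freeCoeff, HilbertBasis.repr_apply_apply, freeBasis_apply]

theorem hasSum_freeCoeff_symm (u : Ell2) :
    HasSum (transformTerm freeWave u) (freeCoeff.symm u) := by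
  have h := freeBasis.hasSum_repr_symm u
  simp only [freeBasis_apply] at h
  exact h

theorem fourierSeries_eq (u : Ell2) : fourierSeries u = freeCoeff.symm u :=
  (hasSum_freeCoeff_symm u).tsum_eq

/-! ### Multiplication operators -/

/-- The bounded measurable functions. -/
def IsMultiplier (g : ℝ → ℂ) : Prop := Measurable g ∧ ∃ C : ℝ, ∀ θ, ‖g θ‖ ≤ C

theorem IsMultiplier.mul {g k : ℝ → ℂ} (hg : IsMultiplier g) (hk : IsMultiplier k) :
    IsMultiplier fun θ => g θ * k θ := by
  obtain ⟨C, hC⟩ := hg.2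
  obtain ⟨D, hD⟩ := hk.2
  refine ⟨hg.1.mul hk.1, C * D, fun θ => ?_⟩
  rw [norm_mul]
  exact mul_le_mul (hC θ) (hD θ) (norm_nonneg _) ((norm_nonneg _).trans (hC θ))

theorem IsMultiplier.sub {g k : ℝ → ℂ} (hg : IsMultiplier g) (hk : IsMultiplier k) :
    IsMultiplier fun θ => g θ - k θ := by
  obtain ⟨C, hC⟩ := hg.2
  obtain ⟨D, hD⟩ := hk.2
  exact ⟨hg.1.sub hk.1, C + D, fun θ => (norm_sub_le _ _).trans (add_le_add (hC θ) (hD θ))⟩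

theorem IsMultiplier.conj {g : ℝ → ℂ} (hg : IsMultiplier g) :
    IsMultiplier fun θ => (starRingEnd ℂ) (g θ) := by
  obtain ⟨C, hC⟩ := hg.2
  exact ⟨Complex.continuous_conj.measurable.comp hg.1, C, fun θ => by simpa using hC θ⟩

theorem IsMultiplier.memLp_mul {g : ℝ → ℂ} (hg : IsMultiplier g) (f : L2Torus) :
    MemLp (fun θ => g θ * f θ) 2 torusMeasure := by
  obtain ⟨C, hC⟩ := hg.2
  refine MemLp.of_le_mul (c := C) (Lp.memLp f)
    (hg.1.aestronglyMeasurable.mul (Lp.aestronglyMeasurable f)) (Eventually.of_forall fun θ => ?_)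
  rw [norm_mul]
  exact mul_le_mul_of_nonneg_right (hC θ) (norm_nonneg _)

theorem IsMultiplier.memLp {g : ℝ → ℂ} (hg : IsMultiplier g) : MemLp g 2 torusMeasure := by
  obtain ⟨C, hC⟩ := hg.2
  exact memLp_of_bound hg.1 hC

theorem isMultiplier_of_continuous {g : ℝ → ℂ} (hg : Continuous g) {C : ℝ} (hC : ∀ θ, ‖g θ‖ ≤ C) :
    IsMultiplier g := ⟨hg.measurable, C, hC⟩

theorem norm_toL2_mul_le {g : ℝ → ℂ} (hg : IsMultiplier g) {C : ℝ} (hC : ∀ θ, ‖g θ‖ ≤ C)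
    (f : L2Torus) : ‖toL2 fun θ => g θ * f θ‖ ≤ C * ‖f‖ := by
  refine Lp.norm_le_mul_norm_of_ae_le_mul ?_
  filter_upwards [coeFn_toL2 (hg.memLp_mul f)] with θ h
  rw [h, norm_mul]
  exact mul_le_mul_of_nonneg_right (hC θ) (norm_nonneg _)

open Classical in
/-- Multiplication by a bounded measurable function. -/
def mulOp (g : ℝ → ℂ) : L2Torus →L[ℂ] L2Torus :=
  if hg : IsMultiplier g then
    LinearMap.mkContinuous
      { toFun := fun f => toL2 fun θ => g θ * f θ
        map_add' := fun f k => by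
          refine Lp.ext ?_
          filter_upwards [coeFn_toL2 (hg.memLp_mul (f + k)), coeFn_toL2 (hg.memLp_mul f),
            coeFn_toL2 (hg.memLp_mul k), Lp.coeFn_add f k, Lp.coeFn_add
            (toL2 fun θ => g θ * f θ) (toL2 fun θ => g θ * k θ)] with θ h1 h2 h3 h4 h5
          rw [h1, h5, Pi.add_apply, h2, h3, h4, Pi.add_apply, mul_add]
        map_smul' := fun c f => by
          refine Lp.ext ?_
          filter_upwards [coeFn_toL2 (hg.memLp_mul (c • f)), coeFn_toL2 (hg.memLp_mul f),
            Lp.coeFn_smul c f, Lp.coeFn_smul c (toL2 fun θ => g θ * f θ)] with θ h1 h2 h3 h4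
          rw [h1, RingHom.id_apply, h4, Pi.smul_apply, h2, h3, Pi.smul_apply, smul_eq_mul,
            smul_eq_mul]
          ring }
      hg.2.choose fun f => norm_toL2_mul_le hg hg.2.choose_spec f
  else 0

theorem mulOp_eq {g : ℝ → ℂ} (hg : IsMultiplier g) (f : L2Torus) :
    mulOp g f = toL2 fun θ => g θ * f θ := by
  rw [mulOp, dif_pos hg]
  rfl

theorem coeFn_mulOp {g : ℝ → ℂ} (hg : IsMultiplier g) (f : L2Torus) :
    mulOp g f =ᵐ[torusMeasure] fun θ => g θ * f θ := by
  rw [mulOp_eq hg]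
  exact coeFn_toL2 (hg.memLp_mul f)

theorem norm_mulOp_apply_le {g : ℝ → ℂ} (hg : IsMultiplier g) {C : ℝ} (hC : ∀ θ, ‖g θ‖ ≤ C)
    (f : L2Torus) : ‖mulOp g f‖ ≤ C * ‖f‖ := by
  rw [mulOp_eq hg]
  exact norm_toL2_mul_le hg hC f

theorem mulOp_mulOp {g k : ℝ → ℂ} (hg : IsMultiplier g) (hk : IsMultiplier k) (f : L2Torus) :
    mulOp g (mulOp k f) = mulOp (fun θ => g θ * k θ) f := by
  refine Lp.ext ?_
  filter_upwards [coeFn_mulOp hg (mulOp k f), coeFn_mulOp hk f, coeFn_mulOp (hg.mul hk) f]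
    with θ h1 h2 h3
  rw [h1, h2, h3, mul_assoc]

theorem mulOp_comm {g k : ℝ → ℂ} (hg : IsMultiplier g) (hk : IsMultiplier k) (f : L2Torus) :
    mulOp g (mulOp k f) = mulOp k (mulOp g f) := by
  rw [mulOp_mulOp hg hk, mulOp_mulOp hk hg]
  congr 1
  simp only [mul_comm]

theorem inner_mulOp_left {g : ℝ → ℂ} (hg : IsMultiplier g) (f k : L2Torus) :
    inner ℂ (mulOp g f) k = inner ℂ f (mulOp (fun θ => (starRingEnd ℂ) (g θ)) k) := by
  rw [L2Torus.inner_def, L2Torus.inner_def]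
  refine integral_congr_ae ?_
  filter_upwards [coeFn_mulOp hg f, coeFn_mulOp hg.conj k] with θ h1 h2
  rw [h1, h2, map_mul]
  ring

theorem mulOp_toL2 {g k : ℝ → ℂ} (hg : IsMultiplier g) (hk : MemLp k 2 torusMeasure)
    (hgk : MemLp (fun θ => g θ * k θ) 2 torusMeasure) :
    mulOp g (toL2 k) = toL2 fun θ => g θ * k θ := by
  refine Lp.ext ?_
  filter_upwards [coeFn_mulOp hg (toL2 k), coeFn_toL2 hk, coeFn_toL2 hgk] with θ h1 h2 h3
  rw [h1, h2, h3]

/-! ### Exponentials of operators -/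

theorem exp_apply_intertwine {E F : Type*} [NormedAddCommGroup E] [NormedSpace ℂ E]
    [CompleteSpace E] [NormedAddCommGroup F] [NormedSpace ℂ F] [CompleteSpace F] {V : E →L[ℂ] F}
    {A : E →L[ℂ] E} {B : F →L[ℂ] F} (h : ∀ f, B (V f) = V (A f)) (f : E) :
    NormedSpace.exp B (V f) = V (NormedSpace.exp A f) := by
  have hp : ∀ (n : ℕ) (f : E), (B ^ n) (V f) = V ((A ^ n) f) := by
    intro n
    induction n with
    | zero => intro f; rfl
    | succ n ih =>
      intro f
      rw [pow_succ, pow_succ, mul_apply_eq_comp, mul_apply_eq_comp, h, ih]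
  have h1 := (ContinuousLinearMap.apply ℂ F (V f)).hasSum
    (NormedSpace.exp_series_hasSum_exp' (𝕂 := ℂ) B)
  have h2 := (V ∘L ContinuousLinearMap.apply ℂ E f).hasSum
    (NormedSpace.exp_series_hasSum_exp' (𝕂 := ℂ) A)
  refine h1.unique ?_
  have e : (fun n : ℕ => ContinuousLinearMap.apply ℂ F (V f) ((n.factorial⁻¹ : ℂ) • B ^ n))
      = fun n : ℕ => (V ∘L ContinuousLinearMap.apply ℂ E f) ((n.factorial⁻¹ : ℂ) • A ^ n) := by
    funext n
    simp [hp]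
  rw [e]
  exact h2

theorem expI_intertwine {V : L2Torus →L[ℂ] Ell2} {A : L2Torus →L[ℂ] L2Torus}
    {B : Ell2 →L[ℂ] Ell2} (h : ∀ f, B (V f) = V (A f)) (t : ℝ) (f : L2Torus) :
    expI B t (V f) = V (NormedSpace.exp ((Complex.I * (t : ℂ)) • A) f) := by
  rw [expI]
  exact exp_apply_intertwine (fun f => by simp [h]) f

theorem expI_unitary {A : Ell2 →L[ℂ] Ell2} (hA : IsSelfAdjoint A) (t : ℝ) (u : Ell2) :
    ‖expI A t u‖ = ‖u‖ := by
  have hs : (Complex.I * (t : ℂ)) • A ∈ skewAdjoint (Ell2 →L[ℂ] Ell2) := by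
    rw [skewAdjoint.mem_iff, star_smul, hA.star_eq]
    simp [neg_smul]
  let +nondep : NormedAlgebra ℚ (Ell2 →L[ℂ] Ell2) := .restrictScalars ℚ ℂ _
  have hu := NormedSpace.exp_mem_unitary_of_mem_skewAdjoint hs
  exact ContinuousLinearMap.norm_map_of_mem_unitary hu u

theorem expI_add (A : Ell2 →L[ℂ] Ell2) (s t : ℝ) (u : Ell2) :
    expI A s (expI A t u) = expI A (s + t) u := by
  let +nondep : NormedAlgebra ℚ (Ell2 →L[ℂ] Ell2) := .restrictScalars ℚ ℂ _
  rw [expI, expI, expI, ← mul_apply_eq_comp, ← NormedSpace.exp_add_of_commute]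
  · rw [← add_smul, ← mul_add, Complex.ofReal_add]
  · exact ((Commute.refl A).smul_left _).smul_right _

theorem expI_zero (A : Ell2 →L[ℂ] Ell2) (u : Ell2) : expI A 0 u = u := by
  simp [expI]

/-! ### The free evolution on the circle -/

/-- The energy `2(1 - cos θ)`. -/
def energy (θ : ℝ) : ℂ := ((2 * (1 - Real.cos θ) : ℝ) : ℂ)

theorem continuous_energy : Continuous energy := by
  unfold energy; fun_prop

theorem norm_energy_le (θ : ℝ) : ‖energy θ‖ ≤ 4 := by
  rw [energy, Complex.norm_real, Real.norm_eq_abs, abs_le]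
  constructor <;> linarith [Real.neg_one_le_cos θ, Real.cos_le_one θ]

theorem isMultiplier_energy : IsMultiplier energy :=
  isMultiplier_of_continuous continuous_energy norm_energy_le

theorem conj_energy (θ : ℝ) : (starRingEnd ℂ) (energy θ) = energy θ := Complex.conj_ofReal _

/-- The phase `e^{isλ}`. -/
def phase (s θ : ℝ) : ℂ := Complex.exp (Complex.I * s * energy θ)

theorem phase_eq (s θ : ℝ) :
    phase s θ = Complex.exp (((s * (2 * (1 - Real.cos θ)) : ℝ) : ℂ) * Complex.I) := by
  rw [phase, energy]; push_cast; ring_nf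

theorem norm_phase (s θ : ℝ) : ‖phase s θ‖ = 1 := by
  rw [phase_eq]; exact Complex.norm_exp_ofReal_mul_I _

theorem continuous_phase (s : ℝ) : Continuous (phase s) :=
  Complex.continuous_exp.comp (continuous_const.mul continuous_energy)

theorem isMultiplier_phase (s : ℝ) : IsMultiplier (phase s) :=
  isMultiplier_of_continuous (continuous_phase s) fun θ => (norm_phase s θ).le

/-- The free evolution. -/
def evol (s : ℝ) : L2Torus →L[ℂ] L2Torus := mulOp (phase s)

theorem norm_evol (s : ℝ) (f : L2Torus) : ‖evol s f‖ = ‖f‖ := by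
  have h : ∀ᵐ θ ∂torusMeasure, ‖evol s f θ‖ = ‖f θ‖ := by
    filter_upwards [coeFn_mulOp (isMultiplier_phase s) f] with θ h
    rw [evol, h, norm_mul, norm_phase, one_mul]
  exact le_antisymm (Lp.norm_le_norm_of_ae_le (h.mono fun _ h => h.le))
    (Lp.norm_le_norm_of_ae_le (h.mono fun _ h => h.ge))

theorem evol_mulOp {g : ℝ → ℂ} (hg : IsMultiplier g) (s : ℝ) (f : L2Torus) :
    evol s (mulOp g f) = mulOp g (evol s f) :=
  mulOp_comm (isMultiplier_phase s) hg f

theorem isMultiplier_bcf (g : BoundedContinuousFunction ℝ ℂ) : IsMultiplier g :=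
  isMultiplier_of_continuous g.continuous g.norm_coe_le_norm

/-- Multiplication operators of bounded continuous functions, as a ring homomorphism. -/
def bcfHom : BoundedContinuousFunction ℝ ℂ →+* (L2Torus →L[ℂ] L2Torus) where
  toFun g := mulOp g
  map_one' := by
    ext1 f
    refine Lp.ext ?_
    filter_upwards [coeFn_mulOp (isMultiplier_bcf 1) f] with θ h
    rw [h]
    simp
  map_mul' g k := by
    ext1 f
    rw [mul_apply_eq_comp, mulOp_mulOp (isMultiplier_bcf g) (isMultiplier_bcf k)]
    rfl
  map_zero' := by
    ext1 f
    refine Lp.ext ?_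
    filter_upwards [coeFn_mulOp (isMultiplier_bcf 0) f, Lp.coeFn_zero ℂ 2 torusMeasure] with θ h h0
    rw [h]
    refine Eq.trans ?_ h0.symm
    simp
  map_add' g k := by
    ext1 f
    refine Lp.ext ?_
    filter_upwards [coeFn_mulOp (isMultiplier_bcf (g + k)) f, coeFn_mulOp (isMultiplier_bcf g) f,
      coeFn_mulOp (isMultiplier_bcf k) f, Lp.coeFn_add (mulOp g f) (mulOp k f)] with θ h h1 h2 h3
    rw [h]
    refine Eq.trans ?_ h3.symm
    rw [Pi.add_apply, h1, h2]
    simp [add_mul]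

theorem continuous_bcfHom : Continuous bcfHom :=
  AddMonoidHomClass.continuous_of_bound bcfHom 1 fun g => by
    rw [one_mul]
    exact ContinuousLinearMap.opNorm_le_bound _ (norm_nonneg _)
      (norm_mulOp_apply_le (isMultiplier_bcf g) g.norm_coe_le_norm)

/-- Evaluation of a bounded continuous function at a point, as a ring homomorphism. -/
def bcfEval (x : ℝ) : BoundedContinuousFunction ℝ ℂ →+* ℂ where
  toFun g := g x
  map_one' := rfl
  map_mul' _ _ := rfl
  map_zero' := rfl
  map_add' _ _ := rfl

/-- The exponential is taken in the algebra of bounded continuous functions. One continuous ring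
homomorphism carries it to operators, another (evaluation at a point) identifies it with the scalar
exponential. -/
theorem exp_energy (s : ℝ) :
    NormedSpace.exp ((Complex.I * (s : ℂ)) • mulOp energy) = evol s := by
  let g : BoundedContinuousFunction ℝ ℂ :=
    BoundedContinuousFunction.ofNormedAddCommGroup energy continuous_energy 4 norm_energy_le
  have hg : (Complex.I * (s : ℂ)) • mulOp energy = bcfHom ((Complex.I * (s : ℂ)) • g) := by
    ext1 f
    refine Lp.ext ?_
    filter_upwards [coeFn_mulOp isMultiplier_energy f,
      coeFn_mulOp (isMultiplier_bcf ((Complex.I * (s : ℂ)) • g)) f,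
      Lp.coeFn_smul (Complex.I * (s : ℂ)) (mulOp energy f)] with θ h1 h2 h3
    refine h3.trans (Eq.trans ?_ h2.symm)
    rw [Pi.smul_apply, h1]
    change (Complex.I * s) * (energy θ * f θ) = (Complex.I * s) * energy θ * f θ
    ring
  rw [hg, ← NormedSpace.map_exp bcfHom continuous_bcfHom]
  change mulOp _ = mulOp _
  congr 1
  funext θ
  have := NormedSpace.map_exp (bcfEval θ)
    (continuous_eval_const θ : Continuous fun g : BoundedContinuousFunction ℝ ℂ => g θ)
    ((Complex.I * (s : ℂ)) • g)
  rw [← Complex.exp_eq_exp_ℂ] at this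
  exact this

/-! ### Decay of the free evolution on half lines -/

/-- Restriction to a set of angles. -/
def cutoff (J : Set ℝ) : L2Torus →L[ℂ] L2Torus := mulOp (J.indicator 1)

theorem norm_indicator_one_le (J : Set ℝ) (θ : ℝ) : ‖(J.indicator 1 θ : ℂ)‖ ≤ 1 := by
  by_cases h : θ ∈ J <;> simp [h]

theorem isMultiplier_indicator {J : Set ℝ} (hJ : MeasurableSet J) :
    IsMultiplier (J.indicator 1) :=
  ⟨measurable_one.indicator hJ, 1, norm_indicator_one_le J⟩

theorem norm_cutoff_le {J : Set ℝ} (hJ : MeasurableSet J) (f : L2Torus) :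
    ‖cutoff J f‖ ≤ ‖f‖ := by
  have := norm_mulOp_apply_le (isMultiplier_indicator hJ) (norm_indicator_one_le J) f
  rwa [one_mul] at this

/-- The non-stationary phase estimate, by one integration by parts. -/
theorem norm_integral_phase_le {a b c ε : ℝ} (hab : a ≤ b) (hc : 0 < c) (hc1 : c ≤ 1 / 2)
    (hε : |ε| = 1) (hsin : ∀ θ ∈ Set.Icc a b, c ≤ ε * Real.sin θ) {g g' : ℝ → ℝ}
    (hg : ∀ θ, HasDerivAt g (g' θ) θ) (hg' : Continuous g') (ha : g a = 0) (hb : g b = 0) :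
    ∃ K : ℝ, 0 ≤ K ∧ ∀ (n : ℤ) (s : ℝ), 0 ≤ ε * n → 1 ≤ s →
      ‖∫ θ in a..b, (g θ : ℂ) * (wave θ n * phase s θ)‖ ≤ K / (|(n : ℝ)| + s) := by
  have hgc : Continuous g := continuous_iff_continuousAt.2 fun θ => (hg θ).continuousAt
  obtain ⟨A, hA⟩ := isCompact_Icc.exists_bound_of_continuousOn (s := Set.Icc a b) hgc.continuousOn
  obtain ⟨B, hB⟩ := isCompact_Icc.exists_bound_of_continuousOn (s := Set.Icc a b) hg'.continuousOn
  have hA0 : 0 ≤ A := (norm_nonneg _).trans (hA a (Set.left_mem_Icc.2 hab))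
  have hB0 : 0 ≤ B := (norm_nonneg _).trans (hB a (Set.left_mem_Icc.2 hab))
  -- One integration by parts leaves the derivative of `g / d`, with `d` the derivative of the
  -- phase. It is at most `(B + A / c) / |d|`, where `|d| ≥ 2c(|n| + s)`, on an interval of length
  -- `b - a`.
  refine ⟨(B + A / c) / (2 * c) * (b - a), by have := sub_nonneg.2 hab; positivity,
    fun n s hn hs => ?_⟩
  set d : ℝ → ℝ := fun θ => n + 2 * s * Real.sin θ with hd
  have hns : 0 < |(n : ℝ)| + s := by positivity
  have hn' : |(n : ℝ)| = ε * n := by rw [← abs_of_nonneg hn, abs_mul, hε, one_mul]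
  -- Since `n` and `sin θ` do not have opposite signs, nothing cancels: `|d| ≥ |n| + 2cs`, and `c ≤
  -- 1/2` gives the stated form.
  have hdlow : ∀ θ ∈ Set.Icc a b, 2 * c * (|(n : ℝ)| + s) ≤ |d θ| := fun θ hθ => by
    have h1 : |d θ| = |ε * d θ| := by rw [abs_mul, hε, one_mul]
    rw [h1]
    refine le_trans ?_ (le_abs_self _)
    have h2 := hsin θ hθ
    have h3 : ε * d θ = ε * n + 2 * s * (ε * Real.sin θ) := by simp only [hd]; ring
    rw [h3, ← hn']
    nlinarith [abs_nonneg (n : ℝ)]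
  have hd0 : ∀ θ ∈ Set.Icc a b, d θ ≠ 0 := fun θ hθ h0 => by
    have := hdlow θ hθ
    rw [h0, abs_zero] at this
    have : 0 < 2 * c * (|(n : ℝ)| + s) := by positivity
    linarith
  have hdd : ∀ θ, HasDerivAt d (2 * s * Real.cos θ) θ := fun θ =>
    ((Real.hasDerivAt_sin θ).const_mul (2 * s)).const_add _
  have hdc : Continuous d := continuous_iff_continuousAt.2 fun θ => (hdd θ).continuousAt
  have huIcc : Set.uIcc a b = Set.Icc a b := Set.uIcc_of_le hab
  set u : ℝ → ℝ := fun θ => g θ / d θ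
  set u' : ℝ → ℝ := fun θ => (g' θ * d θ - g θ * (2 * s * Real.cos θ)) / d θ ^ 2
  have hu : ∀ θ ∈ Set.uIcc a b, HasDerivAt (fun θ => (u θ : ℂ)) (u' θ : ℂ) θ := fun θ hθ =>
    ((hg θ).div (hdd θ) (hd0 θ (huIcc ▸ hθ))).ofReal_comp
  have hv : ∀ θ ∈ Set.uIcc a b, HasDerivAt (fun θ => wave θ n * phase s θ)
      (Complex.I * d θ * (wave θ n * phase s θ)) θ := fun θ _ => by
    have e : (fun θ => wave θ n * phase s θ) = fun θ : ℝ =>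
        Complex.exp (((n * θ + s * (2 * (1 - Real.cos θ)) : ℝ) : ℂ) * Complex.I) := by
      funext θ
      rw [wave_eq, phase_eq, ← Complex.exp_add]
      push_cast
      ring_nf
    have h1 : HasDerivAt (fun θ : ℝ => n * θ + s * (2 * (1 - Real.cos θ))) (d θ) θ := by
      have h2 := ((hasDerivAt_id θ).const_mul (n : ℝ)).add
        ((((Real.hasDerivAt_cos θ).const_sub 1).const_mul 2).const_mul s)
      have h3 : d θ = n * 1 + s * (2 * -(-Real.sin θ)) := by simp only [hd]; ring
      rw [h3]
      exact h2
    have h3 := (h1.ofReal_comp.mul_const Complex.I).cexp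
    rw [e]
    convert h3 using 1
    have := congrFun e θ
    rw [this]
    ring
  have hu'c : ContinuousOn (fun θ => (u' θ : ℂ)) (Set.uIcc a b) := by
    refine Complex.continuous_ofReal.comp_continuousOn ?_
    refine ContinuousOn.div (by fun_prop) (by fun_prop) fun θ hθ => ?_
    exact pow_ne_zero 2 (hd0 θ (huIcc ▸ hθ))
  have hvc : Continuous fun θ => Complex.I * d θ * (wave θ n * phase s θ) :=
    (continuous_const.mul (Complex.continuous_ofReal.comp hdc)).mul
      ((continuous_wave n).mul (continuous_phase s))
  have ibp := intervalIntegral.integral_mul_deriv_eq_deriv_mul hu hv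
    hu'c.intervalIntegrable (hvc.intervalIntegrable _ _)
  have ua : u a = 0 := by simp [u, ha]
  have ub : u b = 0 := by simp [u, hb]
  rw [ua, ub, Complex.ofReal_zero, zero_mul, zero_mul, sub_zero, zero_sub] at ibp
  have hlhs : ∫ θ in a..b, (u θ : ℂ) * (Complex.I * d θ * (wave θ n * phase s θ))
      = Complex.I * ∫ θ in a..b, (g θ : ℂ) * (wave θ n * phase s θ) := by
    rw [← intervalIntegral.integral_const_mul]
    refine intervalIntegral.integral_congr fun θ hθ => ?_
    have h0 : (d θ : ℂ) ≠ 0 := by exact_mod_cast hd0 θ (huIcc ▸ hθ)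
    simp only [u]
    push_cast
    field_simp
  have hnorm : ‖∫ θ in a..b, (g θ : ℂ) * (wave θ n * phase s θ)‖
      = ‖∫ θ in a..b, (u' θ : ℂ) * (wave θ n * phase s θ)‖ := by
    have := congrArg norm (hlhs.symm.trans ibp)
    rwa [norm_mul, Complex.norm_I, one_mul, norm_neg] at this
  rw [hnorm]
  have hbound : ∀ θ ∈ Set.uIoc a b, ‖(u' θ : ℂ) * (wave θ n * phase s θ)‖
      ≤ (B + A / c) / (2 * c) / (|(n : ℝ)| + s) := fun θ hθ => by
    have hθ' : θ ∈ Set.Icc a b := Set.Ioc_subset_Icc_self (Set.uIoc_of_le hab ▸ hθ)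
    rw [norm_mul, norm_mul, norm_wave, norm_phase, mul_one, mul_one, Complex.norm_real,
      Real.norm_eq_abs]
    have h1 := hdlow θ hθ'
    have hD : 0 < 2 * c * (|(n : ℝ)| + s) := by positivity
    have hDpos : 0 < |d θ| := hD.trans_le h1
    have h2 : |g' θ * d θ - g θ * (2 * s * Real.cos θ)| ≤ B * |d θ| + A * (2 * s) := by
      refine (abs_sub _ _).trans ?_
      rw [abs_mul, abs_mul, abs_mul]
      have := Real.abs_cos_le_one θ
      have e2 : |2 * s| = 2 * s := abs_of_nonneg (by linarith)
      rw [e2]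
      refine add_le_add (mul_le_mul_of_nonneg_right (hB θ hθ') (abs_nonneg _)) ?_
      exact mul_le_mul (hA θ hθ') (mul_le_of_le_one_right (by linarith) this) (by positivity) hA0
    -- The derivative of `d` is of size `2s`, which `|d|` itself controls, so the bound loses only
    -- one power of `d`.
    have h3 : 2 * s ≤ |d θ| / c := by
      rw [le_div_iff₀ hc]
      nlinarith [abs_nonneg (n : ℝ)]
    rw [abs_div, abs_pow]
    calc |g' θ * d θ - g θ * (2 * s * Real.cos θ)| / |d θ| ^ 2
        ≤ (B * |d θ| + A * (|d θ| / c)) / |d θ| ^ 2 := by gcongr; exact h2.trans (by gcongr)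
      _ = (B + A / c) / |d θ| := by field_simp
      _ ≤ (B + A / c) / (2 * c * (|(n : ℝ)| + s)) := by gcongr
      _ = _ := by rw [div_div]
  have := intervalIntegral.norm_integral_le_of_norm_le_const hbound
  rw [abs_of_nonneg (sub_nonneg.2 hab)] at this
  refine this.trans_eq ?_
  ring

theorem exists_Ioo_of_isCompact {K : Set ℝ} (hK : IsCompact K) {α β : ℝ} (hαβ : α < β)
    (h : K ⊆ Set.Ioo α β) : ∃ a b, α < a ∧ a ≤ b ∧ b < β ∧ K ⊆ Set.Ioo a b := by
  rcases K.eq_empty_or_nonempty with rfl | hne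
  · exact ⟨(α + β) / 2, (α + β) / 2, by linarith, le_rfl, by linarith, Set.empty_subset _⟩
  · have h1 := h (hK.sInf_mem hne)
    have h2 := h (hK.sSup_mem hne)
    have h3 : sInf K ≤ sSup K := csInf_le_csSup hne hK.bddBelow hK.bddAbove
    refine ⟨(α + sInf K) / 2, (sSup K + β) / 2, by linarith [h1.1], by linarith [h1.1, h2.2],
      by linarith [h2.2], fun x hx => ⟨?_, ?_⟩⟩
    · linarith [h1.1, csInf_le hK.bddBelow hx]
    · linarith [h2.2, le_csSup hK.bddAbove hx]

theorem inner_freeWave_evol_toL2 {g : ℝ → ℂ} (hg : MemLp g 2 torusMeasure) (n : ℤ) (s : ℝ) :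
    inner ℂ (toL2 (freeWave n)) (evol s (toL2 g))
      = normConst * ∫ θ in (-Real.pi)..Real.pi, g θ * (wave θ n * phase s θ) := by
  rw [inner_toL2 (memLp_freeWave n), ← integral_torus, ← integral_const_mul]
  refine integral_congr_ae ?_
  filter_upwards [coeFn_mulOp (isMultiplier_phase s) (toL2 g), coeFn_toL2 hg] with θ h1 h2
  rw [evol, h1, h2, conj_freeWave]
  ring

theorem summable_int_sq_div (A : ℝ) : Summable fun n : ℤ => (A / (|(n : ℝ)| + 1)) ^ 2 := by
  have h : Summable fun n : ℕ => (A / ((n : ℝ) + 1)) ^ 2 := by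
    have h1 := (summable_nat_add_iff 1).2 (Real.summable_one_div_nat_pow.2 one_lt_two)
    refine (h1.mul_left (A ^ 2)).congr fun n => ?_
    rw [div_pow, mul_one_div, Nat.cast_add_one]
  refine Summable.of_nat_of_neg ?_ ?_
  · simpa using h
  · simpa using h

theorem ae_mem_torus : ∀ᵐ θ ∂torusMeasure, θ ∈ Set.Ioc (-Real.pi) Real.pi :=
  ae_restrict_mem measurableSet_Ioc

theorem conj_indicator_one (J : Set ℝ) (θ : ℝ) :
    (starRingEnd ℂ) (J.indicator 1 θ) = J.indicator 1 θ := by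
  by_cases h : θ ∈ J <;> simp [h]

theorem inner_cutoff_left {J : Set ℝ} (hJ : MeasurableSet J) (f g : L2Torus) :
    inner ℂ (cutoff J f) g = inner ℂ f (cutoff J g) := by
  rw [cutoff, inner_mulOp_left (isMultiplier_indicator hJ)]
  simp only [conj_indicator_one]

theorem coeFn_cutoff {J : Set ℝ} (hJ : MeasurableSet J) (f : L2Torus) :
    cutoff J f =ᵐ[torusMeasure] J.indicator f := by
  filter_upwards [coeFn_mulOp (isMultiplier_indicator hJ) f] with θ h
  rw [cutoff, h]
  by_cases h : θ ∈ J <;> simp [h]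

theorem cutoff_cutoff {J : Set ℝ} (hJ : MeasurableSet J) (f : L2Torus) :
    cutoff J (cutoff J f) = cutoff J f := by
  refine Lp.ext ?_
  filter_upwards [coeFn_cutoff hJ (cutoff J f), coeFn_cutoff hJ f] with θ h1 h2
  rw [h1, h2]
  by_cases h : θ ∈ J
  · rw [Set.indicator_of_mem h, h2]
  · rw [Set.indicator_of_notMem h, Set.indicator_of_notMem h]

theorem evol_cutoff {J : Set ℝ} (hJ : MeasurableSet J) (s : ℝ) (f : L2Torus) :
    evol s (cutoff J f) = cutoff J (evol s f) :=
  evol_mulOp (isMultiplier_indicator hJ) s f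

/-! ### Asymptotics of the free evolution -/

/-- Non-stationary phase bounds the coefficients on the half line by `K / (|n| + s)`. They vanish
one by one as `s → ∞` and are dominated by the square summable `K / (|n| + 1)`. The compact support
keeps `sin θ` away from zero. -/
theorem tendsto_coordProj_evol_smooth {α β ε : ℝ} (hαβ : α < β) (hα : -Real.pi ≤ α)
    (hβ : β ≤ Real.pi) (hε : |ε| = 1) (hsin : ∀ θ ∈ Set.Ioo α β, 0 < ε * Real.sin θ) {g : ℝ → ℝ}
    (hg : ContDiff ℝ (⊤ : ℕ∞) g) (hgc : HasCompactSupport g) (hgs : tsupport g ⊆ Set.Ioo α β) :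
    MemLp (fun θ => (g θ : ℂ)) 2 torusMeasure ∧
    Tendsto (fun s => coordProj {n : ℤ | 0 ≤ ε * n} (freeCoeff (evol s (toL2 fun θ => (g θ : ℂ)))))
      atTop (𝓝 0) := by
  have hg1 : ∀ θ, HasDerivAt g (deriv g θ) θ := fun θ =>
    (hg.differentiable (by simp) θ).hasDerivAt
  have hg' : Continuous (deriv g) := hg.continuous_deriv (by simp)
  obtain ⟨C, hC⟩ := hgc.exists_bound_of_continuous hg.continuous
  have hmem : MemLp (fun θ => (g θ : ℂ)) 2 torusMeasure :=
    memLp_of_bound (Complex.continuous_ofReal.comp hg.continuous).measurable fun θ => by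
      rw [Complex.norm_real]; exact hC θ
  refine ⟨hmem, ?_⟩
  obtain ⟨a, b, haα, hab, hbβ, hK⟩ := exists_Ioo_of_isCompact hgc.isCompact hαβ hgs
  obtain ⟨θ₀, hθ₀, hmin⟩ := isCompact_Icc.exists_isMinOn (Set.nonempty_Icc.2 hab)
    (continuous_const.mul Real.continuous_sin : Continuous fun θ => ε * Real.sin θ).continuousOn
  have hc0 : 0 < ε * Real.sin θ₀ := hsin θ₀ ⟨haα.trans_le hθ₀.1, hθ₀.2.trans_lt hbβ⟩
  have hz : ∀ θ, θ ∉ Set.Ioo a b → g θ = 0 := fun θ hθ =>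
    image_eq_zero_of_notMem_tsupport fun h => hθ (hK h)
  obtain ⟨K, hK0, hKb⟩ := norm_integral_phase_le (c := min (ε * Real.sin θ₀) (1 / 2)) hab
    (lt_min hc0 (by norm_num)) (min_le_right _ _) hε
    (fun θ hθ => (min_le_left _ _).trans (hmin hθ)) hg1 hg' (hz a (by simp)) (hz b (by simp))
  have hint : ∀ (n : ℤ) (s : ℝ), 0 ≤ ε * n → 1 ≤ s →
      ‖freeCoeff (evol s (toL2 fun θ => (g θ : ℂ))) n‖ ≤ K / (|(n : ℝ)| + s) := fun n s hn hs => by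
    rw [freeCoeff_apply, inner_freeWave_evol_toL2 hmem, norm_mul]
    refine (mul_le_of_le_one_left (norm_nonneg _) norm_normConst_le).trans ?_
    have hsupp : ∀ x y, x ≤ a → b ≤ y →
        Function.support (fun θ => (g θ : ℂ) * (wave θ n * phase s θ)) ⊆ Set.Ioc x y := by
      intro x y hx hy θ hθ
      by_contra hcon
      refine hθ ?_
      simp only
      rw [hz θ fun h => hcon ⟨hx.trans_lt h.1, h.2.le.trans hy⟩]
      simp
    rw [intervalIntegral.integral_eq_integral_of_support_subset
      (hsupp _ _ (hα.trans haα.le) (hbβ.le.trans hβ)),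
      ← intervalIntegral.integral_eq_integral_of_support_subset (hsupp a b le_rfl le_rfl)]
    exact hKb n s hn hs
  have hcoord : ∀ (n : ℤ) (s : ℝ), 1 ≤ s →
      ‖coordProj {n : ℤ | 0 ≤ ε * n} (freeCoeff (evol s (toL2 fun θ => (g θ : ℂ)))) n‖
        ≤ K / (|(n : ℝ)| + s) := fun n s hs => by
    rw [coordProj_apply]
    by_cases h : n ∈ {n : ℤ | 0 ≤ ε * n}
    · rw [Set.indicator_of_mem h]; exact hint n s h hs
    · rw [Set.indicator_of_notMem h, norm_zero]; positivity
  refine Ell2.tendsto_zero_of_dominated (summable_int_sq_div K) ?_ fun n => ?_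
  · filter_upwards [eventually_ge_atTop 1] with s hs n
    exact (hcoord n s hs).trans (by gcongr)
  · refine squeeze_zero_norm' ?_ (a := fun s => K / (|(n : ℝ)| + s)) ?_
    · filter_upwards [eventually_ge_atTop 1] with s hs
      exact hcoord n s hs
    · exact (tendsto_atTop_add_const_left _ _ tendsto_id).const_div_atTop K

/-- Waves that move to the right leave the right half line in the past, and conversely. -/
theorem tendsto_coordProj_evol {α β ε : ℝ} (hαβ : α < β) (hα : -Real.pi ≤ α)
    (hβ : β ≤ Real.pi) (hε : |ε| = 1) (hsin : ∀ θ ∈ Set.Ioo α β, 0 < ε * Real.sin θ)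
    (f : L2Torus) :
    Tendsto (fun s => coordProj {n : ℤ | 0 ≤ ε * n}
      (freeCoeff (evol s (cutoff (Set.Ioo α β) f)))) atTop (𝓝 0) := by
  set J := Set.Ioo α β with hJ
  have mJ : MeasurableSet J := measurableSet_Ioo
  let Y : ℝ → L2Torus →L[ℂ] Ell2 := fun s => coordProj {n : ℤ | 0 ≤ ε * n} ∘L
    (freeCoeff : L2Torus →L[ℂ] Ell2) ∘L evol s ∘L cutoff J
  -- The total set consists of functions carried by the complement of the arc, which the cutoff
  -- kills, and of smooth functions with compact support in the arc.
  refine tendsto_zero_of_total (Y := Y) (C := 1) (fun s f => ?_)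
    (D := Set.range (cutoff Jᶜ) ∪ {k | ∃ g : ℝ → ℝ, ContDiff ℝ (⊤ : ℕ∞) g ∧ HasCompactSupport g ∧
      tsupport g ⊆ J ∧ k = toL2 fun θ => (g θ : ℂ)}) ?_ ?_ f
  · rw [one_mul]
    refine (norm_coordProj_le _ _).trans ?_
    change ‖freeCoeff (evol s (cutoff J f))‖ ≤ _
    rw [LinearIsometryEquiv.norm_map, norm_evol]
    exact norm_cutoff_le mJ f
  · rintro k (⟨k, rfl⟩ | ⟨g, h1, h2, h3, rfl⟩)
    · have : cutoff J (cutoff Jᶜ k) = 0 := by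
        refine Lp.ext ?_
        filter_upwards [coeFn_cutoff mJ (cutoff Jᶜ k), coeFn_cutoff mJ.compl k,
          Lp.coeFn_zero ℂ 2 torusMeasure] with θ e1 e2 e3
        rw [e1, e3]
        by_cases h : θ ∈ J
        · rw [Set.indicator_of_mem h, e2]; simp [h]
        · simp [h]
      have hY : ∀ s, Y s (cutoff Jᶜ k) = 0 := fun s => by
        change coordProj _ (freeCoeff (evol s (cutoff J (cutoff Jᶜ k)))) = 0
        rw [this]
        simp
      simp only [hY]
      exact tendsto_const_nhds
    · obtain ⟨hm, ht⟩ := tendsto_coordProj_evol_smooth hαβ hα hβ hε hsin h1 h2 h3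
      have : cutoff J (toL2 fun θ => (g θ : ℂ)) = toL2 fun θ => (g θ : ℂ) := by
        refine Lp.ext ?_
        filter_upwards [coeFn_cutoff mJ (toL2 fun θ => (g θ : ℂ)), coeFn_toL2 hm] with θ e1 e2
        rw [e1]
        by_cases h : θ ∈ J
        · simp [h]
        · rw [Set.indicator_of_notMem h, e2, image_eq_zero_of_notMem_tsupport fun hh => h (h3 hh)]
          simp
      refine ht.congr fun s => ?_
      change _ = coordProj _ (freeCoeff (evol s (cutoff J (toL2 fun θ => (g θ : ℂ)))))
      rw [this]
  · intro f hf
    have h1 : cutoff Jᶜ f = 0 := by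
      rw [← inner_self_eq_zero (𝕜 := ℂ), ← inner_cutoff_left mJ.compl, cutoff_cutoff mJ.compl]
      exact hf _ (Or.inl ⟨f, rfl⟩)
    have h2 : ∀ᵐ θ ∂torusMeasure, θ ∈ J → f θ = 0 := by
      have hI : Integrable f torusMeasure := (Lp.memLp f).integrable (by norm_num)
      refine IsOpen.ae_eq_zero_of_integral_contDiff_smul_eq_zero isOpen_Ioo
        (hI.locallyIntegrable.locallyIntegrableOn _) fun g hg hgc hgs => ?_
      obtain ⟨hm, -⟩ := tendsto_coordProj_evol_smooth hαβ hα hβ hε hsin hg hgc hgs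
      have := hf _ (Or.inr ⟨g, hg, hgc, hgs, rfl⟩)
      rw [inner_toL2 hm] at this
      simpa using this
    refine Lp.ext ?_
    filter_upwards [h2, coeFn_cutoff mJ.compl f, Lp.coeFn_zero ℂ 2 torusMeasure] with θ e1 e2 e3
    rw [e3]
    by_cases h : θ ∈ J
    · exact e1 h
    · rw [h1, e3, Set.indicator_of_mem (Set.mem_compl h)] at e2
      exact e2.symm

/-- The angles of the waves that move to the right, and to the left. -/
abbrev rightArc : Set ℝ := Set.Ioo 0 Real.pi

abbrev leftArc : Set ℝ := Set.Ioo (-Real.pi) 0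

theorem tendsto_coordProj_right (f : L2Torus) :
    Tendsto (fun s => coordProj {n : ℤ | 0 ≤ n} (freeCoeff (evol s (cutoff rightArc f))))
      atTop (𝓝 0) := by
  have := tendsto_coordProj_evol (ε := 1) Real.pi_pos (by linarith [Real.pi_pos]) le_rfl (by simp)
    (fun θ hθ => by rw [one_mul]; exact Real.sin_pos_of_mem_Ioo hθ) f
  simpa using this

theorem tendsto_coordProj_left (f : L2Torus) :
    Tendsto (fun s => coordProj {n : ℤ | n ≤ 0} (freeCoeff (evol s (cutoff leftArc f))))
      atTop (𝓝 0) := by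
  have := tendsto_coordProj_evol (ε := -1) (neg_lt_zero.2 Real.pi_pos) le_rfl Real.pi_pos.le
    (by simp) (fun θ hθ => by
      have := Real.sin_neg_of_neg_of_neg_pi_lt hθ.2 hθ.1
      linarith) f
  simpa using this

theorem ae_sin_ne_zero : ∀ᵐ θ ∂torusMeasure, Real.sin θ ≠ 0 := by
  have h : ({0, Real.pi} : Set ℝ).Countable := Set.to_countable _
  have h0 : ∀ᵐ θ ∂torusMeasure, θ ∉ ({0, Real.pi} : Set ℝ) :=
    ae_restrict_of_ae (h.ae_notMem volume)
  filter_upwards [h0, ae_mem_torus] with θ h1 h2 h3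
  have hne0 : θ ≠ 0 := fun h => h1 (by simp [h])
  have hneπ : θ ≠ Real.pi := fun h => h1 (by simp [h])
  exact hne0 ((Real.sin_eq_zero_iff_of_lt_of_lt h2.1 (lt_of_le_of_ne h2.2 hneπ)).1 h3)

theorem mem_arcs {θ : ℝ} (h : θ ∈ Set.Ioc (-Real.pi) Real.pi) (hs : Real.sin θ ≠ 0) :
    θ ∈ rightArc ∨ θ ∈ leftArc := by
  rcases lt_trichotomy θ 0 with h0 | h0 | h0
  · exact Or.inr ⟨h.1, h0⟩
  · exact absurd (by rw [h0, Real.sin_zero]) hs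
  · exact Or.inl ⟨h0, lt_of_le_of_ne h.2 fun e => hs (by rw [e, Real.sin_pi])⟩

theorem cutoff_right_add_left (f : L2Torus) : cutoff rightArc f + cutoff leftArc f = f := by
  refine Lp.ext ?_
  filter_upwards [coeFn_cutoff (J := rightArc) measurableSet_Ioo f,
    coeFn_cutoff (J := leftArc) measurableSet_Ioo f,
    Lp.coeFn_add (cutoff rightArc f) (cutoff leftArc f), ae_sin_ne_zero, ae_mem_torus]
    with θ h1 h2 h3 h4 h5
  rw [h3, Pi.add_apply, h1, h2]
  rcases mem_arcs h5 h4 with h | h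
  · have : θ ∉ leftArc := fun h' => by linarith [h.1, h'.2]
    rw [Set.indicator_of_mem h, Set.indicator_of_notMem this, add_zero]
  · have : θ ∉ rightArc := fun h' => by linarith [h.2, h'.1]
    rw [Set.indicator_of_mem h, Set.indicator_of_notMem this, zero_add]

/-- The site `0` belongs to both half lines, so the contributions of both arcs vanish there. -/
theorem tendsto_freeCoeff_evol (f : L2Torus) :
    Tendsto (fun s => freeCoeff (evol s f) 0) atTop (𝓝 0) := by
  have hc : Continuous fun u : Ell2 => inner ℂ (unitVec 0) u := by fun_prop
  have h1 := (hc.tendsto 0).comp (tendsto_coordProj_right f)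
  have h2 := (hc.tendsto 0).comp (tendsto_coordProj_left f)
  simp only [Function.comp_def, inner_unitVec, coordProj_apply] at h1 h2
  have h := h1.add h2
  refine (h.congr fun s => ?_).trans_eq (by simp) 
  rw [Set.indicator_of_mem (by simp), Set.indicator_of_mem (by simp)]
  conv_rhs => rw [← cutoff_right_add_left f, map_add, map_add]
  rfl

/-- The free evolution tends weakly to zero. -/
theorem tendsto_inner_evol {g : ℝ → ℂ} (hg : IsMultiplier g) (f : L2Torus) :
    Tendsto (fun s => inner ℂ (toL2 g) (evol s f)) atTop (𝓝 0) := by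
  -- Multiplication by `conj g` commutes with the evolution, so the pairing with `g` is a multiple
  -- of a coefficient at the site `0`.
  have h := (tendsto_freeCoeff_evol (mulOp (fun θ => (starRingEnd ℂ) (g θ)) f)).const_mul
    normConst⁻¹
  rw [mul_zero] at h
  refine h.congr fun s => ?_
  rw [freeCoeff_apply, evol_mulOp hg.conj, inner_toL2 (memLp_freeWave 0), inner_toL2 hg.memLp,
    ← integral_const_mul]
  refine integral_congr_ae ?_
  filter_upwards [coeFn_mulOp hg.conj (evol s f)] with θ h1
  rw [h1, conj_freeWave, wave_zero]
  have := normConst_ne_zero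
  field_simp

/-! ### Reflections -/

theorem memlp_flip (u : Ell2) : Memℓp (fun n : ℤ => u (-n)) 2 := by
  apply memℓp_gen
  have h := (memℓp_gen_iff (p := 2) (by norm_num)).1 (lp.memℓp u)
  exact (Equiv.neg ℤ).summable_iff.2 h

/-- The reflection `u ↦ (n ↦ u (-n))`. -/
def flipSeq : Ell2 →ₗᵢ[ℂ] Ell2 where
  toFun u := ⟨fun n => u (-n), memlp_flip u⟩
  map_add' _ _ := rfl
  map_smul' _ _ := rfl
  norm_map' u := by
    have h2 : (0 : ℝ) < (2 : ℝ≥0∞).toReal := by norm_num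
    rw [lp.norm_eq_tsum_rpow h2, lp.norm_eq_tsum_rpow h2]
    congr 1
    exact (Equiv.neg ℤ).tsum_eq fun n : ℤ => ‖u n‖ ^ (2 : ℝ≥0∞).toReal

theorem flipSeq_apply (u : Ell2) (n : ℤ) : flipSeq u n = u (-n) := rfl

theorem measurePreserving_neg_torus :
    MeasurePreserving (fun θ : ℝ => -θ) torusMeasure torusMeasure := by
  have h := (Measure.measurePreserving_neg (volume : Measure ℝ)).restrict_preimage
    (measurableSet_Ioc (a := -Real.pi) (b := Real.pi))
  have e : (volume : Measure ℝ).restrict ((fun θ : ℝ => -θ) ⁻¹' Set.Ioc (-Real.pi) Real.pi)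
      = torusMeasure := by
    refine Measure.restrict_congr_set ?_
    have : (fun θ : ℝ => -θ) ⁻¹' Set.Ioc (-Real.pi) Real.pi = Set.Ico (-Real.pi) Real.pi := by
      ext θ
      simp only [Set.mem_preimage, Set.mem_Ioc, Set.mem_Ico]
      constructor <;> rintro ⟨h1, h2⟩ <;> constructor <;> linarith
    rw [this]
    exact Ico_ae_eq_Ioc
  rwa [e] at h

/-- The reflection `f ↦ (θ ↦ f (-θ))`. -/
def flipL2 : L2Torus →ₗᵢ[ℂ] L2Torus :=
  Lp.compMeasurePreservingₗᵢ ℂ (fun θ : ℝ => -θ) measurePreserving_neg_torus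

theorem coeFn_flipL2 (f : L2Torus) : flipL2 f =ᵐ[torusMeasure] fun θ => f (-θ) :=
  Lp.coeFn_compMeasurePreserving f measurePreserving_neg_torus

theorem ae_comp_neg {p : ℝ → Prop} (h : ∀ᵐ θ ∂torusMeasure, p θ) :
    ∀ᵐ θ ∂torusMeasure, p (-θ) :=
  measurePreserving_neg_torus.quasiMeasurePreserving.ae h

theorem integral_comp_neg_torus (f : ℝ → ℂ) :
    ∫ θ, f (-θ) ∂torusMeasure = ∫ θ, f θ ∂torusMeasure :=
  measurePreserving_neg_torus.integral_comp (MeasurableEquiv.neg ℝ).measurableEmbedding f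

theorem inner_flipL2 {g : ℝ → ℂ} (hg : MemLp g 2 torusMeasure)
    (hg' : MemLp (fun θ => g (-θ)) 2 torusMeasure) (f : L2Torus) :
    inner ℂ (toL2 g) (flipL2 f) = inner ℂ (toL2 fun θ => g (-θ)) f := by
  rw [inner_toL2 hg, inner_toL2 hg', ← integral_comp_neg_torus]
  refine integral_congr_ae ?_
  filter_upwards [ae_comp_neg (coeFn_flipL2 f)] with θ h
  rw [h, neg_neg]

theorem flipL2_mulOp {g : ℝ → ℂ} (hg : IsMultiplier g) (he : ∀ θ, g (-θ) = g θ) (f : L2Torus) :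
    flipL2 (mulOp g f) = mulOp g (flipL2 f) := by
  refine Lp.ext ?_
  filter_upwards [coeFn_flipL2 (mulOp g f), ae_comp_neg (coeFn_mulOp hg f),
    coeFn_mulOp hg (flipL2 f), coeFn_flipL2 f] with θ h1 h2 h3 h4
  rw [h1, h2, h3, h4, he]

theorem flipL2_evol (s : ℝ) (f : L2Torus) : flipL2 (evol s f) = evol s (flipL2 f) :=
  flipL2_mulOp (isMultiplier_phase s) (fun θ => by simp [phase, energy]) f

theorem freeCoeff_flipL2 (f : L2Torus) (n : ℤ) : freeCoeff (flipL2 f) n = freeCoeff f (-n) := by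
  have e : (fun θ => freeWave n (-θ)) = freeWave (-n) := by
    funext θ
    rw [freeWave_eq, freeWave_eq, neg_neg, ← wave_neg, neg_neg]
  rw [freeCoeff_apply, freeCoeff_apply, inner_flipL2 (memLp_freeWave n)
    (e ▸ memLp_freeWave (-n)), e]

/-! ### The transform away from the thresholds -/

/-- The angles at distance from the thresholds. -/
def bulk (δ : ℝ) : Set ℝ := {θ | δ ≤ |Real.sin θ|}

theorem measurableSet_bulk (δ : ℝ) : MeasurableSet (bulk δ) :=
  (isClosed_le continuous_const (continuous_abs.comp Real.continuous_sin)).measurableSet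

theorem flipL2_cutoff_bulk (δ : ℝ) (f : L2Torus) :
    flipL2 (cutoff (bulk δ) f) = cutoff (bulk δ) (flipL2 f) :=
  flipL2_mulOp (isMultiplier_indicator (measurableSet_bulk δ)) (fun θ => by
    by_cases h : δ ≤ |Real.sin θ| <;> simp [Set.indicator, bulk, h]) f

theorem exists_besselOp {v : ℤ → L2Torus} {ρ : ℤ → ℝ} (hρ : Summable fun n => ρ n ^ 2)
    (hv : ∀ n, ‖v n‖ ≤ ρ n) : ∃ V : L2Torus →L[ℂ] Ell2, ∀ f n, V f n = inner ℂ (v n) f := by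
  refine ⟨besselOp v (Real.sqrt (∑' n, ρ n ^ 2)) (Real.sqrt_nonneg _) fun f s => ?_,
    fun f n => besselOp_apply _ _ _ _ f n⟩
  rw [mul_pow, Real.sq_sqrt (tsum_nonneg fun _ => sq_nonneg _)]
  refine le_trans (Finset.sum_le_sum (g := fun n => ρ n ^ 2 * ‖f‖ ^ 2) fun n _ => ?_) ?_
  · rw [← mul_pow]
    exact pow_le_pow_left₀ (norm_nonneg _) ((norm_inner_le_norm _ _).trans
      (mul_le_mul_of_nonneg_right (hv n) (norm_nonneg _))) 2
  · rw [← Finset.sum_mul]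
    exact mul_le_mul_of_nonneg_right (hρ.sum_le_tsum s fun _ _ => sq_nonneg _) (sq_nonneg _)

theorem isMultiplier_planeWave {q : ℤ → ℝ} (hq : MemEllOneOne q) (n : ℤ) :
    IsMultiplier (planeWave q n) := by
  obtain ⟨C, hC⟩ := exists_planeWave_bound hq n
  exact ⟨measurable_planeWave hq n, C, hC q fun _ => le_rfl⟩

theorem isMultiplier_freeWave (n : ℤ) : IsMultiplier (freeWave n) :=
  isMultiplier_of_continuous (continuous_freeWave n) (norm_freeWave_le n)

theorem isMultiplier_ampTransmitted {q : ℤ → ℝ} (hq : MemEllOneOne q) :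
    IsMultiplier (ampTransmitted q) :=
  ⟨measurable_ampTransmitted hq, 1, fun θ => by
    unfold ampTransmitted
    split_ifs
    · exact norm_transmission_le hq θ
    · simp⟩

theorem isMultiplier_ampReflected {q : ℤ → ℝ} (hq : MemEllOneOne q) :
    IsMultiplier (ampReflected q) :=
  ⟨measurable_ampReflected hq, 1, fun θ => by
    unfold ampReflected
    split_ifs
    · simp
    · exact norm_reflection_le hq _⟩

theorem isMultiplier_planeRemainder {q : ℤ → ℝ} (hq : MemEllOneOne q) (n : ℤ) :
    IsMultiplier (planeRemainder q n) :=
  ((isMultiplier_planeWave hq n).sub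
    ((isMultiplier_ampTransmitted hq).mul (isMultiplier_freeWave n))).sub
    ((isMultiplier_ampReflected hq).mul (isMultiplier_freeWave (-n)))

theorem isMultiplier_one : IsMultiplier fun _ => 1 :=
  isMultiplier_of_continuous continuous_const (C := 1) fun _ => by simp

/-- On `bulk δ` the remainder is the kernel of a Hilbert–Schmidt operator, with rows of norm
`O(1/n)`. Such an operator turns the weak convergence of the evolution to zero into norm
convergence. -/
theorem exists_remainderOp {q : ℤ → ℝ} (hq : MemEllOneOne q) {δ : ℝ} (hδ : 0 < δ) :
    ∃ V : L2Torus →L[ℂ] Ell2,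
      (∀ f (n : ℤ), 0 ≤ n →
        V f n = inner ℂ (toL2 (planeRemainder q n)) (cutoff (bulk δ) f)) ∧
      (∀ f (n : ℤ), n < 0 → V f n = 0) ∧
      ∀ f, Tendsto (fun s => V (evol s f)) atTop (𝓝 0) := by
  obtain ⟨A, hA0, hA⟩ := exists_planeRemainder_bound hq
  have mS := measurableSet_bulk δ
  let r : ℤ → ℝ → ℂ := fun n θ => if 0 ≤ n then (bulk δ).indicator 1 θ * planeRemainder q n θ else 0
  have hr : ∀ n, IsMultiplier (r n) := fun n => by
    by_cases h : 0 ≤ n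
    · simp only [r, h, if_true]
      exact (isMultiplier_indicator mS).mul (isMultiplier_planeRemainder hq n)
    · simp only [r, h, if_false]
      exact isMultiplier_of_continuous continuous_const (C := 0) fun _ => by simp
  have hrb : ∀ n θ, ‖r n θ‖ ≤ A / δ / (|(n : ℝ)| + 1) := fun n θ => by
    have hpos : 0 ≤ A / δ / (|(n : ℝ)| + 1) := by positivity
    by_cases h : 0 ≤ n
    · obtain ⟨m, rfl⟩ : ∃ m : ℕ, n = m := ⟨n.toNat, by omega⟩
      by_cases hθ : θ ∈ bulk δ
      · have hs : 0 < |Real.sin θ| := hδ.trans_le hθ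
        simp only [r, h, if_true, Set.indicator_of_mem hθ, Pi.one_apply, one_mul]
        refine (hA m θ (abs_pos.1 hs)).trans ?_
        rw [Int.cast_natCast, Nat.abs_cast]
        have : δ ≤ |Real.sin θ| := hθ
        gcongr
      · simpa [r, Set.indicator_of_notMem hθ] using hpos
    · simpa [r, h] using hpos
  set M := ‖toL2 fun _ => (1 : ℂ)‖
  have hv : ∀ n, ‖toL2 (r n)‖ ≤ A / δ * M / (|(n : ℝ)| + 1) := fun n => by
    have e : toL2 (r n) = mulOp (r n) (toL2 fun _ => (1 : ℂ)) := by
      rw [mulOp_toL2 (hr n) isMultiplier_one.memLp (by simpa using (hr n).memLp)]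
      simp only [mul_one]
    rw [e]
    refine (norm_mulOp_apply_le (hr n) (hrb n) _).trans_eq ?_
    ring
  obtain ⟨V, hV⟩ := exists_besselOp (summable_int_sq_div (A / δ * M)) hv
  refine ⟨V, fun f n hn => ?_, fun f n hn => ?_, fun f => ?_⟩
  · rw [hV, ← inner_cutoff_left mS]
    congr 1
    have hm := isMultiplier_planeRemainder hq n
    rw [cutoff, mulOp_toL2 (isMultiplier_indicator mS) hm.memLp
      ((isMultiplier_indicator mS).mul hm).memLp]
    simp only [r, hn, if_true]
  · rw [hV, inner_toL2 (hr n).memLp]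
    simp [r, not_le.2 hn]
  · refine Ell2.tendsto_zero_of_dominated (summable_int_sq_div (A / δ * M * ‖f‖))
      (Eventually.of_forall fun s n => ?_) fun n => ?_
    · rw [hV]
      refine (norm_inner_le_norm _ _).trans ?_
      rw [norm_evol]
      refine (mul_le_mul_of_nonneg_right (hv n) (norm_nonneg _)).trans_eq ?_
      ring
    · simp only [hV]
      exact tendsto_inner_evol (hr n) f

theorem toL2_planeWave {q : ℤ → ℝ} (hq : MemEllOneOne q) (n : ℤ) :
    toL2 (planeWave q n) = mulOp (ampTransmitted q) (toL2 (freeWave n))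
      + mulOp (ampReflected q) (toL2 (freeWave (-n))) + toL2 (planeRemainder q n) := by
  have hA := isMultiplier_ampTransmitted hq
  have hB := isMultiplier_ampReflected hq
  rw [mulOp_toL2 hA (memLp_freeWave n) (hA.mul (isMultiplier_freeWave n)).memLp,
    mulOp_toL2 hB (memLp_freeWave (-n)) (hB.mul (isMultiplier_freeWave (-n))).memLp]
  refine Lp.ext ?_
  filter_upwards [coeFn_toL2 (isMultiplier_planeWave hq n).memLp,
    coeFn_toL2 (hA.mul (isMultiplier_freeWave n)).memLp,
    coeFn_toL2 (hB.mul (isMultiplier_freeWave (-n))).memLp,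
    coeFn_toL2 (isMultiplier_planeRemainder hq n).memLp,
    Lp.coeFn_add (toL2 fun θ => ampTransmitted q θ * freeWave n θ)
      (toL2 fun θ => ampReflected q θ * freeWave (-n) θ),
    Lp.coeFn_add ((toL2 fun θ => ampTransmitted q θ * freeWave n θ)
      + (toL2 fun θ => ampReflected q θ * freeWave (-n) θ)) (toL2 (planeRemainder q n))]
    with θ h1 h2 h3 h4 h5 h6
  rw [h6, Pi.add_apply, h5, Pi.add_apply, h1, h2, h3, h4, planeRemainder]
  ring

/-- The adjoint transform away from the thresholds, on the right half line. -/
theorem exists_halfLineOp {q : ℤ → ℝ} (hq : MemEllOneOne q) {δ : ℝ} (hδ : 0 < δ) :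
    ∃ V : L2Torus →L[ℂ] Ell2,
      (∀ f (n : ℤ), 0 ≤ n → V f n = inner ℂ (toL2 (planeWave q n)) (cutoff (bulk δ) f)) ∧
      ∀ f, Tendsto (fun s => V (evol s f)
        - coordProj {n : ℤ | 0 ≤ n} (freeCoeff (cutoff (bulk δ) (evol s f)))) atTop (𝓝 0) := by
  obtain ⟨R, hR, hR0, hRt⟩ := exists_remainderOp hq hδ
  have mS := measurableSet_bulk δ
  have hA := (isMultiplier_ampTransmitted hq).conj
  have hB := (isMultiplier_ampReflected hq).conj
  set a : ℝ → ℂ := fun θ => (starRingEnd ℂ) (ampTransmitted q θ) with ha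
  set b : ℝ → ℂ := fun θ => (starRingEnd ℂ) (ampReflected q θ) with hb
  let X : L2Torus →L[ℂ] Ell2 := coordProj {n : ℤ | 0 ≤ n} ∘L
    (freeCoeff : L2Torus →L[ℂ] Ell2) ∘L mulOp a ∘L cutoff (bulk δ)
  let Y : L2Torus →L[ℂ] Ell2 := flipSeq.toContinuousLinearMap ∘L coordProj {n : ℤ | n ≤ 0} ∘L
    (freeCoeff : L2Torus →L[ℂ] Ell2) ∘L mulOp b ∘L cutoff (bulk δ)
  have hX : ∀ f, X f = coordProj {n : ℤ | 0 ≤ n} (freeCoeff (mulOp a (cutoff (bulk δ) f))) :=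
    fun _ => rfl
  have hY : ∀ f, Y f = flipSeq (coordProj {n : ℤ | n ≤ 0}
    (freeCoeff (mulOp b (cutoff (bulk δ) f)))) := fun _ => rfl
  -- A multiplier that vanishes off an arc may be followed by the cutoff to this arc, which brings
  -- in the half-line estimates.
  have hcut : ∀ {J : Set ℝ} (hJ : MeasurableSet J) {g : ℝ → ℂ} (hg : IsMultiplier g),
      (∀ θ ∈ Set.Ioc (-Real.pi) Real.pi, Real.sin θ ≠ 0 → θ ∉ J → g θ = 0) →
      ∀ (s : ℝ) f, mulOp g (cutoff (bulk δ) (evol s f))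
        = evol s (cutoff J (mulOp g (cutoff (bulk δ) f))) := by
    intro J hJ g hg h0 s f
    rw [evol_cutoff hJ, evol_mulOp hg, evol_cutoff mS]
    refine Lp.ext ?_
    filter_upwards [coeFn_cutoff hJ (mulOp g (cutoff (bulk δ) (evol s f))),
      coeFn_mulOp hg (cutoff (bulk δ) (evol s f)), ae_sin_ne_zero, ae_mem_torus] with θ h1 h2 h3 h4
    rw [h1]
    by_cases h : θ ∈ J
    · rw [Set.indicator_of_mem h]
    · rw [Set.indicator_of_notMem h, h2, h0 θ h4 h3 h, zero_mul]
  refine ⟨X + Y + R, fun f n hn => ?_, fun f => ?_⟩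
  · change X f n + Y f n + R f n = _
    have h1 : n ∈ {n : ℤ | 0 ≤ n} := hn
    have h2 : -n ∈ {n : ℤ | n ≤ 0} := by simpa using hn
    rw [hX, hY, hR f n hn, coordProj_apply, flipSeq_apply, coordProj_apply,
      Set.indicator_of_mem h1, Set.indicator_of_mem h2, freeCoeff_apply, freeCoeff_apply,
      toL2_planeWave hq, inner_add_left, inner_add_left,
      inner_mulOp_left (isMultiplier_ampTransmitted hq),
      inner_mulOp_left (isMultiplier_ampReflected hq)]
  -- The transmitted amplitude is `1` for `θ < 0`, so `a - 1` lives on the right arc; the reflected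
  -- amplitude lives on the left arc and acts through the site `-n`. Both leave their half lines,
  -- and what remains is the free coefficient with amplitude `1`.
  · have ha1 : IsMultiplier fun θ => a θ - 1 := hA.sub isMultiplier_one
    have t1 := tendsto_coordProj_right (mulOp (fun θ => a θ - 1) (cutoff (bulk δ) f))
    have t2 := tendsto_coordProj_left (mulOp b (cutoff (bulk δ) f))
    have t3 := (flipSeq.continuous.tendsto 0).comp t2
    rw [map_zero] at t3
    have t4 := (t1.add t3).add (hRt f)
    simp only [add_zero] at t4
    refine t4.congr fun s => ?_
    simp only [Function.comp_apply]
    rw [← hcut measurableSet_Ioo ha1 ?_ s f, ← hcut measurableSet_Ioo hB ?_ s f]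
    · change _ = X (evol s f) + Y (evol s f) + R (evol s f) - _
      rw [hX, hY]
      have e : mulOp (fun θ => a θ - 1) (cutoff (bulk δ) (evol s f))
          = mulOp a (cutoff (bulk δ) (evol s f)) - cutoff (bulk δ) (evol s f) := by
        refine Lp.ext ?_
        filter_upwards [coeFn_mulOp ha1 (cutoff (bulk δ) (evol s f)),
          coeFn_mulOp hA (cutoff (bulk δ) (evol s f)), Lp.coeFn_sub
          (mulOp a (cutoff (bulk δ) (evol s f))) (cutoff (bulk δ) (evol s f))] with θ h1 h2 h3
        rw [h1, h3, Pi.sub_apply, h2]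
        ring
      rw [e, map_sub, map_sub]
      abel
    · intro θ hθ hs hn
      have := (mem_arcs hθ hs).resolve_right hn
      simp [hb, ampReflected, this.1.le]
    · intro θ hθ hs hn
      have := (mem_arcs hθ hs).resolve_left hn
      simp [ha, ampTransmitted, not_le.2 this.2]

/-- The adjoint transform away from the thresholds. -/
theorem exists_bulkOp {q : ℤ → ℝ} (hq : MemEllOneOne q) {δ : ℝ} (hδ : 0 < δ) :
    ∃ V : L2Torus →L[ℂ] Ell2,
      (∀ f n, V f n = inner ℂ (toL2 (planeWave q n)) (cutoff (bulk δ) f)) ∧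
      ∀ f, Tendsto (fun s => V (evol s f) - freeCoeff (cutoff (bulk δ) (evol s f)))
        atTop (𝓝 0) := by
  obtain ⟨V, hV, hVt⟩ := exists_halfLineOp hq hδ
  obtain ⟨W, hW, hWt⟩ := exists_halfLineOp hq.reflect hδ
  have mS := measurableSet_bulk δ
  let P := coordProj {n : ℤ | 0 ≤ n}
  let Q := coordProj {n : ℤ | n < 0}
  -- The negative sites are served by the half-line operator of the reflected potential, conjugated
  -- by reflections.
  let U : L2Torus →L[ℂ] Ell2 := P ∘L V
    + Q ∘L flipSeq.toContinuousLinearMap ∘L W ∘L flipL2.toContinuousLinearMap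
  have hU : ∀ f, U f = P (V f) + Q (flipSeq (W (flipL2 f))) := fun _ => rfl
  refine ⟨U, fun f n => ?_, fun f => ?_⟩
  · rw [hU]
    change P (V f) n + Q (flipSeq (W (flipL2 f))) n = _
    rw [coordProj_apply, coordProj_apply]
    rcases lt_or_ge n 0 with hn | hn
    · have h1 : n ∉ {n : ℤ | 0 ≤ n} := by simpa using hn
      have h2 : n ∈ {n : ℤ | n < 0} := hn
      rw [Set.indicator_of_notMem h1, Set.indicator_of_mem h2, zero_add, flipSeq_apply,
        hW _ _ (by omega), ← flipL2_cutoff_bulk]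
      have hm : MemLp (fun θ => planeWave (reflect q) (-n) (-θ)) 2 torusMeasure :=
        (isMultiplier_planeWave hq.reflect (-n)).memLp.comp_measurePreserving
          measurePreserving_neg_torus
      rw [inner_flipL2 (isMultiplier_planeWave hq.reflect _).memLp hm]
      congr 1
      refine Lp.ext ?_
      filter_upwards [coeFn_toL2 hm, coeFn_toL2 (memLp_planeWave hq n), ae_sin_ne_zero]
        with θ e1 e2 e3
      have : θ ≠ 0 := fun h => e3 (by rw [h, Real.sin_zero])
      rw [e1, e2, planeWave_reflect hq _ (by simpa using this), neg_neg, neg_neg]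
    · have h1 : n ∈ {n : ℤ | 0 ≤ n} := hn
      have h2 : n ∉ {n : ℤ | n < 0} := by simpa using hn
      rw [Set.indicator_of_mem h1, Set.indicator_of_notMem h2, add_zero, hV _ _ hn]
  · have t1 := (P.continuous.tendsto 0).comp (hVt f)
    have t2 := ((Q ∘L flipSeq.toContinuousLinearMap).continuous.tendsto 0).comp (hWt (flipL2 f))
    rw [map_zero] at t1 t2
    have t := t1.add t2
    rw [add_zero] at t
    refine t.congr fun s => ?_
    simp only [Function.comp_apply, ContinuousLinearMap.comp_apply,
      LinearIsometry.coe_toContinuousLinearMap]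
    rw [hU, flipL2_evol, map_sub, map_sub, map_sub]
    set g := freeCoeff (cutoff (bulk δ) (evol s f)) with hg
    have e : P (coordProj {n : ℤ | 0 ≤ n} g)
        + Q (flipSeq (coordProj {n : ℤ | 0 ≤ n}
          (freeCoeff (cutoff (bulk δ) (evol s (flipL2 f)))))) = g := by
      rw [← flipL2_evol, ← flipL2_cutoff_bulk]
      ext n
      change P (coordProj {n : ℤ | 0 ≤ n} g) n + Q (flipSeq (coordProj {n : ℤ | 0 ≤ n} _)) n = _
      rw [coordProj_apply, coordProj_apply]
      rcases lt_or_ge n 0 with hn | hn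
      · have h1 : n ∉ {n : ℤ | 0 ≤ n} := by simpa using hn
        have h2 : n ∈ {n : ℤ | n < 0} := hn
        have h3 : -n ∈ {n : ℤ | 0 ≤ n} := by simpa using hn.le
        rw [Set.indicator_of_notMem h1, Set.indicator_of_mem h2, zero_add, flipSeq_apply,
          coordProj_apply, Set.indicator_of_mem h3, freeCoeff_flipL2, neg_neg]
      · have h1 : n ∈ {n : ℤ | 0 ≤ n} := hn
        have h2 : n ∉ {n : ℤ | n < 0} := by simpa using hn
        rw [Set.indicator_of_mem h1, Set.indicator_of_notMem h2, add_zero, coordProj_apply,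
          Set.indicator_of_mem h1]
    rw [sub_add_sub_comm, e]

/-! ### The operators -/

theorem inner_shift (k : ℤ) (u v : Ell2) : inner ℂ (shift k u) v = inner ℂ u (shift (-k) v) := by
  rw [lp.inner_eq_tsum, lp.inner_eq_tsum]
  refine Eq.trans (tsum_congr fun n => ?_)
    ((Equiv.addRight k).tsum_eq fun n => inner ℂ (u n) (shift (-k) v n))
  change inner ℂ (u (n + k)) (v n) = inner ℂ (u (n + k)) (v (n + k + -k))
  rw [add_neg_cancel_right]

theorem inner_potential (q : ℤ → ℝ) (hq : MemEllOneOne q) (u v : Ell2) :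
    inner ℂ (potential q hq u) v = inner ℂ u (potential q hq v) := by
  rw [lp.inner_eq_tsum, lp.inner_eq_tsum]
  refine tsum_congr fun n => ?_
  change inner ℂ ((q n : ℂ) * u n) (v n) = inner ℂ (u n) ((q n : ℂ) * v n)
  simp only [RCLike.inner_apply, map_mul, Complex.conj_ofReal]
  ring

theorem inner_laplacian (u v : Ell2) : inner ℂ (laplacian u) v = inner ℂ u (laplacian v) := by
  change inner ℂ (shift 1 u + shift (-1) u - (2 : ℂ) • u) v
    = inner ℂ u (shift 1 v + shift (-1) v - (2 : ℂ) • v)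
  rw [inner_sub_left, inner_add_left, inner_shift, inner_shift, neg_neg, inner_sub_right,
    inner_add_right, inner_smul_left, inner_smul_right]
  simp only [map_ofNat]
  ring

theorem inner_hamiltonian (q : ℤ → ℝ) (hq : MemEllOneOne q) (u v : Ell2) :
    inner ℂ (hamiltonian q hq u) v = inner ℂ u (hamiltonian q hq v) := by
  change inner ℂ (-laplacian u + potential q hq u) v
    = inner ℂ u (-laplacian v + potential q hq v)
  rw [inner_add_left, inner_neg_left, inner_laplacian, inner_potential, inner_add_right,
    inner_neg_right]

theorem isSelfAdjoint_hamiltonian (q : ℤ → ℝ) (hq : MemEllOneOne q) :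
    IsSelfAdjoint (hamiltonian q hq) :=
  ContinuousLinearMap.isSelfAdjoint_iff_isSymmetric.2 (inner_hamiltonian q hq)

theorem toL2_planeWave_rec {q : ℤ → ℝ} (hq : MemEllOneOne q) (n : ℤ) :
    mulOp energy (toL2 (planeWave q n)) = ((2 + q n : ℝ) : ℂ) • toL2 (planeWave q n)
      - (toL2 (planeWave q (n + 1)) + toL2 (planeWave q (n - 1))) := by
  refine Lp.ext ?_
  filter_upwards [coeFn_mulOp isMultiplier_energy (toL2 (planeWave q n)),
    coeFn_toL2 (memLp_planeWave hq n), coeFn_toL2 (memLp_planeWave hq (n + 1)),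
    coeFn_toL2 (memLp_planeWave hq (n - 1)),
    Lp.coeFn_sub (((2 + q n : ℝ) : ℂ) • toL2 (planeWave q n))
      (toL2 (planeWave q (n + 1)) + toL2 (planeWave q (n - 1))),
    Lp.coeFn_smul ((2 + q n : ℝ) : ℂ) (toL2 (planeWave q n)),
    Lp.coeFn_add (toL2 (planeWave q (n + 1))) (toL2 (planeWave q (n - 1)))]
    with θ h1 h2 h3 h4 h5 h6 h7
  rw [h1, h5, Pi.sub_apply, h6, Pi.smul_apply, h7, Pi.add_apply, h2, h3, h4, planeWave_rec hq,
    energy, smul_eq_mul]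
  push_cast
  ring

theorem hamiltonian_intertwine {q : ℤ → ℝ} (hq : MemEllOneOne q) {C : L2Torus →L[ℂ] L2Torus}
    (hC : ∀ f, C (mulOp energy f) = mulOp energy (C f)) {V : L2Torus →L[ℂ] Ell2}
    (hV : ∀ f n, V f n = inner ℂ (toL2 (planeWave q n)) (C f)) (f : L2Torus) :
    hamiltonian q hq (V f) = V (mulOp energy f) := by
  ext n
  have h := inner_mulOp_left isMultiplier_energy (toL2 (planeWave q n)) (C f)
  simp only [conj_energy] at h
  rw [hamiltonian_apply, hV, hV, hV, hV, hC]
  refine Eq.trans ?_ h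
  rw [toL2_planeWave_rec hq, inner_sub_left, inner_smul_left, inner_add_left, Complex.conj_ofReal]
  push_cast
  ring

theorem toL2_freeWave_rec (n : ℤ) :
    mulOp energy (toL2 (freeWave n)) = (2 : ℂ) • toL2 (freeWave n)
      - (toL2 (freeWave (n + 1)) + toL2 (freeWave (n - 1))) := by
  refine Lp.ext ?_
  filter_upwards [coeFn_mulOp isMultiplier_energy (toL2 (freeWave n)),
    coeFn_toL2 (memLp_freeWave n), coeFn_toL2 (memLp_freeWave (n + 1)),
    coeFn_toL2 (memLp_freeWave (n - 1)),
    Lp.coeFn_sub ((2 : ℂ) • toL2 (freeWave n))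
      (toL2 (freeWave (n + 1)) + toL2 (freeWave (n - 1))),
    Lp.coeFn_smul (2 : ℂ) (toL2 (freeWave n)),
    Lp.coeFn_add (toL2 (freeWave (n + 1))) (toL2 (freeWave (n - 1)))]
    with θ h1 h2 h3 h4 h5 h6 h7
  have hr := wave_rec (-θ) n
  rw [Real.cos_neg] at hr
  rw [h1, h5, Pi.sub_apply, h6, Pi.smul_apply, h7, Pi.add_apply, h2, h3, h4, energy, smul_eq_mul,
    freeWave_eq, freeWave_eq, freeWave_eq]
  push_cast
  push_cast at hr
  linear_combination normConst * hr

theorem laplacian_apply (u : Ell2) (n : ℤ) :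
    laplacian u n = u (n + 1) + u (n - 1) - 2 * u n := by
  change u (n + 1) + u (n + -1) - 2 * u n = _
  rw [sub_eq_add_neg n 1]

theorem laplacian_freeCoeff (f : L2Torus) :
    laplacian (freeCoeff f) = freeCoeff (-mulOp energy f) := by
  ext n
  have h := inner_mulOp_left isMultiplier_energy (toL2 (freeWave n)) f
  simp only [conj_energy] at h
  rw [laplacian_apply, freeCoeff_apply, freeCoeff_apply, freeCoeff_apply, freeCoeff_apply,
    inner_neg_right, ← h, toL2_freeWave_rec, inner_sub_left, inner_smul_left, inner_add_left,
    map_ofNat]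
  ring

theorem expI_laplacian_freeCoeff (t : ℝ) (f : L2Torus) :
    expI laplacian t (freeCoeff f) = freeCoeff (evol (-t) f) := by
  have h := expI_intertwine (V := (freeCoeff : L2Torus →L[ℂ] Ell2)) (A := -mulOp energy)
    (B := laplacian) (fun f => laplacian_freeCoeff f) t f
  have e : (Complex.I * (t : ℂ)) • -mulOp energy = (Complex.I * ((-t : ℝ) : ℂ)) • mulOp energy := by
    rw [smul_neg, ← neg_smul]
    push_cast
    ring_nf
  rw [e, exp_energy] at h
  exact h

/-! ### The adjoint of the transform -/

theorem tendsto_cutoff_bulk (f : L2Torus) :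
    Tendsto (fun k : ℕ => cutoff (bulk (1 / ((k : ℝ) + 1))) f) atTop (𝓝 f) := by
  have h : Tendsto (fun k : ℕ => ∫ θ, ‖(cutoff (bulk (1 / ((k : ℝ) + 1))) f - f) θ‖ ^ 2
      ∂torusMeasure) atTop (𝓝 (∫ _, (0 : ℝ) ∂torusMeasure)) := by
    refine tendsto_integral_of_dominated_convergence (fun θ => ‖f θ‖ ^ 2) (fun k => ?_) ?_
      (fun k => ?_) ?_
    · exact ((Lp.aestronglyMeasurable _).norm.pow 2)
    · exact (Lp.memLp f).integrable_norm_pow (by norm_num)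
    · filter_upwards [coeFn_cutoff (measurableSet_bulk (1 / ((k : ℝ) + 1))) f,
        Lp.coeFn_sub (cutoff (bulk (1 / ((k : ℝ) + 1))) f) f] with θ h1 h2
      rw [h2, Pi.sub_apply, h1, Real.norm_eq_abs, abs_of_nonneg (sq_nonneg _)]
      refine pow_le_pow_left₀ (norm_nonneg _) ?_ 2
      by_cases h : θ ∈ bulk (1 / ((k : ℝ) + 1))
      · rw [Set.indicator_of_mem h, sub_self, norm_zero]
        exact norm_nonneg _
      · rw [Set.indicator_of_notMem h, zero_sub, norm_neg]
    · have hall : ∀ᵐ θ ∂torusMeasure, ∀ k : ℕ,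
          (cutoff (bulk (1 / ((k : ℝ) + 1))) f - f) θ
            = (bulk (1 / ((k : ℝ) + 1))).indicator f θ - f θ := by
        rw [ae_all_iff]
        intro k
        filter_upwards [coeFn_cutoff (measurableSet_bulk (1 / ((k : ℝ) + 1))) f,
          Lp.coeFn_sub (cutoff (bulk (1 / ((k : ℝ) + 1))) f) f] with θ h1 h2
        rw [h2, Pi.sub_apply, h1]
      filter_upwards [hall, ae_sin_ne_zero] with θ h1 h2
      have hev : ∀ᶠ k : ℕ in atTop, 1 / ((k : ℝ) + 1) ≤ |Real.sin θ| :=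
        tendsto_one_div_add_atTop_nhds_zero_nat.eventually (ge_mem_nhds (abs_pos.2 h2))
      refine tendsto_const_nhds.congr' ?_
      filter_upwards [hev] with k hk
      have : θ ∈ bulk (1 / ((k : ℝ) + 1)) := hk
      rw [h1, Set.indicator_of_mem this]
      simp
  simp only [← L2Torus.norm_sq, integral_zero] at h
  rw [tendsto_iff_norm_sub_tendsto_zero]
  simpa using h.sqrt

/-- By intertwining, `V (evol s f)` is a unitary image of `V f`, and the free side has constant norm
as well. The two norms do not depend on `s` and their difference tends to zero, so they are equal.
-/
theorem norm_bulkOp {q : ℤ → ℝ} (hq : MemEllOneOne q) {δ : ℝ} {V : L2Torus →L[ℂ] Ell2}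
    (hV : ∀ f n, V f n = inner ℂ (toL2 (planeWave q n)) (cutoff (bulk δ) f))
    (hVt : ∀ f, Tendsto (fun s => V (evol s f) - freeCoeff (cutoff (bulk δ) (evol s f)))
      atTop (𝓝 0)) (f : L2Torus) : ‖V f‖ = ‖cutoff (bulk δ) f‖ := by
  have mS := measurableSet_bulk δ
  have hint := hamiltonian_intertwine hq (fun f => (mulOp_comm isMultiplier_energy
    (isMultiplier_indicator mS) f).symm) hV
  have h1 : ∀ s, ‖V (evol s f)‖ = ‖V f‖ := fun s => by
    rw [← exp_energy, ← expI_intertwine hint, expI_unitary (isSelfAdjoint_hamiltonian q hq)]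
  have h2 : ∀ s, ‖freeCoeff (cutoff (bulk δ) (evol s f))‖ = ‖cutoff (bulk δ) f‖ := fun s => by
    rw [LinearIsometryEquiv.norm_map, ← evol_cutoff mS, norm_evol]
  have h3 : Tendsto (fun _ : ℝ => |‖V f‖ - ‖cutoff (bulk δ) f‖|) atTop (𝓝 0) := by
    refine squeeze_zero (fun _ => abs_nonneg _) (fun s => ?_)
      (tendsto_zero_iff_norm_tendsto_zero.1 (hVt f))
    rw [← h1 s, ← h2 s]
    exact abs_norm_sub_norm_le _ _
  have h4 := tendsto_nhds_unique h3 tendsto_const_nhds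
  exact sub_eq_zero.1 (abs_eq_zero.1 h4.symm)

/-- The adjoint of the distorted Fourier transform is an isometry that intertwines and is
asymptotically free in the past. -/
theorem exists_adjointTransform {q : ℤ → ℝ} (hq : MemEllOneOne q) :
    ∃ V : L2Torus →L[ℂ] Ell2,
      (∀ f n, V f n = inner ℂ (toL2 (planeWave q n)) f) ∧ (∀ f, ‖V f‖ = ‖f‖) ∧
      (∀ f, hamiltonian q hq (V f) = V (mulOp energy f)) ∧
      ∀ f, Tendsto (fun s => V (evol s f) - freeCoeff (evol s f)) atTop (𝓝 0) := by
  choose W hW hWt using fun k : ℕ => exists_bulkOp hq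
    (show (0 : ℝ) < 1 / ((k : ℝ) + 1) by positivity)
  have hWn := fun k => norm_bulkOp hq (hW k) (hWt k)
  have mS := fun k : ℕ => measurableSet_bulk (1 / ((k : ℝ) + 1))
  -- The constant `1` holds for every `δ`, so Bessel's inequality survives `δ → 0` on finite sets of
  -- sites, although the remainder estimates degenerate at the thresholds.
  have bound : ∀ (f : L2Torus) (t : Finset ℤ),
      ∑ n ∈ t, ‖inner ℂ (toL2 (planeWave q n)) f‖ ^ 2 ≤ (1 * ‖f‖) ^ 2 := fun f t => by
    have hlim : Tendsto (fun k : ℕ => ∑ n ∈ t, ‖inner ℂ (toL2 (planeWave q n))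
        (cutoff (bulk (1 / ((k : ℝ) + 1))) f)‖ ^ 2) atTop
        (𝓝 (∑ n ∈ t, ‖inner ℂ (toL2 (planeWave q n)) f‖ ^ 2)) :=
      tendsto_finsetSum _ fun n _ =>
        ((tendsto_const_nhds.inner (tendsto_cutoff_bulk f)).norm.pow 2)
    refine le_of_tendsto' hlim fun k => ?_
    simp only [← hW]
    refine (sum_le_hasSum t (fun _ _ => sq_nonneg _) (Ell2.hasSum_norm_sq _)).trans ?_
    rw [hWn, one_mul]
    exact pow_le_pow_left₀ (norm_nonneg _) (norm_cutoff_le (mS k) f) 2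
  set V := besselOp (fun n => toL2 (planeWave q n)) 1 zero_le_one bound
  have hV : ∀ f n, V f n = inner ℂ (toL2 (planeWave q n)) f := besselOp_apply _ _ _ _
  have hVW : ∀ (k : ℕ) (f : L2Torus), V (cutoff (bulk (1 / ((k : ℝ) + 1))) f) = W k f := fun k f => by
    ext n
    rw [hV, hW]
  have hVn : ∀ f, ‖V f‖ = ‖f‖ := fun f => by
    have h1 := ((V.continuous.tendsto f).comp (tendsto_cutoff_bulk f)).norm
    have h2 := (tendsto_cutoff_bulk f).norm
    simp only [Function.comp_def, hVW, hWn] at h1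
    exact tendsto_nhds_unique h1 h2
  refine ⟨V, hV, hVn, hamiltonian_intertwine hq (C := ContinuousLinearMap.id ℂ _)
    (fun _ => rfl) hV, fun f => ?_⟩
  -- Functions that vanish near the thresholds are dense, and the operators are bounded by `2`
  -- uniformly in `s`.
  refine tendsto_zero_of_total (Y := fun s => (V - (freeCoeff : L2Torus →L[ℂ] Ell2)) ∘L evol s)
    (C := 2) (fun s f => ?_)
    (D := {g | ∃ (k : ℕ) (f : L2Torus), g = cutoff (bulk (1 / ((k : ℝ) + 1))) f}) ?_ ?_ f
  · change ‖V (evol s f) - freeCoeff (evol s f)‖ ≤ _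
    refine (norm_sub_le _ _).trans ?_
    rw [hVn, LinearIsometryEquiv.norm_map, norm_evol, two_mul]
  · rintro _ ⟨k, f, rfl⟩
    refine (hWt k f).congr fun s => ?_
    change _ = V (evol s (cutoff _ f)) - freeCoeff (evol s (cutoff _ f))
    rw [evol_cutoff (mS k), hVW]
  · intro f hf
    have hz : ∀ k : ℕ, cutoff (bulk (1 / ((k : ℝ) + 1))) f = 0 := fun k => by
      rw [← inner_self_eq_zero (𝕜 := ℂ), ← inner_cutoff_left (mS k), cutoff_cutoff (mS k)]
      exact hf _ ⟨k, f, rfl⟩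
    have := tendsto_cutoff_bulk f
    simp only [hz] at this
    exact (tendsto_nhds_unique this tendsto_const_nhds)

/-- The adjoint transform. -/
def adjointTransform {q : ℤ → ℝ} (hq : MemEllOneOne q) : L2Torus →L[ℂ] Ell2 :=
  (exists_adjointTransform hq).choose

section

variable {q : ℤ → ℝ} (hq : MemEllOneOne q)

theorem adjointTransform_apply (f : L2Torus) (n : ℤ) :
    adjointTransform hq f n = inner ℂ (toL2 (planeWave q n)) f :=
  (exists_adjointTransform hq).choose_spec.1 f n

theorem norm_adjointTransform (f : L2Torus) : ‖adjointTransform hq f‖ = ‖f‖ :=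
  (exists_adjointTransform hq).choose_spec.2.1 f

theorem hamiltonian_adjointTransform (f : L2Torus) :
    hamiltonian q hq (adjointTransform hq f) = adjointTransform hq (mulOp energy f) :=
  (exists_adjointTransform hq).choose_spec.2.2.1 f

theorem tendsto_adjointTransform_evol (f : L2Torus) :
    Tendsto (fun s => adjointTransform hq (evol s f) - freeCoeff (evol s f)) atTop (𝓝 0) :=
  (exists_adjointTransform hq).choose_spec.2.2.2 f

theorem adjointTransform_eq (f : L2Torus) (n : ℤ) :
    adjointTransform hq f n = distortedFourierAdj q f n := by
  rw [adjointTransform_apply, inner_toL2 (memLp_planeWave hq n), integral_torus]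
  rfl

/-- The distorted Fourier transform as an operator. -/
def transformOp : Ell2 →L[ℂ] L2Torus := (adjointTransform hq).adjoint

theorem hasSum_transformOp (u : Ell2) :
    HasSum (transformTerm (planeWave q) u) (transformOp hq u) :=
  hasSum_adjoint (adjointTransform_apply hq) u

theorem distortedFourier_eq (u : Ell2) : distortedFourier q u = transformOp hq u :=
  (hasSum_transformOp hq u).tsum_eq

theorem transformOp_unitVec (n : ℤ) : transformOp hq (unitVec n) = toL2 (planeWave q n) :=
  adjoint_unitVec (adjointTransform_apply hq) n

/-- An isometry has its adjoint as a left inverse; this is where the surjectivity of `F` comes from.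
-/
theorem transformOp_adjointTransform (f : L2Torus) :
    transformOp hq (adjointTransform hq f) = f := by
  have h := (ContinuousLinearMap.norm_map_iff_adjoint_comp_self _).1 (norm_adjointTransform hq)
  exact DFunLike.congr_fun h f

theorem transformOp_hamiltonian (u : Ell2) :
    transformOp hq (hamiltonian q hq u) = mulOp energy (transformOp hq u) := by
  refine ext_inner_right ℂ fun f => ?_
  rw [transformOp, ContinuousLinearMap.adjoint_inner_left, inner_hamiltonian,
    hamiltonian_adjointTransform, inner_mulOp_left isMultiplier_energy,
    ContinuousLinearMap.adjoint_inner_left]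
  simp only [conj_energy]

theorem norm_transformOp_le (u : Ell2) : ‖transformOp hq u‖ ≤ ‖u‖ := by
  have h : ‖transformOp hq u‖ ^ 2 ≤ ‖u‖ * ‖transformOp hq u‖ := by
    have h1 : inner ℂ (transformOp hq u) (transformOp hq u)
        = inner ℂ u (adjointTransform hq (transformOp hq u)) := by
      rw [transformOp, ContinuousLinearMap.adjoint_inner_left]
    have h2 := norm_inner_le_norm (𝕜 := ℂ) u (adjointTransform hq (transformOp hq u))
    rw [← h1, norm_adjointTransform, inner_self_eq_norm_sq_to_K] at h2
    simpa using h2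
  rcases (norm_nonneg (transformOp hq u)).eq_or_lt with h0 | h0
  · rw [← h0]; exact norm_nonneg _
  · nlinarith

/-- The wave operator in the past. -/
theorem tendsto_wave_atBot (u : Ell2) :
    Tendsto (fun t : ℝ => expI (hamiltonian q hq) t (expI laplacian t u)) atBot
      (𝓝 (adjointTransform hq (freeCoeff.symm u))) := by
  set f := freeCoeff.symm u with hf
  have hu : u = freeCoeff f := by simp [hf]
  rw [tendsto_iff_norm_sub_tendsto_zero]
  have h := ((tendsto_zero_iff_norm_tendsto_zero.1 (tendsto_adjointTransform_evol hq f)).comp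
    tendsto_neg_atBot_atTop)
  refine h.congr fun t => ?_
  have e : adjointTransform hq (evol (-t) f) = expI (hamiltonian q hq) (-t)
      (adjointTransform hq f) := by
    rw [← exp_energy, ← expI_intertwine (hamiltonian_adjointTransform hq)]
  rw [Function.comp_apply, hu, expI_laplacian_freeCoeff, norm_sub_rev,
    ← expI_unitary (isSelfAdjoint_hamiltonian q hq) t, map_sub, e, expI_add, add_neg_cancel,
    expI_zero]

end

section

/-! ### Complex conjugation and the wave operator in the future -/

theorem exp_apply_star {A : Ell2 →L[ℂ] Ell2} {B : Ell2 →L[ℂ] Ell2}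
    (h : ∀ u, B (star u) = star (A u)) (u : Ell2) :
    NormedSpace.exp B (star u) = star (NormedSpace.exp A u) := by
  have hp : ∀ (n : ℕ) (u : Ell2), (B ^ n) (star u) = star ((A ^ n) u) := by
    intro n
    induction n with
    | zero => intro f; rfl
    | succ n ih =>
      intro f
      rw [pow_succ, pow_succ, mul_apply_eq_comp, mul_apply_eq_comp, h, ih]
  have h1 := (ContinuousLinearMap.apply ℂ Ell2 (star u)).hasSum
    (NormedSpace.exp_series_hasSum_exp' (𝕂 := ℂ) B)
  have h2 := ((ContinuousLinearMap.apply ℂ Ell2 u).hasSum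
    (NormedSpace.exp_series_hasSum_exp' (𝕂 := ℂ) A)).star
  refine h1.unique ?_
  have e : (fun n : ℕ => ContinuousLinearMap.apply ℂ Ell2 (star u) ((n.factorial⁻¹ : ℂ) • B ^ n))
      = fun n : ℕ => star (ContinuousLinearMap.apply ℂ Ell2 u ((n.factorial⁻¹ : ℂ) • A ^ n)) := by
    funext n
    change (n.factorial⁻¹ : ℂ) • (B ^ n) (star u) = star ((n.factorial⁻¹ : ℂ) • (A ^ n) u)
    rw [hp, star_smul]
    simp
  rw [e]
  exact h2

/-- Conjugation reverses time for operators with real coefficients, so the limit in the past yields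
the one in the future. -/
theorem star_expI {A : Ell2 →L[ℂ] Ell2} (h : ∀ u, A (star u) = star (A u)) (t : ℝ) (u : Ell2) :
    star (expI A t u) = expI A (-t) (star u) := by
  rw [expI, expI]
  refine (exp_apply_star (fun u => ?_) u).symm
  change (Complex.I * ((-t : ℝ) : ℂ)) • A (star u) = star ((Complex.I * (t : ℂ)) • A u)
  rw [h, star_smul]
  simp

theorem laplacian_star (u : Ell2) : laplacian (star u) = star (laplacian u) := by
  ext n
  simp [laplacian_apply, lp.star_apply]

theorem hamiltonian_star (q : ℤ → ℝ) (hq : MemEllOneOne q) (u : Ell2) :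
    hamiltonian q hq (star u) = star (hamiltonian q hq u) := by
  ext n
  simp [hamiltonian_apply, lp.star_apply]

theorem coeFn_star_flipL2 (f : L2Torus) :
    (star (flipL2 f) : L2Torus) =ᵐ[torusMeasure] fun θ => (starRingEnd ℂ) (f (-θ)) := by
  filter_upwards [Lp.coeFn_star (flipL2 f), coeFn_flipL2 f] with θ h1 h2
  rw [h1, Pi.star_apply, h2]
  rfl

theorem conj_inner_toL2_star_flipL2 {g : ℝ → ℂ} (hg : MemLp g 2 torusMeasure) (f : L2Torus) :
    (starRingEnd ℂ) (inner ℂ (toL2 g) (star (flipL2 f))) = ∫ θ, g (-θ) * f θ ∂torusMeasure := by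
  rw [inner_toL2 hg, ← integral_conj, ← integral_comp_neg_torus]
  refine integral_congr_ae ?_
  filter_upwards [ae_comp_neg (coeFn_star_flipL2 f)] with θ h
  rw [h, neg_neg]
  simp

theorem freeCoeff_star_flipL2 (f : L2Torus) : freeCoeff (star (flipL2 f)) = star (freeCoeff f) := by
  ext n
  rw [lp.star_apply, freeCoeff_apply, freeCoeff_apply, RCLike.star_def,
    ← (starRingEnd ℂ).injective.eq_iff, conj_inner_toL2_star_flipL2 (memLp_freeWave n),
    Complex.conj_conj, inner_toL2 (memLp_freeWave n)]
  refine integral_congr_ae (Eventually.of_forall fun θ => ?_)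
  change freeWave n (-θ) * f θ = (starRingEnd ℂ) (freeWave n θ) * f θ
  rw [conj_freeWave, freeWave_eq, neg_neg]

variable {q : ℤ → ℝ} (hq : MemEllOneOne q)

/-- The wave operator in the future. -/
theorem exists_wave_atTop (u : Ell2) : ∃ w : Ell2,
    (∀ n : ℤ, w n = ∫ θ in (-Real.pi)..Real.pi, planeWave q n (-θ) * freeCoeff.symm u θ) ∧
    Tendsto (fun t : ℝ => expI (hamiltonian q hq) t (expI laplacian t u)) atTop (𝓝 w) := by
  -- Conjugating a sequence conjugates its Fourier series and flips the angle; hence the kernel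
  -- `ψ(n, -θ)` of `W₊`.
  have e : freeCoeff.symm (star u) = star (flipL2 (freeCoeff.symm u)) := by
    rw [LinearIsometryEquiv.symm_apply_eq, freeCoeff_star_flipL2, LinearIsometryEquiv.apply_symm_apply]
  refine ⟨star (adjointTransform hq (freeCoeff.symm (star u))), fun n => ?_, ?_⟩
  · rw [lp.star_apply, adjointTransform_apply, e, RCLike.star_def,
      conj_inner_toL2_star_flipL2 (memLp_planeWave hq n), integral_torus]
  · have h := ((tendsto_wave_atBot hq (star u)).comp tendsto_neg_atTop_atBot).star
    refine h.congr fun t => ?_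
    rw [Function.comp_apply, star_expI (hamiltonian_star q hq), neg_neg, star_expI laplacian_star,
      neg_neg, star_star]

/-! ### Eigenvectors -/

/-- A square summable solution decays at `+∞`, and at every `θ`, thresholds included, there is a
Jost solution to compare it with. So there are no eigenvalues in `[0, 4]`. -/
theorem eq_zero_of_hamiltonian_eq_energy {θ : ℝ} {v : Ell2}
    (hv : hamiltonian q hq v = energy θ • v) : v = 0 := by
  have hg : IsGeneralizedEigenfunction q θ v := fun n => by
    rw [← hamiltonian_apply q hq, hv]
    rfl
  have h0 : Tendsto (v : ℤ → ℂ) atTop (𝓝 0) := by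
    have h1 := (Ell2.hasSum_norm_sq v).summable.tendsto_cofinite_zero
    have h2 : Tendsto (fun n => Real.sqrt (‖v n‖ ^ 2)) atTop (𝓝 (Real.sqrt 0)) :=
      (h1.mono_left (by rw [Int.cofinite_eq]; exact le_sup_right)).sqrt
    simp only [Real.sqrt_sq (norm_nonneg _), Real.sqrt_zero] at h2
    exact tendsto_zero_iff_norm_tendsto_zero.2 h2
  ext n
  exact eq_zero_of_tendsto_zero (jostPlus_spec hq θ) hg h0 n

/-- An energy of the form `2(1 - cos θ)` has no eigenvector. For any other `z` the identity `(energy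
- z) F v = 0` can be divided. -/
theorem transformOp_eq_zero_of_eigenvector {z : ℂ} {v : Ell2} (hv : hamiltonian q hq v = z • v) :
    transformOp hq v = 0 := by
  by_cases h : ∃ θ, energy θ = z
  · obtain ⟨θ, rfl⟩ := h
    rw [eq_zero_of_hamiltonian_eq_energy hq hv, map_zero]
  · push Not at h
    have h1 := transformOp_hamiltonian hq v
    rw [hv, map_smul] at h1
    refine Lp.ext ?_
    filter_upwards [coeFn_mulOp isMultiplier_energy (transformOp hq v),
      Lp.coeFn_smul z (transformOp hq v), Lp.coeFn_zero ℂ 2 torusMeasure] with θ h2 h3 h4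
    rw [← h1, h3, Pi.smul_apply, smul_eq_mul] at h2
    rw [h4, Pi.zero_apply]
    have h5 : (energy θ - z) * transformOp hq v θ = 0 := by linear_combination -h2
    exact (mul_eq_zero.1 h5).resolve_left (sub_ne_zero.2 (h θ))

theorem mem_continuousSubspace_iff {u : Ell2} : u ∈ continuousSubspace q hq ↔
    ∀ (z : ℂ) (v : Ell2), hamiltonian q hq v = z • v → inner ℂ v u = 0 := by
  rw [continuousSubspace, eigenspan, ← Submodule.iInf_orthogonal, Submodule.mem_iInf]
  refine forall_congr' fun z => ?_
  rw [Submodule.mem_orthogonal]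
  refine forall_congr' fun v => ?_
  rw [Module.End.mem_eigenspace_iff]
  rfl

theorem adjointTransform_mem (f : L2Torus) :
    adjointTransform hq f ∈ continuousSubspace q hq := by
  rw [mem_continuousSubspace_iff]
  intro z v hv
  rw [← ContinuousLinearMap.adjoint_inner_left]
  change inner ℂ (transformOp hq v) f = 0
  rw [transformOp_eq_zero_of_eigenvector hq hv, inner_zero_left]

end

/-! ### The kernel of the transform for potentials of finite support -/

theorem isMultiplier_jostPlus {q : ℤ → ℝ} (hq : MemEllOneOne q) (n : ℤ) :
    IsMultiplier (jostPlus q n) := by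
  obtain ⟨C, hC⟩ := exists_jostPlus_bound hq n
  exact ⟨measurable_jostPlus hq n, C, hC q fun _ => le_rfl⟩

theorem isMultiplier_jostMinus {q : ℤ → ℝ} (hq : MemEllOneOne q) (n : ℤ) :
    IsMultiplier (jostMinus q n) := by
  rw [show jostMinus q n = jostPlus (reflect q) (-n) from funext fun θ => jostMinus_eq hq n θ]
  exact isMultiplier_jostPlus hq.reflect _

theorem IsMultiplier.comp_neg {g : ℝ → ℂ} (hg : IsMultiplier g) :
    IsMultiplier fun θ => g (-θ) := by
  obtain ⟨C, hC⟩ := hg.2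
  exact ⟨hg.1.comp measurable_neg, C, fun θ => hC _⟩

theorem isMultiplier_wave (k : ℤ) : IsMultiplier fun θ => wave θ k :=
  isMultiplier_of_continuous (continuous_wave k) fun θ => (norm_wave θ k).le

theorem isMultiplier_sin : IsMultiplier fun θ => (Real.sin θ : ℂ) :=
  isMultiplier_of_continuous (by fun_prop) (C := 1) fun θ => by
    rw [Complex.norm_real]; exact Real.abs_sin_le_one θ

theorem isMultiplier_jostWronskian {q : ℤ → ℝ} (hq : MemEllOneOne q) :
    IsMultiplier (jostWronskian q) :=
  ((isMultiplier_jostPlus hq 1).mul (isMultiplier_jostMinus hq 0)).sub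
    ((isMultiplier_jostPlus hq 0).mul (isMultiplier_jostMinus hq 1))

theorem isMultiplier_crossWronskian {q : ℤ → ℝ} (hq : MemEllOneOne q) :
    IsMultiplier (crossWronskian q) :=
  ((isMultiplier_jostMinus hq 1).mul (isMultiplier_jostPlus hq 0).comp_neg).sub
    ((isMultiplier_jostMinus hq 0).mul (isMultiplier_jostPlus hq 1).comp_neg)

theorem integral_eq_of_even_part {f g : ℝ → ℂ} (hf : Integrable f torusMeasure)
    (hg : Integrable g torusMeasure)
    (h : ∀ᵐ θ ∂torusMeasure, f θ + f (-θ) = g θ + g (-θ)) :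
    ∫ θ, f θ ∂torusMeasure = ∫ θ, g θ ∂torusMeasure := by
  have key : ∀ f : ℝ → ℂ, Integrable f torusMeasure →
      ∫ θ, (f θ + f (-θ)) ∂torusMeasure = 2 * ∫ θ, f θ ∂torusMeasure := fun f hf => by
    have hf' : Integrable (fun θ => f (-θ)) torusMeasure :=
      measurePreserving_neg_torus.integrable_comp_of_integrable hf
    rw [integral_add hf hf', integral_comp_neg_torus, two_mul]
  have := integral_congr_ae h
  rw [key f hf, key g hg] at this
  exact mul_left_cancel₀ two_ne_zero this

/-- The function whose coefficients in the plane waves are those of `sin θ e^{ikθ} f₊`. -/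
def probe (q : ℤ → ℝ) (k : ℤ) (θ : ℝ) : ℂ :=
  if 0 ≤ θ then Complex.I / 2 * normConst⁻¹ *
    (wave θ k * jostWronskian q θ + wave (-θ) k * crossWronskian q θ)
  else normConst⁻¹ * (wave θ k * Real.sin θ)

theorem isMultiplier_probe {q : ℤ → ℝ} (hq : MemEllOneOne q) (k : ℤ) :
    IsMultiplier (probe q k) := by
  have hc : ∀ c : ℂ, IsMultiplier fun _ => c := fun c =>
    isMultiplier_of_continuous continuous_const (C := ‖c‖) fun _ => le_rfl
  obtain ⟨m1, C, hC⟩ := (hc (Complex.I / 2 * normConst⁻¹)).mul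
    (((isMultiplier_wave k).mul (isMultiplier_jostWronskian hq)).sub ((hc (-1)).mul
      ((isMultiplier_wave k).comp_neg.mul (isMultiplier_crossWronskian hq))))
  obtain ⟨m2, D, hD⟩ := (hc normConst⁻¹).mul ((isMultiplier_wave k).mul isMultiplier_sin)
  have e : probe q k = fun θ => if 0 ≤ θ then Complex.I / 2 * normConst⁻¹ *
      (wave θ k * jostWronskian q θ - -1 * (wave (-θ) k * crossWronskian q θ))
      else normConst⁻¹ * (wave θ k * Real.sin θ) := by
    funext θ
    rw [probe]
    congr 1
    ring
  rw [e]
  refine ⟨Measurable.ite measurableSet_Ici m1 m2, max C D, fun θ => ?_⟩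
  dsimp only
  split_ifs
  · exact (hC θ).trans (le_max_left _ _)
  · exact (hD θ).trans (le_max_right _ _)

/-- The factor `w` in the probe cancels the denominator of `T`, and the `crossWronskian` terms
cancel through the expansion of `f₊(-θ)` in `f₊` and `f₋`. Only even parts matter under the
integral, so the plane waves have been tested without leaving a quotient. -/
theorem planeWave_mul_probe_even {q : ℤ → ℝ} (hq : MemEllOneOne q) (k n : ℤ) {θ : ℝ}
    (h : Real.sin θ ≠ 0) (hθ : 0 < θ) :
    planeWave q n θ * probe q k θ + planeWave q n (-θ) * probe q k (-θ)
      = Real.sin θ * wave θ k * jostPlus q n θ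
        + Real.sin (-θ) * wave (-θ) k * jostPlus q n (-θ) := by
  have hw := jostWronskian_ne_zero hq h
  have hn := normConst_ne_zero
  have h1 := wronsk_expansion (jostPlus_spec hq θ).1 (jostMinus_spec hq θ).1
    (by simpa using (jostPlus_spec hq (-θ)).1.neg_angle :
      IsGeneralizedEigenfunction q θ fun n => jostPlus q n (-θ)) n
  have h2 : wronsk (fun n => jostPlus q n (-θ)) (fun n => jostMinus q n θ) 0
      = - crossWronskian q θ := by
    rw [crossWronskian_eq]; simp only [wronsk]; ring
  rw [← jostWronskian_eq, h2, wronsk_jostPlus_conj hq] at h1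
  rw [planeWave_of_nonneg _ _ hθ.le, planeWave_of_neg _ _ (neg_lt_zero.2 hθ), probe, probe,
    if_pos hθ.le, if_neg (by linarith), neg_neg, Real.sin_neg, transmission]
  have hI := Complex.I_mul_I
  rw [Complex.ofReal_neg]
  field_simp
  linear_combination (Real.sin θ : ℂ) * wave (-θ) k * h1 - Real.sin θ * jostPlus q n θ *
    (jostWronskian q θ * wave θ k + wave (-θ) k * crossWronskian q θ) * hI

theorem integral_planeWave_mul_probe {q : ℤ → ℝ} (hq : MemEllOneOne q) (k n : ℤ) :
    ∫ θ, planeWave q n θ * probe q k θ ∂torusMeasure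
      = ∫ θ in (-Real.pi)..Real.pi, Real.sin θ * wave θ k * jostPlus q n θ := by
  have hint : ∀ {g : ℝ → ℂ}, IsMultiplier g → Integrable g torusMeasure := fun hg =>
    hg.memLp.integrable (by norm_num)
  rw [← integral_torus]
  refine integral_eq_of_even_part (hint ((isMultiplier_planeWave hq n).mul
    (isMultiplier_probe hq k))) (hint ((isMultiplier_sin.mul (isMultiplier_wave k)).mul
    (isMultiplier_jostPlus hq n))) ?_
  filter_upwards [ae_sin_ne_zero] with θ h
  have h0 : θ ≠ 0 := fun h0 => h (by rw [h0, Real.sin_zero])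
  rcases lt_or_gt_of_ne h0 with h1 | h1
  · have := planeWave_mul_probe_even hq k n (θ := -θ) (by simpa using h) (by linarith)
    rw [neg_neg] at this
    linear_combination this
  · exact planeWave_mul_probe_even hq k n h h1

theorem adjointTransform_probe {q : ℤ → ℝ} (hq : MemEllOneOne q) (k n : ℤ) :
    adjointTransform hq (toL2 fun θ => (starRingEnd ℂ) (probe q k θ)) n
      = (starRingEnd ℂ) (∫ θ in (-Real.pi)..Real.pi,
          Real.sin θ * wave θ k * jostPlus q n θ) := by
  rw [adjointTransform_apply, inner_toL2 (memLp_planeWave hq n), ← integral_planeWave_mul_probe hq,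
    ← integral_conj]
  refine integral_congr_ae ?_
  filter_upwards [coeFn_toL2 (isMultiplier_probe hq k).conj.memLp] with θ h
  rw [h, map_mul]

theorem jostMinus_eq_wave {q : ℤ → ℝ} (hq : MemEllOneOne q) {N : ℕ}
    (h : ∀ n : ℤ, N < |n| → q n = 0) {n : ℤ} (hn : n ≤ -N) (θ : ℝ) :
    jostMinus q n θ = wave θ n := by
  rw [jostMinus_eq hq, jostPlus_eq_wave hq.reflect (N := N) (fun n hn => h _ (by rwa [abs_neg]))
    (by omega), wave_neg, neg_neg]

/-- To the left of the support `f₋` and its conjugate are plane waves, and `f₊` is expanded in them.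
-/
theorem sin_mul_jostPlus {q : ℤ → ℝ} (hq : MemEllOneOne q) {N : ℕ}
    (h : ∀ n : ℤ, N < |n| → q n = 0) {n : ℤ} (hn : n ≤ -N) (θ : ℝ) :
    Real.sin θ * jostPlus q n θ = Complex.I / 2 *
      (crossWronskian q (-θ) * wave θ n + jostWronskian q θ * wave (-θ) n) := by
  have h1 := wronsk_expansion (jostMinus_spec hq θ).1
    (by simpa using (jostMinus_spec hq (-θ)).1.neg_angle :
      IsGeneralizedEigenfunction q θ fun n => jostMinus q n (-θ)) (jostPlus_spec hq θ).1 n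
  have h2 : wronsk (fun n => jostPlus q n θ) (fun n => jostMinus q n (-θ)) 0
      = - crossWronskian q (-θ) := by
    rw [crossWronskian_eq, neg_neg]; simp only [wronsk]; ring
  have h3 : wronsk (fun n => jostMinus q n θ) (fun n => jostPlus q n θ) 0
      = - jostWronskian q θ := by
    rw [jostWronskian_eq]; simp only [wronsk]; ring
  rw [h2, h3, wronsk_jostMinus_conj hq, jostMinus_eq_wave hq h hn, jostMinus_eq_wave hq h hn] at h1
  have hI := Complex.I_mul_I
  linear_combination (-Complex.I / 2) * h1 + (Real.sin θ : ℂ) * jostPlus q n θ * hI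

/-- The Fourier coefficients of the Wronskian. -/
def wronskCoeff (q : ℤ → ℝ) (j : ℤ) : ℂ :=
  ∫ θ in (-Real.pi)..Real.pi, jostWronskian q θ * wave θ j

/-- Otherwise `w` would vanish almost everywhere, whereas it is nonzero off the thresholds. -/
theorem exists_wronskCoeff_ne_zero {q : ℤ → ℝ} (hq : MemEllOneOne q) :
    ∃ j, wronskCoeff q j ≠ 0 := by
  by_contra! h
  have hm := (isMultiplier_jostWronskian hq).memLp
  have h0 : toL2 (jostWronskian q) = 0 := eq_zero_of_inner_freeWave _ fun n => by
    rw [inner_toL2 (memLp_freeWave n), ← mul_zero normConst, ← h n, wronskCoeff, ← integral_torus,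
      ← integral_const_mul]
    refine integral_congr_ae ?_
    filter_upwards [coeFn_toL2 hm] with θ h1
    rw [h1, conj_freeWave]
    ring
  have hF : ∀ᵐ _ ∂torusMeasure, False := by
    filter_upwards [coeFn_toL2 hm, ae_sin_ne_zero, Lp.coeFn_zero ℂ 2 torusMeasure] with θ h1 h2 h3
    rw [h0, h3] at h1
    exact jostWronskian_ne_zero hq h2 h1.symm
  rw [eventually_false_iff_eq_bot, ae_eq_bot, Measure.restrict_eq_zero, Real.volume_Ioc,
    ENNReal.ofReal_eq_zero] at hF
  linarith [Real.pi_pos]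

theorem sin_mem_trigPoly : (fun θ => (Real.sin θ : ℂ)) ∈ trigPoly 1 := by
  have e : (fun θ => (Real.sin θ : ℂ)) = (-Complex.I / 2) • ((fun θ => wave θ 1)
      - fun θ => wave (-θ) 1) := by
    funext θ
    have := wave_one_sub θ
    simp only [Pi.smul_apply, Pi.sub_apply, smul_eq_mul]
    rw [this]
    linear_combination (Real.sin θ : ℂ) * Complex.I_mul_I
  rw [e]
  exact (trigPoly 1).smul_mem _ ((trigPoly 1).sub_mem (wave_mem_trigPoly (by simp))
    (wave_neg_mem_trigPoly (by simp)))

theorem exists_wronskian_mem_trigPoly {q : ℤ → ℝ} (hq : MemEllOneOne q) {N : ℕ}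
    (h : ∀ n : ℤ, N < |n| → q n = 0) :
    ∃ D, jostWronskian q ∈ trigPoly D ∧ (fun θ => crossWronskian q (-θ)) ∈ trigPoly D := by
  obtain ⟨D, hD⟩ := exists_trigPoly_jostPlus hq h {0, 1}
  obtain ⟨E, hE⟩ := exists_trigPoly_jostPlus hq.reflect (N := N)
    (fun n hn => h _ (by rwa [abs_neg])) {0, -1}
  have hp : ∀ n ∈ ({0, 1} : Finset ℤ), jostPlus q n ∈ trigPoly D := hD
  have hm : ∀ n ∈ ({0, 1} : Finset ℤ), jostMinus q n ∈ trigPoly E := fun n hn => by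
    rw [show jostMinus q n = jostPlus (reflect q) (-n) from funext fun θ => jostMinus_eq hq n θ]
    refine hE _ ?_
    fin_cases hn <;> simp
  refine ⟨D + E, (trigPoly _).sub_mem (mul_mem_trigPoly (hp 1 (by simp)) (hm 0 (by simp)))
    (mul_mem_trigPoly (hp 0 (by simp)) (hm 1 (by simp))), ?_⟩
  have h1 := mul_mem_trigPoly (hp 0 (by simp)) (comp_neg_mem_trigPoly (hm 1 (by simp)))
  have h2 := mul_mem_trigPoly (hp 1 (by simp)) (comp_neg_mem_trigPoly (hm 0 (by simp)))
  have h3 := (trigPoly _).sub_mem h1 h2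
  convert h3 using 1
  funext θ
  simp only [crossWronskian, neg_neg, Pi.sub_apply]
  ring

/-- For `k` very negative, all integrals against trigonometric polynomials of lower degree vanish.
Only the outgoing coefficient `w` of `f₊` to the left of the support survives. The images of the
probes are thus translates of one finitely supported sequence. -/
theorem exists_banded_probe {q : ℤ → ℝ} (hq : MemEllOneOne q) {N : ℕ}
    (h : ∀ n : ℤ, N < |n| → q n = 0) :
    ∃ D M : ℕ, (∀ j : ℤ, D < |j| → wronskCoeff q j = 0) ∧ ∀ k : ℤ, k ≤ -M → ∀ n,
      ∫ θ in (-Real.pi)..Real.pi, Real.sin θ * wave θ k * jostPlus q n θ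
        = Complex.I / 2 * wronskCoeff q (k - n) := by
  obtain ⟨D, hw, hc⟩ := exists_wronskian_mem_trigPoly hq h
  obtain ⟨E, hE⟩ := exists_trigPoly_jostPlus hq h (Finset.Icc (-N) N)
  have hband : ∀ j : ℤ, D < |j| → wronskCoeff q j = 0 := fun j hj =>
    integral_trigPoly_mul_wave hw hj
  -- The frequencies have to exceed the degree `D` of the Wronskians and the degree `1 + E` of `sin
  -- θ f₊` on the window, after a shift of at most `N`.
  refine ⟨D, N + D + E + 2, hband, fun k hk n => ?_⟩
  push_cast at hk
  rcases le_or_gt n (-N) with hn | hn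
  · have e : ∀ θ, (Real.sin θ : ℂ) * wave θ k * jostPlus q n θ = Complex.I / 2 *
        (crossWronskian q (-θ) * wave θ (n + k) + jostWronskian q θ * wave θ (k - n)) := fun θ => by
      rw [wave_add, sub_eq_add_neg, wave_add, ← wave_neg]
      linear_combination wave θ k * sin_mul_jostPlus hq h hn θ
    simp only [e]
    rw [intervalIntegral.integral_const_mul, intervalIntegral.integral_add,
      integral_trigPoly_mul_wave hc, zero_add, wronskCoeff]
    · rw [abs_of_neg (by omega)]; omega
    · exact ((continuous_of_mem_trigPoly hc).mul (continuous_wave _)).intervalIntegrable _ _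
    · exact ((continuous_of_mem_trigPoly hw).mul (continuous_wave _)).intervalIntegrable _ _
  · rw [hband (k - n) (by rw [abs_of_neg (by omega)]; omega), mul_zero]
    rcases le_or_gt n N with hn' | hn'
    · have e : ∀ θ, (Real.sin θ : ℂ) * wave θ k * jostPlus q n θ
          = Real.sin θ * jostPlus q n θ * wave θ k := fun θ => by ring
      simp only [e]
      refine integral_trigPoly_mul_wave (mul_mem_trigPoly sin_mem_trigPoly
        (hE n (Finset.mem_Icc.2 ⟨hn.le, hn'⟩))) ?_
      rw [abs_of_neg (by omega)]; push_cast; omega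
    · have e : ∀ θ, (Real.sin θ : ℂ) * wave θ k * jostPlus q n θ
          = Real.sin θ * wave θ (k - n) := fun θ => by
        rw [jostPlus_eq_wave hq h hn'.le, sub_eq_add_neg, wave_add, wave_neg]; ring
      simp only [e]
      refine integral_trigPoly_mul_wave sin_mem_trigPoly ?_
      rw [abs_of_neg (by omega)]; push_cast; omega

theorem mem_ker_transformOp_iff {q : ℤ → ℝ} (hq : MemEllOneOne q) {u : Ell2} :
    transformOp hq u = 0 ↔ ∀ f, inner ℂ (adjointTransform hq f) u = 0 := by
  refine ⟨fun h f => ?_, fun h => ext_inner_left ℂ fun f => ?_⟩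
  · rw [← ContinuousLinearMap.adjoint_inner_right]
    change inner ℂ f (transformOp hq u) = 0
    rw [h, inner_zero_right]
  · rw [transformOp, ContinuousLinearMap.adjoint_inner_right, h, inner_zero_right]

theorem tsum_wronskCoeff_eq_zero {q : ℤ → ℝ} (hq : MemEllOneOne q) {M : ℕ}
    (hM : ∀ k : ℤ, k ≤ -M → ∀ n,
      ∫ θ in (-Real.pi)..Real.pi, Real.sin θ * wave θ k * jostPlus q n θ
        = Complex.I / 2 * wronskCoeff q (k - n)) {u : Ell2} (hu : transformOp hq u = 0)
    {k : ℤ} (hk : k ≤ -M) : ∑' n, wronskCoeff q (k - n) * u n = 0 := by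
  have h := (mem_ker_transformOp_iff hq).1 hu (toL2 fun θ => (starRingEnd ℂ) (probe q k θ))
  rw [lp.inner_eq_tsum] at h
  have e : ∀ n, inner ℂ (adjointTransform hq (toL2 fun θ => (starRingEnd ℂ) (probe q k θ)) n) (u n)
      = Complex.I / 2 * (wronskCoeff q (k - n) * u n) := fun n => by
    rw [adjointTransform_probe, hM k hk, RCLike.inner_apply, Complex.conj_conj]
    ring
  simp only [e] at h
  rw [tsum_mul_left] at h
  exact (mul_eq_zero.1 h).resolve_left (div_ne_zero Complex.I_ne_zero two_ne_zero)

/-- A sequence that satisfies a linear recurrence to the left of a window on which it vanishes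
vanishes there. -/
theorem eq_zero_of_banded_recurrence {a u : ℤ → ℂ} {D M : ℕ} (ha : ∀ j : ℤ, D < |j| → a j = 0)
    (ha0 : ∃ j, a j ≠ 0) (hau : ∀ k : ℤ, k ≤ -M → ∑' n, a (k - n) * u n = 0)
    (hu : ∀ n : ℤ, |n| ≤ M + 2 * D → u n = 0) (n : ℤ) (hn : n ≤ 0) : u n = 0 := by
  -- With `j` the largest index where `a` is nonzero, the equation at `k = n + j` involves `u n` and
  -- only sites to its right, at distance at most `2 * D`. It therefore determines `u n`, and the
  -- induction moves left.
  obtain ⟨j, hj, hmax⟩ : ∃ j, a j ≠ 0 ∧ ∀ i, j < i → a i = 0 := by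
    obtain ⟨j, hj, hmax⟩ := Int.exists_greatest_of_bdd (P := fun j => a j ≠ 0)
      ⟨D, fun z hz => not_lt.1 fun hlt => hz (ha z (lt_of_lt_of_le hlt (le_abs_self z)))⟩ ha0
    exact ⟨j, hj, fun i hi => by_contra fun hai => (hmax i hai).not_gt hi⟩
  have hjD : |j| ≤ D := not_lt.1 fun h => hj (ha j h)
  have key : ∀ i : ℕ, ∀ n : ℤ, -(M + 2 * D : ℤ) - i ≤ n → n ≤ 0 → u n = 0 := by
    intro i
    induction i with
    | zero => intro n h1 h2; exact hu n (by rw [abs_of_nonpos h2]; push_cast at h1; omega)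
    | succ i ih =>
      intro n h1 h2
      rcases le_or_gt (-(M + 2 * D : ℤ) - i) n with h3 | h3
      · exact ih n h3 h2
      · have hs := hau (n + j) (by have := (abs_le.1 hjD).2; omega)
        rw [tsum_eq_single n] at hs
        · rw [add_sub_cancel_left] at hs
          exact (mul_eq_zero.1 hs).resolve_left hj
        · intro m hm
          rcases lt_or_gt_of_ne hm with hm | hm
          · rw [hmax _ (by omega), zero_mul]
          · by_cases hb : (D : ℤ) < |n + j - m|
            · rw [ha _ hb, zero_mul]
            · have h4 := (abs_le.1 (not_lt.1 hb)).1
              have h5 := (abs_le.1 hjD).2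
              push_cast at h1
              rw [ih m (by omega) (by omega), mul_zero]
  exact key (-n).toNat n (by omega) hn

theorem adjointTransform_reflect {q : ℤ → ℝ} (hq : MemEllOneOne q) (f : L2Torus) :
    adjointTransform hq.reflect f = flipSeq (adjointTransform hq (flipL2 f)) := by
  have e : ∀ n, (toL2 fun θ => planeWave q n (-θ)) = toL2 (planeWave (reflect q) (-n)) := fun n => by
    refine Lp.ext ?_
    filter_upwards [coeFn_toL2 (isMultiplier_planeWave hq n).comp_neg.memLp,
      coeFn_toL2 (memLp_planeWave hq.reflect (-n)), ae_sin_ne_zero] with θ h1 h2 h3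
    rw [h1, h2, planeWave_reflect hq _ (fun h0 => h3 (by rw [h0, Real.sin_zero])), neg_neg]
  ext n
  rw [flipSeq_apply, adjointTransform_apply, adjointTransform_apply,
    inner_flipL2 (memLp_planeWave hq _) (isMultiplier_planeWave hq _).comp_neg.memLp, e, neg_neg]

theorem transformOp_reflect_flipSeq {q : ℤ → ℝ} (hq : MemEllOneOne q) {u : Ell2}
    (hu : transformOp hq u = 0) : transformOp hq.reflect (flipSeq u) = 0 := by
  rw [mem_ker_transformOp_iff hq] at hu
  rw [mem_ker_transformOp_iff hq.reflect]
  intro f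
  rw [adjointTransform_reflect hq, LinearIsometry.inner_map_map, hu]

/-- The recurrence propagates zeros to the left, and the reflected potential handles the right;
elements of the kernel are determined by finitely many values. -/
theorem exists_window {q : ℤ → ℝ} (hq : MemEllOneOne q) {N : ℕ} (h : ∀ n : ℤ, N < |n| → q n = 0) :
    ∃ R : ℕ, ∀ u : Ell2, transformOp hq u = 0 → (∀ n : ℤ, |n| ≤ R → u n = 0) → u = 0 := by
  have left : ∀ {q : ℤ → ℝ} (hq : MemEllOneOne q), (∀ n : ℤ, N < |n| → q n = 0) →
      ∃ R : ℕ, ∀ u : Ell2, transformOp hq u = 0 → (∀ n : ℤ, |n| ≤ R → u n = 0) →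
        ∀ n : ℤ, n ≤ 0 → u n = 0 := fun {q} hq h => by
    obtain ⟨D, M, hD, hM⟩ := exists_banded_probe hq h
    refine ⟨M + 2 * D, fun u hu hz => eq_zero_of_banded_recurrence hD
      (exists_wronskCoeff_ne_zero hq) (fun k hk => tsum_wronskCoeff_eq_zero hq hM hu hk) ?_⟩
    exact fun n hn => hz n (by push_cast; exact hn)
  obtain ⟨R, hR⟩ := left hq h
  obtain ⟨S, hS⟩ := left hq.reflect fun n hn => h _ (by rwa [abs_neg])
  refine ⟨max R S, fun u hu hz => ?_⟩
  ext n
  rcases le_total n 0 with hn | hn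
  · exact hR u hu (fun m hm => hz m (hm.trans (by exact_mod_cast le_max_left _ _))) n hn
  · have := hS (flipSeq u) (transformOp_reflect_flipSeq hq hu) (fun m hm => hz _ (by
      rw [abs_neg]; exact hm.trans (by exact_mod_cast le_max_right _ _))) (-n) (by omega)
    rwa [flipSeq_apply, neg_neg] at this

theorem finiteDimensional_ker_transformOp {q : ℤ → ℝ} (hq : MemEllOneOne q) {N : ℕ}
    (h : ∀ n : ℤ, N < |n| → q n = 0) :
    FiniteDimensional ℂ (LinearMap.ker (transformOp hq : Ell2 →ₗ[ℂ] L2Torus)) := by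
  obtain ⟨R, hR⟩ := exists_window hq h
  let r : LinearMap.ker (transformOp hq : Ell2 →ₗ[ℂ] L2Torus) →ₗ[ℂ]
      (Finset.Icc (-R : ℤ) R → ℂ) :=
    { toFun := fun u n => (u : Ell2) n
      map_add' := fun _ _ => rfl
      map_smul' := fun _ _ => rfl }
  refine FiniteDimensional.of_injective r ((injective_iff_map_eq_zero r).2 fun u hu => ?_)
  refine Subtype.ext (hR u u.2 fun n hn => ?_)
  exact congrFun hu ⟨n, Finset.mem_Icc.2 (abs_le.1 hn)⟩

/-! ### The spectral gap on the kernel of the transform -/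

theorem norm_sq_le_of_eigenvalues {E : Type*} [NormedAddCommGroup E] [InnerProductSpace ℂ E]
    [FiniteDimensional ℂ E] {T : E →ₗ[ℂ] E} (hT : T.IsSymmetric) {c : ℝ} (hc : 0 ≤ c)
    (h : ∀ (r : ℝ) (v : E), v ≠ 0 → T v = (r : ℂ) • v → c ≤ |r|) (v : E) :
    c ^ 2 * ‖v‖ ^ 2 ≤ ‖T v‖ ^ 2 := by
  set b := hT.eigenvectorBasis rfl with hb
  rw [← b.repr.norm_map v, ← b.repr.norm_map (T v), EuclideanSpace.norm_sq_eq,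
    EuclideanSpace.norm_sq_eq, Finset.mul_sum]
  refine Finset.sum_le_sum fun i _ => ?_
  rw [hb, hT.eigenvectorBasis_apply_self_apply rfl, norm_mul, mul_pow]
  refine mul_le_mul_of_nonneg_right ?_ (sq_nonneg _)
  have h1 := h _ _ (b.orthonormal.ne_zero i) (hT.apply_eigenvectorBasis rfl i)
  simpa using pow_le_pow_left₀ hc h1 2

/-- The operator `H - 2`. -/
def centered (q : ℤ → ℝ) (hq : MemEllOneOne q) : Ell2 →L[ℂ] Ell2 :=
  hamiltonian q hq - (2 : ℂ) • ContinuousLinearMap.id ℂ Ell2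

theorem centered_apply (q : ℤ → ℝ) (hq : MemEllOneOne q) (u : Ell2) :
    centered q hq u = hamiltonian q hq u - (2 : ℂ) • u := rfl

theorem inner_centered (q : ℤ → ℝ) (hq : MemEllOneOne q) (u v : Ell2) :
    inner ℂ (centered q hq u) v = inner ℂ u (centered q hq v) := by
  rw [centered_apply, centered_apply, inner_sub_left, inner_sub_right, inner_hamiltonian,
    inner_smul_left, inner_smul_right, map_ofNat]

/-- The free counterpart of `H - 2`. -/
def centeredEnergy (f : L2Torus) : L2Torus := mulOp energy f - (2 : ℂ) • f

theorem transformOp_centered {q : ℤ → ℝ} (hq : MemEllOneOne q) (u : Ell2) :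
    transformOp hq (centered q hq u) = centeredEnergy (transformOp hq u) := by
  rw [centered_apply, map_sub, transformOp_hamiltonian, map_smul, centeredEnergy]

theorem centered_adjointTransform {q : ℤ → ℝ} (hq : MemEllOneOne q) (f : L2Torus) :
    centered q hq (adjointTransform hq f) = adjointTransform hq (centeredEnergy f) := by
  rw [centered_apply, hamiltonian_adjointTransform, centeredEnergy, map_sub, map_smul]

theorem eq_zero_of_centered_eq_smul {q : ℤ → ℝ} (hq : MemEllOneOne q) {r : ℝ} (hr : |r| < 2)
    {v : Ell2} (hv : centered q hq v = (r : ℂ) • v) : v = 0 := by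
  -- The angle solves `2(1 - cos θ) = 2 + r`.
  refine eq_zero_of_hamiltonian_eq_energy hq (θ := Real.arccos (-r / 2)) ?_
  have h := abs_lt.1 hr
  rw [centered_apply, sub_eq_iff_eq_add] at hv
  rw [hv, ← add_smul, energy, Real.cos_arccos (by linarith) (by linarith)]
  congr 1
  push_cast
  ring

/-- The kernel is invariant and finite dimensional, so `H - 2` is diagonalizable on it, and its
eigenvalues avoid `(-2, 2)`. -/
theorem norm_sq_centered_of_finite {q : ℤ → ℝ} (hq : MemEllOneOne q) {N : ℕ}
    (h : ∀ n : ℤ, N < |n| → q n = 0) {v : Ell2} (hv : transformOp hq v = 0) :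
    2 ^ 2 * ‖v‖ ^ 2 ≤ ‖centered q hq v‖ ^ 2 := by
  have := finiteDimensional_ker_transformOp hq h
  have hinv : ∀ v ∈ LinearMap.ker (transformOp hq : Ell2 →ₗ[ℂ] L2Torus),
      (centered q hq : Ell2 →ₗ[ℂ] Ell2) v
        ∈ LinearMap.ker (transformOp hq : Ell2 →ₗ[ℂ] L2Torus) := fun v hv => by
    change transformOp hq v = 0 at hv
    change transformOp hq (centered q hq v) = 0
    rw [transformOp_centered, hv, centeredEnergy, map_zero, smul_zero, sub_zero]
  have hT : (centered q hq : Ell2 →ₗ[ℂ] Ell2).IsSymmetric := inner_centered q hq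
  refine norm_sq_le_of_eigenvalues (hT.restrict_invariant hinv) zero_le_two (fun r w hw hr => ?_)
    ⟨v, hv⟩
  by_contra! hlt
  exact hw (Subtype.ext (eq_zero_of_centered_eq_smul hq hlt (congrArg Subtype.val hr)))

theorem norm_sq_add_of_ker {q : ℤ → ℝ} (hq : MemEllOneOne q) (f : L2Torus) {v : Ell2}
    (hv : transformOp hq v = 0) : ‖adjointTransform hq f + v‖ ^ 2 = ‖f‖ ^ 2 + ‖v‖ ^ 2 := by
  have h := norm_add_sq_eq_norm_sq_add_norm_sq_of_inner_eq_zero (𝕜 := ℂ) _ _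
    ((mem_ker_transformOp_iff hq).1 hv f)
  rw [norm_adjointTransform] at h
  simpa only [sq] using h

/-- Pythagoras for `u = F* F u + v` with `v` in the kernel, together with the gap on the kernel. As
the kernel varies with the potential, the gap is stated for all `u`, in terms that converge under
truncation. -/
theorem gap_of_finite {q : ℤ → ℝ} (hq : MemEllOneOne q) {N : ℕ}
    (h : ∀ n : ℤ, N < |n| → q n = 0) (u : Ell2) :
    ‖centeredEnergy (transformOp hq u)‖ ^ 2 + 2 ^ 2 * ‖u‖ ^ 2
      ≤ ‖centered q hq u‖ ^ 2 + 2 ^ 2 * ‖transformOp hq u‖ ^ 2 := by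
  set f := transformOp hq u with hf
  set v := u - adjointTransform hq f with hvdef
  have hv : transformOp hq v = 0 := by
    rw [hvdef, map_sub, transformOp_adjointTransform, ← hf, sub_self]
  have hu : u = adjointTransform hq f + v := by rw [hvdef]; abel
  have hBv : transformOp hq (centered q hq v) = 0 := by
    rw [transformOp_centered, hv, centeredEnergy, map_zero, smul_zero, sub_zero]
  have h1 := norm_sq_add_of_ker hq f hv
  have h2 := norm_sq_add_of_ker hq (centeredEnergy f) hBv
  rw [← centered_adjointTransform, ← map_add, ← hu] at h2
  rw [← hu] at h1
  have h3 := norm_sq_centered_of_finite hq h hv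
  rw [h1, h2]
  linarith

/-! ### Approximation by potentials of finite support -/

theorem norm_toL2_sub_sq {f g : ℝ → ℂ} (hf : MemLp f 2 torusMeasure) (hg : MemLp g 2 torusMeasure) :
    ‖toL2 f - toL2 g‖ ^ 2 = ∫ θ, ‖f θ - g θ‖ ^ 2 ∂torusMeasure := by
  rw [L2Torus.norm_sq]
  refine integral_congr_ae ?_
  filter_upwards [Lp.coeFn_sub (toL2 f) (toL2 g), coeFn_toL2 hf, coeFn_toL2 hg] with θ h1 h2 h3
  rw [h1, Pi.sub_apply, h2, h3]

theorem tendsto_toL2_planeWave_truncate {q : ℤ → ℝ} (hq : MemEllOneOne q) (n : ℤ) :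
    Tendsto (fun N => toL2 (planeWave (truncate q N) n)) atTop (𝓝 (toL2 (planeWave q n))) := by
  obtain ⟨C, hC⟩ := exists_planeWave_bound hq n
  have h : Tendsto (fun N => ∫ θ, ‖planeWave (truncate q N) n θ - planeWave q n θ‖ ^ 2
      ∂torusMeasure) atTop (𝓝 (∫ _, (0 : ℝ) ∂torusMeasure)) := by
    refine tendsto_integral_of_dominated_convergence (fun _ => (C + C) ^ 2) (fun N => ?_)
      (integrable_const _) (fun N => Eventually.of_forall fun θ => ?_)
      (Eventually.of_forall fun θ => ?_)
    · exact (((measurable_planeWave (hq.truncate N) n).sub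
        (measurable_planeWave hq n)).norm.pow_const 2).aestronglyMeasurable
    · rw [Real.norm_eq_abs, abs_of_nonneg (sq_nonneg _)]
      exact pow_le_pow_left₀ (norm_nonneg _) ((norm_sub_le _ _).trans
        (add_le_add (hC _ (abs_truncate_le q N) θ) (hC q (fun _ => le_rfl) θ))) 2
    · have := ((tendsto_planeWave_truncate hq n θ).sub_const (planeWave q n θ)).norm.pow 2
      simpa using this
  simp only [← norm_toL2_sub_sq (memLp_planeWave (hq.truncate _) n) (memLp_planeWave hq n),
    integral_zero] at h
  rw [tendsto_iff_norm_sub_tendsto_zero]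
  simpa using h.sqrt

theorem tendsto_transformOp_truncate {q : ℤ → ℝ} (hq : MemEllOneOne q) (u : Ell2) :
    Tendsto (fun N => transformOp (hq.truncate N) u) atTop (𝓝 (transformOp hq u)) := by
  rw [← tendsto_sub_nhds_zero_iff]
  refine tendsto_zero_of_total (Y := fun N => transformOp (hq.truncate N) - transformOp hq)
    (C := 2) (fun N u => ?_) (D := Set.range unitVec) ?_ (fun u hu => ?_) u
  · change ‖transformOp (hq.truncate N) u - transformOp hq u‖ ≤ _
    refine (norm_sub_le _ _).trans ?_
    linarith [norm_transformOp_le (hq.truncate N) u, norm_transformOp_le hq u]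
  · rintro _ ⟨n, rfl⟩
    have := tendsto_toL2_planeWave_truncate hq n
    simp only [← transformOp_unitVec hq, ← transformOp_unitVec (hq.truncate _)] at this
    exact tendsto_sub_nhds_zero_iff.2 this
  · ext n
    rw [← inner_unitVec, hu _ ⟨n, rfl⟩]
    rfl

theorem norm_potential_sub_truncate_le {q : ℤ → ℝ} (hq : MemEllOneOne q) (N : ℕ) :
    ‖potential (truncate q N) (hq.truncate N) - potential q hq‖ ≤ truncationError q N := by
  have h0 : 0 ≤ truncationError q N := tsum_nonneg fun _ => by positivity
  refine ContinuousLinearMap.opNorm_le_bound _ h0 fun u => ?_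
  refine Ell2.norm_le_of_forall_sum_le (mul_nonneg h0 (norm_nonneg _)) fun s => ?_
  rw [mul_pow]
  refine le_trans (Finset.sum_le_sum (g := fun n => truncationError q N ^ 2 * ‖u n‖ ^ 2)
    fun n _ => ?_) ?_
  · change ‖(truncate q N n : ℂ) * u n - (q n : ℂ) * u n‖ ^ 2 ≤ _
    rw [← sub_mul, norm_mul, mul_pow, ← Complex.ofReal_sub, Complex.norm_real, Real.norm_eq_abs,
      abs_sub_comm]
    exact mul_le_mul_of_nonneg_right (pow_le_pow_left₀ (abs_nonneg _)
      ((hq.sub_truncate N).abs_le n) 2) (sq_nonneg _)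
  · rw [← Finset.mul_sum]
    exact mul_le_mul_of_nonneg_left
      (sum_le_hasSum s (fun _ _ => sq_nonneg _) (Ell2.hasSum_norm_sq u)) (sq_nonneg _)

theorem tendsto_potential_truncate {q : ℤ → ℝ} (hq : MemEllOneOne q) :
    Tendsto (fun N => potential (truncate q N) (hq.truncate N)) atTop (𝓝 (potential q hq)) := by
  rw [tendsto_iff_norm_sub_tendsto_zero]
  exact squeeze_zero (fun _ => norm_nonneg _) (norm_potential_sub_truncate_le hq)
    hq.tendsto_truncationError

theorem tendsto_centered_truncate {q : ℤ → ℝ} (hq : MemEllOneOne q) (u : Ell2) :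
    Tendsto (fun N => centered (truncate q N) (hq.truncate N) u) atTop (𝓝 (centered q hq u)) := by
  have h1 : Continuous fun A : Ell2 →L[ℂ] Ell2 => A u := by fun_prop
  have h := (h1.tendsto _).comp (tendsto_potential_truncate hq)
  exact ((tendsto_const_nhds (x := -laplacian u)).add h).sub_const ((2 : ℂ) • u)

theorem continuous_centeredEnergy : Continuous centeredEnergy := by
  unfold centeredEnergy; fun_prop

theorem norm_sq_centered_of_ker {q : ℤ → ℝ} (hq : MemEllOneOne q) {u : Ell2}
    (hu : transformOp hq u = 0) : 2 ^ 2 * ‖u‖ ^ 2 ≤ ‖centered q hq u‖ ^ 2 := by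
  have hF := tendsto_transformOp_truncate hq u
  have h := le_of_tendsto_of_tendsto'
    ((((continuous_centeredEnergy.tendsto _).comp hF).norm.pow 2).add_const (2 ^ 2 * ‖u‖ ^ 2))
    (((tendsto_centered_truncate hq u).norm.pow 2).add ((hF.norm.pow 2).const_mul (2 ^ 2)))
    fun N => gap_of_finite (hq.truncate N) (fun _ => truncate_eq_zero q N) u
  rw [hu, centeredEnergy, map_zero, smul_zero, sub_zero, norm_zero] at h
  simpa using h

/-- Multiplication by the potential is a compact operator. -/
theorem isCompactOperator_potential {q : ℤ → ℝ} (hq : MemEllOneOne q) :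
    IsCompactOperator (potential q hq) := by
  refine isCompactOperator_of_tendsto (tendsto_potential_truncate hq)
    (Eventually.of_forall fun N => ?_)
  have e : potential (truncate q N) (hq.truncate N) = ∑ n ∈ Finset.Icc (-N : ℤ) N,
      (innerSL ℂ (unitVec n)).smulRight ((q n : ℂ) • unitVec n) := by
    ext u m
    rw [_root_.sum_apply, lp.coeFn_sum, Finset.sum_apply]
    change (truncate q N m : ℂ) * u m
      = ∑ n ∈ Finset.Icc (-N : ℤ) N, inner ℂ (unitVec n) u * ((q n : ℂ) * unitVec n m)
    simp only [inner_unitVec, unitVec_apply, mul_ite, mul_one, mul_zero]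
    rw [Finset.sum_ite_eq]
    simp only [Finset.mem_Icc, ← abs_le, truncate]
    split_ifs
    · rw [mul_comm]
    · simp
  rw [e]
  refine (compactOperator (RingHom.id ℂ) Ell2 Ell2).sum_mem fun n _ => ?_
  have h : IsCompactOperator (innerSL ℂ (unitVec n) : Ell2 →L[ℂ] ℂ) :=
    isCompactOperator_of_locallyCompactSpace_dom _
  exact h.clm_comp
    (ContinuousLinearMap.toSpanSingleton ℂ ((q n : ℂ) • unitVec n))

section

/-! ### Compactness criteria -/

/-- Positivity is tested on `M u - T u`, where `M = ‖T‖ + 1` is positive even for `T = 0`. -/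
theorem norm_sq_le_of_nonneg {E : Type*} [NormedAddCommGroup E] [InnerProductSpace ℂ E]
    {T : E →L[ℂ] E} (hT : ∀ u v, inner ℂ (T u) v = inner ℂ u (T v))
    (h0 : ∀ u, 0 ≤ (inner ℂ (T u) u).re) (u : E) :
    ‖T u‖ ^ 2 ≤ (‖T‖ + 1) * (inner ℂ (T u) u).re := by
  set M := ‖T‖ + 1
  have hM : 0 < M := by positivity
  have h := h0 ((M : ℂ) • u - T u)
  have e : (inner ℂ (T ((M : ℂ) • u - T u)) ((M : ℂ) • u - T u)).re
      = M ^ 2 * (inner ℂ (T u) u).re - 2 * M * ‖T u‖ ^ 2 + (inner ℂ (T (T u)) (T u)).re := by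
    have h1 : inner ℂ (T (T u)) u = inner ℂ (T u) (T u) := hT _ _
    have h2 : inner ℂ (T u) (T u) = ((‖T u‖ ^ 2 : ℝ) : ℂ) := by
      rw [inner_self_eq_norm_sq_to_K]; push_cast; rfl
    rw [map_sub, map_smul, inner_sub_left, inner_sub_right, inner_sub_right, inner_smul_left,
      inner_smul_right, inner_smul_left, inner_smul_right, h1, h2, Complex.conj_ofReal]
    simp only [Complex.sub_re, Complex.re_ofReal_mul, Complex.ofReal_re]
    ring
  have h3 : (inner ℂ (T (T u)) (T u)).re ≤ M * ‖T u‖ ^ 2 := by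
    refine (Complex.re_le_norm _).trans ((norm_inner_le_norm _ _).trans ?_)
    have h4 := T.le_opNorm (T u)
    have h5 := norm_nonneg (T u)
    nlinarith
  rw [e] at h
  have h6 : M * (‖T u‖ ^ 2) ≤ M * (M * (inner ℂ (T u) u).re) := by nlinarith
  exact le_of_mul_le_mul_left h6 hM

/-- A finite net for the image of the ball under `P` gives one for `T`: differences of points of the
ball have norm at most `2`, and `ε² / (2(c + 1))` is chosen so that the square stays below `ε²`. -/
theorem isCompactOperator_of_norm_sq_le {E F G : Type*} [NormedAddCommGroup E] [NormedSpace ℂ E]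
    [NormedAddCommGroup F] [NormedSpace ℂ F] [CompleteSpace F] [NormedAddCommGroup G]
    [NormedSpace ℂ G] {T : E →L[ℂ] F} {P : E →L[ℂ] G} (hP : IsCompactOperator P) {c : ℝ}
    (hc : 0 ≤ c) (h : ∀ u, ‖T u‖ ^ 2 ≤ c * ‖u‖ * ‖P u‖) : IsCompactOperator T := by
  refine (isCompactOperator_iff_isCompact_closure_image_ball (T : E →ₗ[ℂ] F) zero_lt_one).2 ?_
  refine (TotallyBounded.closure ?_).isCompact_of_isClosed isClosed_closure
  have hPb : TotallyBounded (P '' Metric.ball 0 1) :=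
    ((isCompactOperator_iff_isCompact_closure_image_ball (P : E →ₗ[ℂ] G) zero_lt_one).1
      hP).totallyBounded.subset subset_closure
  rw [Metric.totallyBounded_iff]
  intro ε hε
  obtain ⟨t, ht, hfin, hcov⟩ := Set.exists_subset_image_finite_and.1
    (hPb.exists_subset (Metric.dist_mem_uniformity (ε := ε ^ 2 / (2 * (c + 1))) (by positivity)))
  refine ⟨T '' t, hfin.image _, ?_⟩
  rintro _ ⟨u, hu, rfl⟩
  obtain ⟨_, hy, hd⟩ := Set.mem_iUnion₂.1 (hcov ⟨u, hu, rfl⟩)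
  obtain ⟨v, hv, rfl⟩ := hy
  refine Set.mem_iUnion₂.2 ⟨T v, ⟨v, hv, rfl⟩, ?_⟩
  change dist (T u) (T v) < ε
  change dist (P u) (P v) < _ at hd
  rw [dist_eq_norm, ← map_sub] at hd ⊢
  have h1 : ‖u - v‖ ≤ 2 := by
    have h2 := ht hv
    rw [mem_ball_zero_iff] at hu h2
    linarith [norm_sub_le u v]
  have h3 : ‖T (u - v)‖ ^ 2 < ε ^ 2 := by
    calc ‖T (u - v)‖ ^ 2 ≤ c * ‖u - v‖ * ‖P (u - v)‖ := h _
      _ ≤ c * 2 * (ε ^ 2 / (2 * (c + 1))) := by gcongr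
      _ = ε ^ 2 * (c / (c + 1)) := by field_simp
      _ < ε ^ 2 * 1 := by
        refine mul_lt_mul_of_pos_left ?_ (by positivity)
        rw [div_lt_one (by positivity)]
        linarith
      _ = ε ^ 2 := mul_one _
  exact lt_of_pow_lt_pow_left₀ 2 hε.le h3

/-! ### Completeness -/

variable {q : ℤ → ℝ} (hq : MemEllOneOne q)

/-- `H - 2` is minus the sum of two isometric shifts, plus the potential; so `(H-2)²` exceeds `4`
only by a term that the compact operator `q` controls. -/
theorem norm_sq_centered_le (u : Ell2) : ‖centered q hq u‖ ^ 2 ≤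
    2 ^ 2 * ‖u‖ ^ 2 + (4 + ‖potential q hq‖) * ‖u‖ * ‖potential q hq u‖ := by
  have e : centered q hq u = -(shift 1 u + shift (-1) u) + potential q hq u := by
    change -(shift 1 u + shift (-1) u - (2 : ℂ) • u) + potential q hq u - (2 : ℂ) • u = _
    abel
  have h1 : ‖centered q hq u‖ ≤ 2 * ‖u‖ + ‖potential q hq u‖ := by
    rw [e]
    refine (norm_add_le _ _).trans (add_le_add_left ?_ _)
    rw [norm_neg]
    refine (norm_add_le _ _).trans ?_
    rw [LinearIsometry.norm_map, LinearIsometry.norm_map, two_mul]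
  have h2 := (potential q hq).le_opNorm u
  have h3 := norm_nonneg (potential q hq u)
  nlinarith [norm_nonneg (centered q hq u), pow_le_pow_left₀ (norm_nonneg _) h1 2]

/-- The part of the continuous subspace on which the transform vanishes. -/
def defect : Submodule ℂ Ell2 :=
  LinearMap.ker (transformOp hq : Ell2 →ₗ[ℂ] L2Torus) ⊓ continuousSubspace q hq

theorem isClosed_defect : IsClosed (defect hq : Set Ell2) :=
  (transformOp hq).isClosed_ker.inter (Submodule.isClosed_orthogonal _)

instance : CompleteSpace (defect hq) := (isClosed_defect hq).completeSpace_coe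

theorem centered_mem_defect {u : Ell2} (hu : u ∈ defect hq) : centered q hq u ∈ defect hq := by
  refine ⟨?_, ?_⟩
  · have h : transformOp hq u = 0 := hu.1
    change transformOp hq (centered q hq u) = 0
    rw [transformOp_centered, h, centeredEnergy, map_zero, smul_zero, sub_zero]
  · rw [SetLike.mem_coe, mem_continuousSubspace_iff]
    intro z v hv
    rw [← inner_centered, centered_apply, hv, ← sub_smul, inner_smul_left,
      (mem_continuousSubspace_iff hq).1 hu.2 z v hv, mul_zero]

theorem eq_zero_of_mem_defect {z : ℂ} {u : Ell2} (hu : u ∈ defect hq)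
    (hz : centered q hq u = z • u) : u = 0 := by
  rw [centered_apply, sub_eq_iff_eq_add, ← add_smul] at hz
  exact inner_self_eq_zero.1 ((mem_continuousSubspace_iff hq).1 hu.2 _ u hz)

/-- The operator `(H - 2)² - 4` on the defect space. -/
def defectOp : defect hq →L[ℂ] defect hq :=
  (centered q hq ∘L centered q hq - (4 : ℂ) • ContinuousLinearMap.id ℂ Ell2).restrict
    fun _ hu => (defect hq).sub_mem (centered_mem_defect hq (centered_mem_defect hq hu))
      ((defect hq).smul_mem 4 hu)

theorem coe_defectOp (u : defect hq) : (defectOp hq u : Ell2)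
    = centered q hq (centered q hq u) - (4 : ℂ) • (u : Ell2) := rfl

theorem inner_defectOp (u v : defect hq) :
    inner ℂ (defectOp hq u) v = inner ℂ u (defectOp hq v) := by
  rw [Submodule.coe_inner, Submodule.coe_inner, coe_defectOp, coe_defectOp, inner_sub_left,
    inner_sub_right, inner_centered, inner_centered, inner_smul_left, inner_smul_right, map_ofNat]

theorem re_inner_defectOp (u : defect hq) : (inner ℂ (defectOp hq u) u).re
    = ‖centered q hq u‖ ^ 2 - 2 ^ 2 * ‖(u : Ell2)‖ ^ 2 := by
  have h : ∀ x : Ell2, inner ℂ x x = ((‖x‖ ^ 2 : ℝ) : ℂ) := fun x => by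
    rw [inner_self_eq_norm_sq_to_K]; push_cast; rfl
  rw [Submodule.coe_inner, coe_defectOp, inner_sub_left, inner_centered, inner_smul_left,
    map_ofNat, h, h, ← Complex.ofReal_ofNat, ← Complex.ofReal_mul, ← Complex.ofReal_sub,
    Complex.ofReal_re]
  norm_num

/-- The quadratic form is nonnegative by the gap on the kernel and at most a multiple of `‖u‖ ‖q
u‖`. For a nonnegative operator the form controls the norm. -/
theorem isCompactOperator_defectOp : IsCompactOperator (defectOp hq) := by
  refine isCompactOperator_of_norm_sq_le (P := potential q hq ∘L (defect hq).subtypeL)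
    (c := (‖defectOp hq‖ + 1) * (4 + ‖potential q hq‖))
    ((isCompactOperator_potential hq).comp_clm _) (by positivity) fun u => ?_
  refine (norm_sq_le_of_nonneg (inner_defectOp hq) (fun u => ?_) u).trans ?_
  · rw [re_inner_defectOp]
    linarith [norm_sq_centered_of_ker hq u.2.1]
  · rw [re_inner_defectOp, mul_assoc, mul_assoc]
    refine mul_le_mul_of_nonneg_left ?_ (by positivity)
    have := norm_sq_centered_le hq u
    change _ ≤ (4 + ‖potential q hq‖) * (‖(u : Ell2)‖ * ‖potential q hq u‖)
    linarith

/-- A compact symmetric operator without eigenvectors acts on the zero space only, and eigenvectors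
here would give eigenvectors of `H` orthogonal to themselves. -/
theorem defect_eq_bot : defect hq = ⊥ := by
  have hspec := ContinuousLinearMap.orthogonalComplement_iSup_eigenspaces_eq_bot
    (isCompactOperator_defectOp hq) (inner_defectOp hq)
  have hE : ∀ μ : ℂ, Module.End.eigenspace (defectOp hq : Module.End ℂ (defect hq)) μ = ⊥ := by
    intro μ
    rw [Submodule.eq_bot_iff]
    intro u hu
    have h1 : centered q hq (centered q hq u) = (4 + μ) • (u : Ell2) := by
      have h2 := congrArg Subtype.val (Module.End.mem_eigenspace_iff.1 hu)
      change centered q hq (centered q hq u) - (4 : ℂ) • (u : Ell2) = μ • (u : Ell2) at h2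
      rw [sub_eq_iff_eq_add.1 h2, ← add_smul, add_comm]
    -- Factor `(B - c)(B + c) u = 0` with `B = H - 2`. If `(B + c) u` is nonzero it is an
    -- eigenvector of `B`; if it is zero then `u` is one, unless `u = 0`.
    obtain ⟨c, hc⟩ := IsAlgClosed.exists_eq_mul_self (4 + μ)
    have h3 : centered q hq u + c • (u : Ell2) = 0 :=
      eq_zero_of_mem_defect hq (z := c) ((defect hq).add_mem (centered_mem_defect hq u.2)
        ((defect hq).smul_mem c u.2)) (by
          rw [map_add, map_smul, h1, hc, smul_add, smul_smul, add_comm])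
    exact Subtype.ext (eq_zero_of_mem_defect hq (z := -c) u.2 (by
      rw [eq_neg_of_add_eq_zero_left h3, neg_smul]))
  simp only [hE, iSup_bot, Submodule.bot_orthogonal_eq_top] at hspec
  rw [Submodule.eq_bot_iff]
  intro u hu
  have : (⟨u, hu⟩ : defect hq) ∈ (⊤ : Submodule ℂ (defect hq)) := trivial
  rw [hspec, Submodule.mem_bot] at this
  exact congrArg Subtype.val this

theorem adjointTransform_transformOp {u : Ell2} (hu : u ∈ continuousSubspace q hq) :
    adjointTransform hq (transformOp hq u) = u := by
  have h : u - adjointTransform hq (transformOp hq u) ∈ defect hq := by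
    refine ⟨?_, (continuousSubspace q hq).sub_mem hu (adjointTransform_mem hq _)⟩
    change transformOp hq (u - adjointTransform hq (transformOp hq u)) = 0
    rw [map_sub, transformOp_adjointTransform, sub_self]
  rw [defect_eq_bot, Submodule.mem_bot] at h
  exact (sub_eq_zero.1 h).symm

/-- The distorted Fourier transform as a unitary operator on the continuous subspace. -/
def transformEquiv : continuousSubspace q hq ≃ₗᵢ[ℂ] L2Torus where
  toFun u := transformOp hq u
  map_add' u v := map_add (transformOp hq) (u : Ell2) v
  map_smul' c u := map_smul (transformOp hq) c (u : Ell2)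
  invFun f := ⟨adjointTransform hq f, adjointTransform_mem hq f⟩
  left_inv u := Subtype.ext (adjointTransform_transformOp hq u.2)
  right_inv f := transformOp_adjointTransform hq f
  norm_map' u := by
    change ‖transformOp hq u‖ = ‖(u : Ell2)‖
    rw [← norm_adjointTransform hq, adjointTransform_transformOp hq u.2]

end

end

end DiscreteSchrodinger

theorem lemma2p9 (q : ℤ → ℝ) (hq : MemEllOneOne q) :
    -- the Jost functions exist and are unique
    (∀ θ : ℝ, (∃! f : ℤ → ℂ, IsJostPlus q θ f) ∧ ∃! f : ℤ → ℂ, IsJostMinus q θ f) ∧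
    -- the denominator of `T(θ)` does not vanish away from `0` and `π`
    (∀ θ : ℝ, Real.sin θ ≠ 0 → jostWronskian q θ ≠ 0) ∧
    -- the series that define `F` and `F₀` make sense and converge in `L²(𝕋)`
    (∀ n : ℤ, MeasureTheory.MemLp (planeWave q n) 2 torusMeasure ∧
      MeasureTheory.MemLp (freeWave n) 2 torusMeasure) ∧
    (∀ u : Ell2, Summable (transformTerm (planeWave q) u) ∧
      Summable (transformTerm freeWave u)) ∧
    -- `F` is an isometric isomorphism of `ℓ²_c(H)` onto `L²(𝕋)`
    ∃ Φ : continuousSubspace q hq ≃ₗᵢ[ℂ] L2Torus,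
      (∀ u : continuousSubspace q hq, Φ u = distortedFourier q (u : Ell2)) ∧
      -- its inverse is `F*`
      (∀ (f : L2Torus) (n : ℤ), (Φ.symm f : Ell2) n = distortedFourierAdj q f n) ∧
      -- `F` diagonalizes `H`
      (∀ u : Ell2, distortedFourier q (hamiltonian q hq u) =ᵐ[torusMeasure]
        fun θ => ((2 * (1 - Real.cos θ) : ℝ) : ℂ) * distortedFourier q u θ) ∧
      -- the strong limit of `e^{itH} e^{itΔ}` as `t → -∞` exists and is `F* F₀`
      (∀ u : Ell2, Filter.Tendsto
        (fun t : ℝ => expI (hamiltonian q hq) t (expI laplacian t u))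
        Filter.atBot (𝓝 (Φ.symm (fourierSeries u) : Ell2))) ∧
      -- the strong limit as `t → +∞` exists and is `G* F₀`, where `G` is the transform
      -- built from the plane waves `conj ψ(n, -θ)`
      (∀ u : Ell2, ∃ w : Ell2,
        (∀ n : ℤ, w n = ∫ θ in (-Real.pi)..Real.pi,
          planeWave q n (-θ) * fourierSeries u θ) ∧
        Filter.Tendsto
          (fun t : ℝ => expI (hamiltonian q hq) t (expI laplacian t u))
          Filter.atTop (𝓝 w)) := by
  refine ⟨fun θ => ⟨⟨_, jostPlus_spec hq θ, fun f hf => hf.unique (jostPlus_spec hq θ)⟩,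
    ⟨_, jostMinus_spec hq θ, fun f hf => ?_⟩⟩, fun θ => jostWronskian_ne_zero hq,
    fun n => ⟨memLp_planeWave hq n, memLp_freeWave n⟩,
    fun u => ⟨(hasSum_transformOp hq u).summable, (hasSum_freeCoeff_symm u).summable⟩,
    transformEquiv hq, fun u => (distortedFourier_eq hq u).symm, fun f n => adjointTransform_eq hq f n,
    fun u => ?_, fun u => ?_, fun u => ?_⟩
  · have h := (isJostMinus_iff.1 hf).unique (isJostMinus_iff.1 (jostMinus_spec hq θ))
    funext n
    simpa using congrFun h (-n)
  · rw [distortedFourier_eq hq, distortedFourier_eq hq, transformOp_hamiltonian]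
    exact coeFn_mulOp isMultiplier_energy _
  · rw [fourierSeries_eq]
    exact tendsto_wave_atBot hq u
  · rw [fourierSeries_eq]
    exact exists_wave_atTop hq u
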